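/- Let $P$ be a complex polynomial of degree $d$ which is strongly generic, meaning that all roots of $P$ and all roots of $P'$ are simple, and let $\alpha$ be a real number with $0<\alpha<d$. For $n\ge 1$ put $m_n=\lfloor \alpha n\rfloor$ and $R_n=\frac{d^{m_n}}{dz^{m_n}}\bigl(P(z)^n\bigr)$, a polynomial of degree $dn-m_n$; let $\mu_n=\frac{1}{dn-m_n}\sum_{\zeta}\delta_\zeta$ be its root-counting measure (the sum is over the roots of $R_n$, counted with multiplicity) and $\mathcal C_n(z)=\frac{R_n'(z)}{(dn-m_n)R_n(z)}$ the Cauchy transform of $\mu_n$. Then the sequence $\mu_n$ converges weakly, as $n\to\infty$, to a probability measure $\mu_{\alpha,P}$ on $\mathbb C$. Moreover, for Lebesgue-almost every $z\in\mathbb C$ the limit $\mathcal C(z)=\lim_{n\to\infty}\mathcal C_n(z)$ exists, is equal to the (absolutely convergent) Cauchy transform $\int_{\mathbb C}\frac{d\mu_{\alpha,P}(\xi)}{z-\xi}$ of $\mu_{\alpha,P}$, and satisfies the algebraic equation $$\sum_{k=0}^{d}\frac{\alpha^{k-1}(\alpha-k)(d-\alpha)^{d-k}}{k!}\,P^{(k)}(z)\,\mathcal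 C(z)^{d-k}=0 .$$ Equivalently, $\mathcal C(z)\neq 0$, $P$ does not vanish at $w=z+\frac{\alpha}{(d-\alpha)\mathcal C(z)}$, and $$(d-\alpha)\,\mathcal C(z)=(\log P)'(w)=\frac{P'(w)}{P(w)} ;$$ these two equations are equivalent for all complex values of $z$ and $\mathcal C$. -/

import Mathlib

open MeasureTheory Filter Topology Polynomial

noncomputable section

/-- `P` is strongly generic: all roots of `P` and all roots of `P'` are simple. -/
def StronglyGeneric (P : ℂ[X]) : Prop :=
  P.roots.Nodup ∧ P.derivative.roots.Nodup

/-- The Rodrigues descendant `d^m (P^n) / dz^m`. -/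
def rodrigues (m n : ℕ) (P : ℂ[X]) : ℂ[X] :=
  Polynomial.derivative^[m] (P ^ n)

/-- The unit point mass at `z`. -/
def pointMass (z : ℂ) : FiniteMeasure ℂ :=
  ⟨Measure.dirac z, inferInstance⟩

/-- The root-counting measure `(1 / deg Q) ∑ δ(ζ)` of a polynomial `Q`, the sum running over the
roots `ζ` of `Q` with multiplicity. It is a probability measure if `Q` is not constant (and it is
zero if `Q` is constant). -/
def rootCountingMeasure (Q : ℂ[X]) : FiniteMeasure ℂ :=
  (Q.natDegree : NNReal)⁻¹ • (Q.roots.map pointMass).sum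

/-- The Cauchy transform `R' / ((d n - m) R)` of the root-counting measure of the Rodrigues
descendant `R = d^m (P^n) / dz^m`, where `d = deg P`. -/
def rodriguesCauchy (m n : ℕ) (P : ℂ[X]) (z : ℂ) : ℂ :=
  (rodrigues m n P).derivative.eval z /
    (((P.natDegree : ℂ) * n - m) * (rodrigues m n P).eval z)

/-- The Cauchy transform `∫ dμ(ξ) / (z - ξ)` of a measure `μ` on the complex plane. -/
def cauchyTransform (μ : Measure ℂ) (z : ℂ) : ℂ :=
  ∫ ξ, (z - ξ)⁻¹ ∂μ

/-- The algebraic equation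
`∑ k = 0..d, α ^ (k-1) (α - k) (d - α) ^ (d-k) / k! * P^{(k)}(z) * c ^ (d-k) = 0`
between `z` and `c`; the exponent `k - 1` is an integer (it is `-1` for `k = 0`). -/
def SymbolEquation (P : ℂ[X]) (α : ℝ) (z c : ℂ) : Prop :=
  ∑ k ∈ Finset.range (P.natDegree + 1),
    ((α : ℂ) ^ ((k : ℤ) - 1) * ((α : ℂ) - k) * ((P.natDegree : ℂ) - α) ^ (P.natDegree - k) /
        (k.factorial : ℂ)) *
      (Polynomial.derivative^[k] P).eval z * c ^ (P.natDegree - k) = 0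

/-- The equation `(d - α) c = (log P)'(z + α / ((d - α) c))` between `z` and `c`; that its two
sides are meaningful (`c ≠ 0`, and `P` does not vanish at the argument) is part of it. -/
def LogDerivEquation (P : ℂ[X]) (α : ℝ) (z c : ℂ) : Prop :=
  c ≠ 0 ∧ P.eval (z + α / (((P.natDegree : ℂ) - α) * c)) ≠ 0 ∧
    ((P.natDegree : ℂ) - α) * c =
      logDeriv (fun u : ℂ => P.eval u) (z + α / (((P.natDegree : ℂ) - α) * c))

end

open MeasureTheory Filter Topology Polynomial

/-! Let A_k(z) be the k-th Taylor coefficient of P^n at z. Then R_n(z) = m! A_m(z) with m = m_n,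
A_m' = (m+1) A_{m+1}, and C_n(z) is A_m'/(n A_m) divided by d - m/n. So the theorem reduces to
showing that, for almost every z, A_m'/(n A_m) tends to P'(w)/P(w) at a suitable critical point w of
|P(w)|/|w - z|^α. The critical equation P'(w)/P(w) = α/(w - z) is then the logarithmic equation for
the limit, and Taylor expansion of P at z identifies it with the symbol equation
(`symbolEquation_iff_logDerivEquation`).

The relevant critical point is a mountain pass. Let the basin of z at level l be the component
containing z of the set where |P(w)| > l |w - z|^α, and let l(z) be the smallest level at which the
basin is bounded (`passLevel`). Cauchy's formula on a contour hugging the basin gives |A_k(z)| ≤ C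
n^2 l(z)^n for k near αn (`exists_norm_coeff_taylor_le`). At level l(z) the basin touches the rest
of the superlevel set, whose components are all unbounded, and it can do so only at a critical
point.

No steepest descent contour is built for the matching lower bound. Instead let H_n(z, w) be the
Taylor polynomial of P^n at z of degree < m, evaluated at w and divided by P(w)^n (`headRatio`). Its
z-derivative telescopes to m A_m(z) (w - z)^(m-1) / P(w)^n, and its w-derivative involves only the
last few A_k with k < m, because P^n satisfies (P^n)' P = n P' P^n. By the upper bound both are
exponentially small where |P(w)| > l(z) |w - z|^α. Hence H_n tends to 1 on the basin and to 0 on the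
unbounded components: it jumps across the pass w₀.

Let ξ(v) be the point z for which v is critical. Along a short segment v = w + x e the derivative of
H_n(ξ(v), w) is G_n(v) times a kernel close to exp(-n x^2), where G_n(v) is A_m(ξ(v)) suitably
normalised. Its integral is the jump, which has a nonzero limit. A bootstrap starting from the
polynomial bound on G_n shows that G_n has exact order √n near w₀ and that G_n'/(n G_n) tends to 0
(`tendsto_logDeriv_of_integral_tendsto`). Unwinding the normalisation gives the limit of A_m'/(n
A_m) (`exists_tendsto_coeff_ratio`).

The argument needs nondegenerate critical points with distinct critical values, which holds off a
null set of z (`ae_generic`). Finally the roots of R_n stay in a fixed compact set by Gauss–Lucas,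
Cauchy transforms pass to weak limits almost everywhere, and they determine the measure; so almost
everywhere convergence of C_n forces weak convergence of the root measures. -/

/-! ### Equivalence of the two algebraic equations -/

theorem natDegree_pos_of_lt {P : ℂ[X]} {α : ℝ} (hα : 0 < α) (hαd : α < (P.natDegree : ℝ)) :
    0 < P.natDegree := by
  have : (0 : ℝ) < P.natDegree := hα.trans hαd
  exact_mod_cast this

theorem eval_derivative_ne_zero_of_nodup_roots {P : ℂ[X]} (hP0 : P ≠ 0) (hP : P.roots.Nodup)
    {w : ℂ} (hw : P.eval w = 0) : P.derivative.eval w ≠ 0 := by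
  intro h
  have h1 : 1 < P.rootMultiplicity w :=
    (one_lt_rootMultiplicity_iff_isRoot hP0).2 ⟨hw, h⟩
  rw [← count_roots] at h1
  have := Multiset.nodup_iff_count_le_one.1 hP w
  omega

theorem sum_derivative_eval_eq_eval_add (P : ℂ[X]) (z u : ℂ) :
    ∑ k ∈ Finset.range (P.natDegree + 1),
      (derivative^[k] P).eval z * u ^ k / (k.factorial : ℂ) = P.eval (z + u) := by
  have h2 : P.eval (z + u) = (taylor z P).eval u := by
    rw [taylor_eval, add_comm]
  rw [h2, eval_eq_sum_range, natDegree_taylor]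
  refine Finset.sum_congr rfl fun k _ => ?_
  rw [taylor_coeff, ← factorial_smul_hasseDeriv]
  have : (k.factorial : ℂ) ≠ 0 := by exact_mod_cast k.factorial_ne_zero
  rw [LinearMap.smul_apply, eval_smul, nsmul_eq_mul]
  field_simp

/-- This is the Euler operator u d/du applied to the Taylor expansion of P at z; it accounts for the
factor k in the coefficient α - k. -/
theorem sum_mul_derivative_eval_eq (P : ℂ[X]) (z u : ℂ) :
    ∑ k ∈ Finset.range (P.natDegree + 1),
      (k : ℂ) * ((derivative^[k] P).eval z * u ^ k / (k.factorial : ℂ)) =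
        u * P.derivative.eval (z + u) := by
  have h := sum_derivative_eval_eq_eval_add P.derivative z u
  by_cases hd : P.natDegree = 0
  · rw [hd]
    have : P.derivative = 0 := by
      rw [eq_C_of_natDegree_eq_zero hd]; simp
    simp [this]
  have hd' : P.derivative.natDegree + 1 = P.natDegree := by
    rw [natDegree_derivative]; omega
  rw [Finset.sum_range_succ', ← h, hd', Finset.mul_sum]
  simp only [Nat.cast_zero, zero_mul, add_zero]
  refine Finset.sum_congr rfl fun k _ => ?_
  rw [Function.iterate_succ_apply, Nat.factorial_succ]
  have : (k.factorial : ℂ) ≠ 0 := by exact_mod_cast k.factorial_ne_zero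
  have : (k : ℂ) + 1 ≠ 0 := by exact_mod_cast k.succ_ne_zero
  push_cast
  field_simp
  ring

/-- With u = α / ((d - α) c), the factor (d - α) c equals α/u, and the left side of the symbol
equation collapses to a nonzero multiple of α P(z + u) - u P'(z + u). -/
theorem symbolEquation_iff_logDerivEquation {P : ℂ[X]} (hP : P.roots.Nodup) {α : ℝ} (hα : 0 < α)
    (hαd : α < (P.natDegree : ℝ)) (z c : ℂ) :
    SymbolEquation P α z c ↔ LogDerivEquation P α z c := by
  have hd := natDegree_pos_of_lt hα hαd
  have hP0 : P ≠ 0 := by rintro rfl; simp at hd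
  have hα0 : (α : ℂ) ≠ 0 := by exact_mod_cast hα.ne'
  have hdα : (P.natDegree : ℂ) - α ≠ 0 := by
    rw [sub_ne_zero]; exact_mod_cast hαd.ne'
  by_cases hc : c = 0
  · subst hc
    refine iff_of_false ?_ fun h => h.1 rfl
    -- At c = 0 only the term k = d survives, and it equals α^(d-1) (α - d) times the leading
    -- coefficient.
    rw [SymbolEquation, Finset.sum_eq_single P.natDegree]
    · have hlead : (derivative^[P.natDegree] P).eval z = P.natDegree.factorial * P.leadingCoeff := by
        rw [← factorial_smul_hasseDeriv, LinearMap.smul_apply, hasseDeriv_natDegree_eq_C]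
        simp
      rw [hlead]
      have h3 : (α : ℂ) - P.natDegree ≠ 0 := by rw [← neg_sub]; exact neg_ne_zero.2 hdα
      have h4 : (P.natDegree.factorial : ℂ) ≠ 0 := by exact_mod_cast P.natDegree.factorial_ne_zero
      simp [zpow_ne_zero, hα0, h3, h4, hP0]
    · intro k hk hk'
      have : P.natDegree - k ≠ 0 := by
        have := Finset.mem_range.1 hk; omega
      simp [this]
    · intro h; exact absurd (Finset.mem_range.2 (Nat.lt_succ_self _)) h
  set u : ℂ := α / (((P.natDegree : ℂ) - α) * c) with hu
  have hu0 : u ≠ 0 := div_ne_zero hα0 (mul_ne_zero hdα hc)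
  have huc : ((P.natDegree : ℂ) - α) * c = α / u := by
    rw [hu]; field_simp
  have key : ∑ k ∈ Finset.range (P.natDegree + 1),
      ((α : ℂ) ^ ((k : ℤ) - 1) * ((α : ℂ) - k) * ((P.natDegree : ℂ) - α) ^ (P.natDegree - k) /
        (k.factorial : ℂ)) *
      (Polynomial.derivative^[k] P).eval z * c ^ (P.natDegree - k) =
      (α / u) ^ P.natDegree * (α : ℂ)⁻¹ *
        (α * P.eval (z + u) - u * P.derivative.eval (z + u)) := by
    rw [← sum_derivative_eval_eq_eval_add, ← sum_mul_derivative_eval_eq, Finset.mul_sum,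
      ← Finset.sum_sub_distrib, Finset.mul_sum]
    refine Finset.sum_congr rfl fun k hk => ?_
    have hk' : k ≤ P.natDegree := Nat.lt_succ_iff.1 (Finset.mem_range.1 hk)
    have e1 : ((P.natDegree : ℂ) - α) ^ (P.natDegree - k) * c ^ (P.natDegree - k) =
        (α / u) ^ (P.natDegree - k) := by rw [← mul_pow, huc]
    have e2 : (α / u) ^ P.natDegree = (α / u) ^ (P.natDegree - k) * (α / u) ^ k := by
      rw [← pow_add]; congr 1; omega
    rw [e2, ← e1, zpow_sub₀ hα0, div_pow]
    have : (k.factorial : ℂ) ≠ 0 := by exact_mod_cast k.factorial_ne_zero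
    simp only [zpow_natCast, zpow_one]
    field_simp
  have hpre : (α / u) ^ P.natDegree * (α : ℂ)⁻¹ ≠ 0 :=
    mul_ne_zero (pow_ne_zero _ (div_ne_zero hα0 hu0)) (inv_ne_zero hα0)
  rw [SymbolEquation, key, mul_eq_zero, or_iff_right hpre, LogDerivEquation, ← hu, huc]
  have hld : logDeriv (fun u : ℂ => P.eval u) (z + u) =
      P.derivative.eval (z + u) / P.eval (z + u) := by
    simp [logDeriv_apply]
  rw [hld]
  constructor
  · intro h
    -- If P vanished at z + u, so would P', contradicting simplicity of the roots.
    have hPw : P.eval (z + u) ≠ 0 := by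
      intro h0
      rw [h0] at h
      have := eval_derivative_ne_zero_of_nodup_roots hP0 hP h0
      simp [hu0, this] at h
    refine ⟨hc, hPw, ?_⟩
    rw [div_eq_div_iff hu0 hPw]
    linear_combination h
  · rintro ⟨-, hPw, h⟩
    rw [div_eq_div_iff hu0 hPw] at h
    linear_combination h

/-! ### Cauchy transforms under weak limits -/

/-- The singular part of the Cauchy kernel: `1 / ‖x‖` on the punctured disc of radius `ε`. -/
noncomputable def singularKernel (ε : ℝ) (x : ℂ) : ENNReal :=
  (Metric.ball (0 : ℂ) ε).indicator (fun y => ‖y⁻¹‖ₑ) x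

theorem measurable_singularKernel (ε : ℝ) : Measurable (singularKernel ε) :=
  Measurable.indicator (by fun_prop) Metric.isOpen_ball.measurableSet

/-- In polar coordinates the Jacobian r cancels 1/r, which leaves the area of a rectangle with sides
ε and 2π. -/
theorem lintegral_singularKernel_le {ε : ℝ} (hε : 0 ≤ ε) :
    ∫⁻ x, singularKernel ε x ≤ ENNReal.ofReal (2 * Real.pi * ε) := by
  rw [← Complex.lintegral_comp_polarCoord_symm]
  have hle : ∀ p ∈ polarCoord.target, ENNReal.ofReal p.1 • singularKernel ε
      (Complex.polarCoord.symm p) ≤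
      (Set.Ioo (0 : ℝ) ε ×ˢ Set.Ioo (-Real.pi) Real.pi).indicator (fun _ => (1 : ENNReal)) p := by
    rintro ⟨r, θ⟩ hp
    rw [polarCoord_target] at hp
    have hr : 0 < r := hp.1
    have hn : ‖Complex.polarCoord.symm (r, θ)‖ = r := by
      rw [Complex.norm_polarCoord_symm]; exact abs_of_pos hr
    by_cases h : r < ε
    · rw [Set.indicator_of_mem (show (r, θ) ∈ Set.Ioo (0 : ℝ) ε ×ˢ Set.Ioo (-Real.pi) Real.pi from
        ⟨⟨hr, h⟩, hp.2⟩), singularKernel, Set.indicator_of_mem (by rw [mem_ball_zero_iff, hn]; exact h)]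
      rw [← ofReal_norm, norm_inv, hn, smul_eq_mul, ← ENNReal.ofReal_mul hr.le,
        mul_inv_cancel₀ hr.ne']
      simp
    · rw [singularKernel, Set.indicator_of_notMem (by rw [mem_ball_zero_iff, hn]; exact h)]
      simp
  refine (setLIntegral_mono' polarCoord.open_target.measurableSet hle).trans ?_
  refine (setLIntegral_le_lintegral _ _).trans ?_
  rw [lintegral_indicator (measurableSet_Ioo.prod measurableSet_Ioo)]
  simp only [lintegral_const, one_mul, Measure.restrict_apply MeasurableSet.univ, Set.univ_inter]
  rw [Measure.volume_eq_prod, Measure.prod_prod, Real.volume_Ioo, Real.volume_Ioo,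
    ← ENNReal.ofReal_mul (by linarith)]
  apply ENNReal.ofReal_le_ofReal
  linarith

/-- Tonelli and translation invariance. What matters is that the bound is the same for all
probability measures. -/
theorem lintegral_lintegral_singularKernel_le (ν : Measure ℂ) [IsProbabilityMeasure ν] {ε : ℝ}
    (hε : 0 ≤ ε) :
    ∫⁻ z, ∫⁻ ξ, singularKernel ε (z - ξ) ∂ν ≤ ENNReal.ofReal (2 * Real.pi * ε) := by
  rw [lintegral_lintegral_swap]
  · calc ∫⁻ ξ, (∫⁻ z, singularKernel ε (z - ξ)) ∂ν
        ≤ ∫⁻ _ξ, ENNReal.ofReal (2 * Real.pi * ε) ∂ν := by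
          refine lintegral_mono fun ξ => ?_
          rw [lintegral_sub_right_eq_self (fun x => singularKernel ε x) ξ]
          exact lintegral_singularKernel_le hε
      _ = ENNReal.ofReal (2 * Real.pi * ε) := by simp
  · exact ((measurable_singularKernel ε).comp (measurable_fst.sub measurable_snd)).aemeasurable

theorem ae_integrable_cauchyKernel (ν : Measure ℂ) [IsProbabilityMeasure ν] :
    ∀ᵐ z : ℂ, Integrable (fun ξ : ℂ => (z - ξ)⁻¹) ν := by
  have h1 : ∀ᵐ z : ℂ, ∫⁻ ξ, singularKernel 1 (z - ξ) ∂ν < ⊤ := by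
    refine ae_lt_top ?_ ?_
    · exact Measurable.lintegral_prod_right
        ((measurable_singularKernel 1).comp (measurable_fst.sub measurable_snd))
    · exact ((lintegral_lintegral_singularKernel_le ν zero_le_one).trans_lt
        ENNReal.ofReal_lt_top).ne
  filter_upwards [h1] with z hz
  refine ⟨by fun_prop, ?_⟩
  rw [HasFiniteIntegral]
  have hle : ∀ ξ : ℂ, ‖(z - ξ)⁻¹‖ₑ ≤ singularKernel 1 (z - ξ) + 1 := by
    intro ξ
    by_cases h : z - ξ ∈ Metric.ball (0 : ℂ) 1
    · rw [singularKernel, Set.indicator_of_mem h]; exact le_self_add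
    · have h' : 1 ≤ ‖z - ξ‖ := by simpa using h
      refine le_trans ?_ le_add_self
      rw [← ofReal_norm, norm_inv, ← ENNReal.ofReal_one]
      exact ENNReal.ofReal_le_ofReal (inv_le_one_of_one_le₀ h')
  refine (lintegral_mono hle).trans_lt ?_
  rw [lintegral_add_right _ measurable_const]
  simpa using hz

/-- The Cauchy kernel `1 / x`, truncated to a bounded continuous function. -/
noncomputable def truncKernel (ε : ℝ) (x : ℂ) : ℂ :=
  (starRingEnd ℂ) x / ((max (‖x‖ ^ 2) (ε ^ 2) : ℝ) : ℂ)

theorem continuous_truncKernel {ε : ℝ} (hε : 0 < ε) : Continuous (truncKernel ε) := by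
  unfold truncKernel
  refine Continuous.div Complex.continuous_conj (by fun_prop) fun x => ?_
  have : 0 < max (‖x‖ ^ 2) (ε ^ 2) := lt_max_of_lt_right (by positivity)
  exact_mod_cast this.ne'

theorem norm_truncKernel_le {ε : ℝ} (hε : 0 < ε) (x : ℂ) : ‖truncKernel ε x‖ ≤ ε⁻¹ := by
  have h0 : 0 < max (‖x‖ ^ 2) (ε ^ 2) := lt_max_of_lt_right (by positivity)
  rw [truncKernel, norm_div, Complex.norm_conj, Complex.norm_real, Real.norm_of_nonneg h0.le,
    div_le_iff₀ h0]
  have h1 := le_max_left (‖x‖ ^ 2) (ε ^ 2)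
  have h2 := le_max_right (‖x‖ ^ 2) (ε ^ 2)
  rw [← div_eq_inv_mul, le_div_iff₀ hε]
  nlinarith [sq_nonneg (‖x‖ - ε), norm_nonneg x]

/-- Since 1/x is the conjugate of x over |x|^2, the two kernels agree for |x| ≥ ε; inside, the
truncation is 1/x times |x|^2/ε^2, a factor in [0, 1]. -/
theorem enorm_inv_sub_truncKernel_le {ε : ℝ} (hε : 0 < ε) (x : ℂ) :
    ‖x⁻¹ - truncKernel ε x‖ₑ ≤ singularKernel ε x := by
  by_cases h : x ∈ Metric.ball (0 : ℂ) ε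
  · rw [singularKernel, Set.indicator_of_mem h]
    have hx : ‖x‖ < ε := by simpa using h
    have hm : max (‖x‖ ^ 2) (ε ^ 2) = ε ^ 2 := max_eq_right (by gcongr)
    rw [truncKernel, hm, ← ofReal_norm, ← ofReal_norm]
    apply ENNReal.ofReal_le_ofReal
    by_cases hx0 : x = 0
    · simp [hx0]
    have hxn : (‖x‖ : ℂ) ≠ 0 := by exact_mod_cast norm_ne_zero_iff.2 hx0
    have hεn : (ε : ℂ) ≠ 0 := by exact_mod_cast hε.ne'
    have e : x⁻¹ - (starRingEnd ℂ) x / ((ε ^ 2 : ℝ) : ℂ) =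
        x⁻¹ * ((1 - ‖x‖ ^ 2 / ε ^ 2 : ℝ) : ℂ) := by
      have := Complex.mul_conj' x
      push_cast
      field_simp
      linear_combination -this
    rw [e, norm_mul, Complex.norm_real]
    refine mul_le_of_le_one_right (norm_nonneg _) ?_
    have h1 : ‖x‖ ^ 2 / ε ^ 2 ≤ 1 := by
      rw [div_le_one (by positivity)]; gcongr
    have h2 : 0 ≤ ‖x‖ ^ 2 / ε ^ 2 := by positivity
    rw [Real.norm_eq_abs, abs_le]; constructor <;> linarith
  · have hx : ε ≤ ‖x‖ := by simpa using h
    have hx0 : x ≠ 0 := by rintro rfl; simp at hx; linarith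
    have hm : max (‖x‖ ^ 2) (ε ^ 2) = ‖x‖ ^ 2 := max_eq_left (by gcongr)
    have e : x⁻¹ - truncKernel ε x = 0 := by
      rw [truncKernel, hm]
      have := Complex.mul_conj' x
      have hxn : (‖x‖ : ℂ) ≠ 0 := by exact_mod_cast norm_ne_zero_iff.2 hx0
      push_cast
      field_simp
      linear_combination -this
    rw [e]; simp

theorem measurable_cauchyTransform (ν : Measure ℂ) [SFinite ν] :
    Measurable (cauchyTransform ν) := by
  have : StronglyMeasurable (Function.uncurry fun z ξ : ℂ => (z - ξ)⁻¹) :=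
    Measurable.stronglyMeasurable (by fun_prop)
  exact (this.integral_prod_right (ν := ν)).measurable

/-- The truncated Cauchy transform. -/
noncomputable def truncTransform (ε : ℝ) (ν : Measure ℂ) (z : ℂ) : ℂ :=
  ∫ ξ, truncKernel ε (z - ξ) ∂ν

theorem measurable_truncTransform {ε : ℝ} (hε : 0 < ε) (ν : Measure ℂ) [SFinite ν] :
    Measurable (truncTransform ε ν) := by
  have : StronglyMeasurable (Function.uncurry fun z ξ : ℂ => truncKernel ε (z - ξ)) :=
    ((continuous_truncKernel hε).comp (continuous_fst.sub continuous_snd)).stronglyMeasurable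
  exact (this.integral_prod_right (ν := ν)).measurable

theorem integrable_truncKernel {ε : ℝ} (hε : 0 < ε) (ν : Measure ℂ) [IsFiniteMeasure ν] (z : ℂ) :
    Integrable (fun ξ => truncKernel ε (z - ξ)) ν := by
  refine Integrable.of_bound (C := ε⁻¹) ?_ (Eventually.of_forall fun ξ => norm_truncKernel_le hε _)
  exact ((continuous_truncKernel hε).comp (continuous_const.sub continuous_id)).aestronglyMeasurable

theorem lintegral_cauchyTransform_sub_truncTransform_le (ν : Measure ℂ) [IsProbabilityMeasure ν]
    {ε : ℝ} (hε : 0 < ε) :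
    ∫⁻ z, ‖cauchyTransform ν z - truncTransform ε ν z‖ₑ ≤ ENNReal.ofReal (2 * Real.pi * ε) := by
  refine le_trans (lintegral_mono_ae ?_) (lintegral_lintegral_singularKernel_le ν hε.le)
  filter_upwards [ae_integrable_cauchyKernel ν] with z hz
  rw [cauchyTransform, truncTransform, ← integral_sub hz (integrable_truncKernel hε ν z)]
  refine (enorm_integral_le_lintegral_enorm _).trans (lintegral_mono fun ξ => ?_)
  exact enorm_inv_sub_truncKernel_le hε _

theorem tendsto_truncTransform {ε : ℝ} (hε : 0 < ε) {ν : ℕ → ProbabilityMeasure ℂ}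
    {μ : ProbabilityMeasure ℂ} (h : Tendsto ν atTop (𝓝 μ)) (z : ℂ) :
    Tendsto (fun n => truncTransform ε (ν n : Measure ℂ) z) atTop
      (𝓝 (truncTransform ε (μ : Measure ℂ) z)) := by
  have hc : Continuous fun ξ => truncKernel ε (z - ξ) :=
    (continuous_truncKernel hε).comp (continuous_const.sub continuous_id)
  exact (ProbabilityMeasure.tendsto_iff_forall_integral_rclike_tendsto ℂ).1 h
    (BoundedContinuousFunction.ofNormedAddCommGroup _ hc ε⁻¹ fun ξ => norm_truncKernel_le hε _)

/-- Truncation costs at most 2πε in L^1, uniformly in the measure, and truncated transforms converge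
pointwise because their kernel is bounded and continuous. Fatou then puts c within 4πε of the
transform of μ in L^1, for every ε. -/
theorem ae_cauchyTransform_eq_of_tendsto {ν : ℕ → ProbabilityMeasure ℂ} {μ : ProbabilityMeasure ℂ}
    (h : Tendsto ν atTop (𝓝 μ)) {c : ℂ → ℂ}
    (hc : ∀ᵐ z : ℂ, Tendsto (fun n => cauchyTransform (ν n : Measure ℂ) z) atTop (𝓝 (c z))) :
    ∀ᵐ z : ℂ, cauchyTransform (μ : Measure ℂ) z = c z := by
  have hcm : AEMeasurable c :=
    aemeasurable_of_tendsto_metrizable_ae atTop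
      (fun n => (measurable_cauchyTransform (ν n : Measure ℂ)).aemeasurable) hc
  have key : ∀ ε : ℝ, 0 < ε →
      ∫⁻ z, ‖c z - cauchyTransform (μ : Measure ℂ) z‖ₑ ≤ ENNReal.ofReal (4 * Real.pi * ε) := by
    intro ε hε
    have h1 : ∫⁻ z, ‖c z - truncTransform ε (μ : Measure ℂ) z‖ₑ ≤
        ENNReal.ofReal (2 * Real.pi * ε) := by
      have e1 : ∀ᵐ z : ℂ, ‖c z - truncTransform ε (μ : Measure ℂ) z‖ₑ =
          liminf (fun n => ‖cauchyTransform (ν n : Measure ℂ) z -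
            truncTransform ε (ν n : Measure ℂ) z‖ₑ) atTop := by
        filter_upwards [hc] with z hz
        exact ((hz.sub (tendsto_truncTransform hε h z)).enorm).liminf_eq.symm
      rw [lintegral_congr_ae e1]
      refine (lintegral_liminf_le' fun n => ?_).trans ?_
      · exact ((measurable_cauchyTransform _).sub (measurable_truncTransform hε _)).enorm.aemeasurable
      · refine liminf_le_of_le (by isBoundedDefault) fun b hb => ?_
        obtain ⟨n, hn⟩ := hb.exists
        exact hn.trans (lintegral_cauchyTransform_sub_truncTransform_le _ hε)
    calc ∫⁻ z, ‖c z - cauchyTransform (μ : Measure ℂ) z‖ₑ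
        ≤ ∫⁻ z, (‖c z - truncTransform ε (μ : Measure ℂ) z‖ₑ +
            ‖cauchyTransform (μ : Measure ℂ) z - truncTransform ε (μ : Measure ℂ) z‖ₑ) := by
          refine lintegral_mono fun z => ?_
          have := enorm_sub_le (a := c z - truncTransform ε (μ : Measure ℂ) z)
            (b := cauchyTransform (μ : Measure ℂ) z - truncTransform ε (μ : Measure ℂ) z)
          simpa using this
      _ = (∫⁻ z, ‖c z - truncTransform ε (μ : Measure ℂ) z‖ₑ) +
            ∫⁻ z, ‖cauchyTransform (μ : Measure ℂ) z - truncTransform ε (μ : Measure ℂ) z‖ₑ :=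
          lintegral_add_right _
            ((measurable_cauchyTransform _).sub (measurable_truncTransform hε _)).enorm
      _ ≤ ENNReal.ofReal (2 * Real.pi * ε) + ENNReal.ofReal (2 * Real.pi * ε) :=
          add_le_add h1 (lintegral_cauchyTransform_sub_truncTransform_le _ hε)
      _ = ENNReal.ofReal (4 * Real.pi * ε) := by
          rw [← ENNReal.ofReal_add (by positivity) (by positivity)]; congr 1; ring
  have hzero : ∫⁻ z, ‖c z - cauchyTransform (μ : Measure ℂ) z‖ₑ = 0 := by
    refine le_antisymm (ENNReal.le_of_forall_pos_le_add fun δ hδ _ => ?_) zero_le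
    have hδ' : (0 : ℝ) < δ := hδ
    refine (key (δ / (4 * Real.pi)) (by positivity)).trans ?_
    rw [zero_add, mul_div_cancel₀ _ (by positivity)]
    simp
  have hm : AEMeasurable fun z => ‖c z - cauchyTransform (μ : Measure ℂ) z‖ₑ :=
    (hcm.sub (measurable_cauchyTransform _).aemeasurable).enorm
  filter_upwards [(lintegral_eq_zero_iff' hm).1 hzero] with z hz
  have : c z - cauchyTransform (μ : Measure ℂ) z = 0 := by simpa using hz
  rw [sub_eq_zero] at this
  exact this.symm

/-! ### A measure is determined by its Cauchy transform -/

/-- Up to the factor i this is the integral of dz/(z - ξ) over the circle, parametrised from -π to π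
to match polar coordinates. -/
theorem integral_circle_kernel {r : ℝ} (hr : 0 < r) {ξ : ℂ} (hξ : ‖ξ‖ ≠ r) :
    ∫ θ in Set.Ioo (-Real.pi) Real.pi,
      (r : ℂ) * Complex.exp (θ * Complex.I) * ((r : ℂ) * Complex.exp (θ * Complex.I) - ξ)⁻¹ =
    if ‖ξ‖ < r then (2 * Real.pi : ℂ) else 0 := by
  have hper : Function.Periodic (fun θ : ℝ => (r : ℂ) * Complex.exp (θ * Complex.I) *
      ((r : ℂ) * Complex.exp (θ * Complex.I) - ξ)⁻¹) (2 * Real.pi) := by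
    intro θ
    have : Complex.exp (((θ + 2 * Real.pi : ℝ) : ℂ) * Complex.I) = Complex.exp (θ * Complex.I) := by
      push_cast
      rw [add_mul, Complex.exp_add, Complex.exp_two_pi_mul_I, mul_one]
    simp only [this]
  have h1 : ∫ θ in Set.Ioo (-Real.pi) Real.pi,
      (r : ℂ) * Complex.exp (θ * Complex.I) * ((r : ℂ) * Complex.exp (θ * Complex.I) - ξ)⁻¹ =
      ∫ θ in (0 : ℝ)..2 * Real.pi,
      (r : ℂ) * Complex.exp (θ * Complex.I) * ((r : ℂ) * Complex.exp (θ * Complex.I) - ξ)⁻¹ := by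
    rw [← integral_Ioc_eq_integral_Ioo, ← intervalIntegral.integral_of_le (by linarith [Real.pi_pos])]
    have := hper.intervalIntegral_add_eq (-Real.pi) 0
    rw [zero_add, show -Real.pi + 2 * Real.pi = Real.pi by ring] at this
    exact this
  have h2 : (∮ z in C(0, r), (z - ξ)⁻¹) = Complex.I * ∫ θ in (0 : ℝ)..2 * Real.pi,
      (r : ℂ) * Complex.exp (θ * Complex.I) * ((r : ℂ) * Complex.exp (θ * Complex.I) - ξ)⁻¹ := by
    rw [circleIntegral, ← intervalIntegral.integral_const_mul]
    refine intervalIntegral.integral_congr fun θ _ => ?_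
    simp only [deriv_circleMap, circleMap, zero_add, smul_eq_mul]
    ring
  rw [h1]
  split_ifs with h
  · rw [circleIntegral.integral_sub_inv_of_mem_ball (by simpa using h)] at h2
    have := mul_left_cancel₀ Complex.I_ne_zero (h2.symm.trans (by ring :
      2 * (Real.pi : ℂ) * Complex.I = Complex.I * (2 * Real.pi)))
    exact this
  · have hlt : r < ‖ξ‖ := lt_of_le_of_ne (not_lt.1 h) (Ne.symm hξ)
    have hz : (∮ z in C(0, r), (z - ξ)⁻¹) = 0 := by
      refine Complex.circleIntegral_eq_zero_of_differentiable_on_off_countable hr.le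
        Set.countable_empty ?_ ?_
      · intro z hz
        have : z - ξ ≠ 0 := by
          rw [sub_ne_zero]; rintro rfl
          have : ‖z‖ ≤ r := by simpa using hz
          linarith
        exact ((continuousAt_id.sub continuousAt_const).inv₀ this).continuousWithinAt
      · rintro z ⟨hz, -⟩
        have : z - ξ ≠ 0 := by
          rw [sub_ne_zero]; rintro rfl
          have : ‖z‖ < r := by simpa using hz
          linarith
        exact (differentiableAt_id.sub_const ξ).inv this
    rw [hz] at h2
    exact (mul_eq_zero.1 h2.symm).resolve_left Complex.I_ne_zero

/-- The unit radial field on the disc of radius `r`. -/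
noncomputable def radialField (r : ℝ) (z : ℂ) : ℂ :=
  (Metric.ball (0 : ℂ) r).indicator (fun y => y / ‖y‖) z

theorem measurable_radialField (r : ℝ) : Measurable (radialField r) :=
  Measurable.indicator (by fun_prop) Metric.isOpen_ball.measurableSet

theorem norm_radialField_le (r : ℝ) (z : ℂ) : ‖radialField r z‖ ≤ 1 := by
  unfold radialField
  by_cases h : z ∈ Metric.ball (0 : ℂ) r
  · rw [Set.indicator_of_mem h, norm_div, Complex.norm_real, norm_norm]
    exact div_self_le_one _
  · rw [Set.indicator_of_notMem h]; simp

theorem radialField_eq_zero {r : ℝ} {z : ℂ} (h : r ≤ ‖z‖) : radialField r z = 0 :=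
  Set.indicator_of_notMem (by simpa using h) _

theorem enorm_radialField_mul_le (r : ℝ) (z x : ℂ) :
    ‖radialField r z * x⁻¹‖ₑ ≤
      singularKernel 1 x + (Metric.ball (0 : ℂ) r).indicator (fun _ => (1 : ENNReal)) z := by
  rw [enorm_mul]
  by_cases h : x ∈ Metric.ball (0 : ℂ) 1
  · rw [singularKernel, Set.indicator_of_mem h]
    refine le_trans ?_ le_self_add
    refine mul_le_of_le_one_left zero_le ?_
    rw [← ofReal_norm, ← ENNReal.ofReal_one]
    exact ENNReal.ofReal_le_ofReal (norm_radialField_le r z)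
  · have hx : 1 ≤ ‖x‖ := by simpa using h
    refine le_trans ?_ le_add_self
    by_cases hz : z ∈ Metric.ball (0 : ℂ) r
    · rw [Set.indicator_of_mem hz, ← ofReal_norm, ← ofReal_norm, ← ENNReal.ofReal_mul (norm_nonneg _),
        ← ENNReal.ofReal_one, norm_inv]
      apply ENNReal.ofReal_le_ofReal
      exact mul_le_one₀ (norm_radialField_le r z) (by positivity) (inv_le_one_of_one_le₀ hx)
    · rw [radialField, Set.indicator_of_notMem hz]; simp

theorem integrable_radialField_mul (r : ℝ) (ξ : ℂ) :
    Integrable fun z : ℂ => radialField r z * (z - ξ)⁻¹ := by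
  refine ⟨((measurable_radialField r).mul (by fun_prop)).aestronglyMeasurable, ?_⟩
  rw [HasFiniteIntegral]
  refine (lintegral_mono fun z => enorm_radialField_mul_le r z (z - ξ)).trans_lt ?_
  rw [lintegral_add_right _ (measurable_const.indicator Metric.isOpen_ball.measurableSet),
    lintegral_sub_right_eq_self (fun x => singularKernel 1 x) ξ,
    lintegral_indicator Metric.isOpen_ball.measurableSet]
  refine ENNReal.add_lt_top.2 ⟨(lintegral_singularKernel_le zero_le_one).trans_lt
    ENNReal.ofReal_lt_top, ?_⟩
  simpa using measure_ball_lt_top (μ := (volume : Measure ℂ)) (x := 0) (r := r)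

/-- The radial field turns the polar area element into dz/i on each circle, so a circle of radius ρ
< r contributes 2π when it encloses ξ and 0 otherwise. The Cauchy kernel is thereby converted into a
continuous tent function. -/
theorem integral_radialField_mul (r : ℝ) (ξ : ℂ) :
    ∫ z : ℂ, radialField r z * (z - ξ)⁻¹ = ((2 * Real.pi * max 0 (r - ‖ξ‖) : ℝ) : ℂ) := by
  rw [← Complex.integral_comp_polarCoord_symm, polarCoord_target, Measure.volume_eq_prod,
    setIntegral_prod]
  · have hin : ∀ ρ ∈ Set.Ioi (0 : ℝ), ρ ≠ ‖ξ‖ →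
        ∫ θ in Set.Ioo (-Real.pi) Real.pi, (ρ, θ).1 • (radialField r (Complex.polarCoord.symm (ρ, θ)) *
          (Complex.polarCoord.symm (ρ, θ) - ξ)⁻¹) =
        (Set.Ioo ‖ξ‖ r).indicator (fun _ => (2 * Real.pi : ℂ)) ρ := by
      intro ρ hρ hρξ
      have hρ : 0 < ρ := hρ
      have hsymm : ∀ θ : ℝ, Complex.polarCoord.symm (ρ, θ) = ρ * Complex.exp (θ * Complex.I) := by
        intro θ
        rw [Complex.polarCoord_symm_apply, Complex.exp_mul_I]
        push_cast; rfl
      have hn : ∀ θ : ℝ, ‖(ρ : ℂ) * Complex.exp (θ * Complex.I)‖ = ρ := by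
        intro θ
        rw [norm_mul, Complex.norm_exp_ofReal_mul_I, mul_one, Complex.norm_real,
          Real.norm_of_nonneg hρ.le]
      by_cases h : ρ < r
      · have e : ∀ θ : ℝ, (ρ, θ).1 • (radialField r (Complex.polarCoord.symm (ρ, θ)) *
          (Complex.polarCoord.symm (ρ, θ) - ξ)⁻¹) = (ρ : ℂ) * Complex.exp (θ * Complex.I) *
            ((ρ : ℂ) * Complex.exp (θ * Complex.I) - ξ)⁻¹ := by
          intro θ
          rw [hsymm, radialField, Set.indicator_of_mem (by rw [mem_ball_zero_iff, hn]; exact h), hn]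
          have : (ρ : ℂ) ≠ 0 := by exact_mod_cast hρ.ne'
          rw [Complex.real_smul]
          field_simp
        simp_rw [e]
        rw [integral_circle_kernel hρ (Ne.symm hρξ)]
        by_cases h' : ‖ξ‖ < ρ
        · rw [if_pos h', Set.indicator_of_mem (show ρ ∈ Set.Ioo ‖ξ‖ r from ⟨h', h⟩)]
        · rw [if_neg h', Set.indicator_of_notMem (fun hh => h' hh.1)]
      · have e : ∀ θ : ℝ, (ρ, θ).1 • (radialField r (Complex.polarCoord.symm (ρ, θ)) *
          (Complex.polarCoord.symm (ρ, θ) - ξ)⁻¹) = 0 := by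
          intro θ
          rw [hsymm, radialField_eq_zero (by rw [hn]; exact not_lt.1 h)]
          simp
        simp_rw [e]
        rw [Set.indicator_of_notMem (fun hh => h hh.2)]
        simp
    have hae : ∀ᵐ ρ : ℝ, ρ ∈ Set.Ioi (0 : ℝ) →
        ∫ θ in Set.Ioo (-Real.pi) Real.pi, (ρ, θ).1 • (radialField r (Complex.polarCoord.symm (ρ, θ)) *
          (Complex.polarCoord.symm (ρ, θ) - ξ)⁻¹) =
        (Set.Ioo ‖ξ‖ r).indicator (fun _ => (2 * Real.pi : ℂ)) ρ := by
      have : ∀ᵐ ρ : ℝ, ρ ≠ ‖ξ‖ := by simp [ae_iff]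
      filter_upwards [this] with ρ h1 h2 using hin ρ h2 h1
    rw [setIntegral_congr_ae measurableSet_Ioi hae, setIntegral_indicator measurableSet_Ioo]
    have : Set.Ioi (0 : ℝ) ∩ Set.Ioo ‖ξ‖ r = Set.Ioo ‖ξ‖ r :=
      Set.inter_eq_right.2 fun x hx => (norm_nonneg ξ).trans_lt hx.1
    rw [this, setIntegral_const, Real.volume_real_Ioo]
    rw [Complex.real_smul, max_comm]
    push_cast; ring
  · have hm : Measurable fun p : ℝ × ℝ => p.1 • (radialField r (Complex.polarCoord.symm p) *
        (Complex.polarCoord.symm p - ξ)⁻¹) := by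
      have hs : Measurable fun p : ℝ × ℝ => Complex.polarCoord.symm p := by
        simp_rw [Complex.polarCoord_symm_apply]; fun_prop
      exact measurable_fst.smul (((measurable_radialField r).comp hs).mul (hs.sub_const ξ).inv)
    refine ⟨hm.aestronglyMeasurable, ?_⟩
    rw [HasFiniteIntegral, ← Measure.volume_eq_prod, ← polarCoord_target]
    have h := Complex.lintegral_comp_polarCoord_symm
      fun z : ℂ => ‖radialField r z * (z - ξ)⁻¹‖ₑ
    have hfin := (integrable_radialField_mul r ξ).2
    rw [HasFiniteIntegral, ← h] at hfin
    refine lt_of_le_of_lt (le_of_eq ?_) hfin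
    refine setLIntegral_congr_fun polarCoord.open_target.measurableSet fun p hp => ?_
    rw [polarCoord_target] at hp
    have hp1 : 0 < p.1 := hp.1
    simp only [enorm_smul, smul_eq_mul]
    congr 1
    rw [← ofReal_norm, Real.norm_of_nonneg hp1.le]

theorem integrable_radialField_kernel_prod (ν : Measure ℂ) [IsProbabilityMeasure ν] (r : ℝ) (a : ℂ) :
    Integrable (Function.uncurry fun z ξ : ℂ => radialField r (z - a) * (z - ξ)⁻¹)
      (volume.prod ν) := by
  have hm : Measurable (Function.uncurry fun z ξ : ℂ => radialField r (z - a) * (z - ξ)⁻¹) := by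
    refine Measurable.mul ?_ (by fun_prop)
    exact (measurable_radialField r).comp (measurable_fst.sub_const a)
  refine ⟨hm.aestronglyMeasurable, ?_⟩
  rw [HasFiniteIntegral, lintegral_prod _ hm.enorm.aemeasurable]
  have h1 : Measurable fun z : ℂ => (Metric.ball (0 : ℂ) r).indicator (fun _ => (1 : ENNReal)) (z - a) :=
    (measurable_const.indicator Metric.isOpen_ball.measurableSet).comp (measurable_id.sub_const a)
  calc ∫⁻ z, (∫⁻ ξ, ‖radialField r (z - a) * (z - ξ)⁻¹‖ₑ ∂ν)
      ≤ ∫⁻ z, ((∫⁻ ξ, singularKernel 1 (z - ξ) ∂ν) +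
          (Metric.ball (0 : ℂ) r).indicator (fun _ => (1 : ENNReal)) (z - a)) := by
        refine lintegral_mono fun z => ?_
        refine (lintegral_mono fun ξ => enorm_radialField_mul_le r (z - a) (z - ξ)).trans ?_
        rw [lintegral_add_right _ measurable_const]
        simp
    _ = (∫⁻ z, ∫⁻ ξ, singularKernel 1 (z - ξ) ∂ν) +
          ∫⁻ z, (Metric.ball (0 : ℂ) r).indicator (fun _ => (1 : ENNReal)) (z - a) :=
        lintegral_add_right _ h1
    _ < ⊤ := by
        refine ENNReal.add_lt_top.2 ⟨(lintegral_lintegral_singularKernel_le ν zero_le_one).trans_lt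
          ENNReal.ofReal_lt_top, ?_⟩
        rw [lintegral_sub_right_eq_self
          (fun x => (Metric.ball (0 : ℂ) r).indicator (fun _ => (1 : ENNReal)) x) a,
          lintegral_indicator Metric.isOpen_ball.measurableSet]
        simpa using measure_ball_lt_top (μ := (volume : Measure ℂ)) (x := 0) (r := r)

/-- Fubini: integrals of tents against ν can be read off from the Cauchy transform, so almost
everywhere knowledge of it suffices. -/
theorem integral_tent_eq_integral_cauchyTransform (ν : Measure ℂ) [IsProbabilityMeasure ν] (r : ℝ)
    (a : ℂ) :
    ((∫ ξ, 2 * Real.pi * max 0 (r - ‖ξ - a‖) ∂ν : ℝ) : ℂ) =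
      ∫ z, radialField r (z - a) * cauchyTransform ν z := by
  have h := integral_integral_swap (integrable_radialField_kernel_prod ν r a)
  simp only [integral_const_mul] at h
  rw [← integral_complex_ofReal]
  simp only [cauchyTransform]
  rw [h]
  refine integral_congr_ae (Eventually.of_forall fun ξ => ?_)
  have e := integral_sub_right_eq_self (μ := (volume : Measure ℂ))
    (fun z : ℂ => radialField r z * (z - (ξ - a))⁻¹) a
  simp only [sub_sub_sub_cancel_right] at e
  simp only
  rw [e, integral_radialField_mul]

theorem continuous_tent (r : ℝ) : Continuous fun b : ℂ => max 0 (r - ‖b‖) := by fun_prop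

theorem hasCompactSupport_tent (r : ℝ) : HasCompactSupport fun b : ℂ => max 0 (r - ‖b‖) := by
  refine HasCompactSupport.intro (isCompact_closedBall (0 : ℂ) r) fun b hb => ?_
  have : r < ‖b‖ := by simpa using hb
  exact max_eq_left (by linarith)

theorem integral_tent_pos : 0 < ∫ b : ℂ, max 0 (1 - ‖b‖) := by
  refine Continuous.integral_pos_of_hasCompactSupport_nonneg_nonzero (x := 0) (continuous_tent 1)
    (hasCompactSupport_tent 1) (fun b => le_max_left _ _) ?_
  simp

/-- Convolving f with a tent produces a superposition of translated tents, whose integrals agree by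
hypothesis. -/
theorem integral_mul_tent_eq_of_forall_integral_tent_eq {μ ν : Measure ℂ} [IsProbabilityMeasure μ]
    [IsProbabilityMeasure ν]
    (h : ∀ (r : ℝ) (a : ℂ), ∫ ξ, max 0 (r - ‖ξ - a‖) ∂μ = ∫ ξ, max 0 (r - ‖ξ - a‖) ∂ν)
    (f : BoundedContinuousFunction ℂ ℝ) (r : ℝ) :
    ∫ ξ, (∫ b : ℂ, f (ξ + b) * max 0 (r - ‖b‖)) ∂μ =
      ∫ ξ, (∫ b : ℂ, f (ξ + b) * max 0 (r - ‖b‖)) ∂ν := by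
  have key : ∀ ρ : Measure ℂ, IsProbabilityMeasure ρ →
      ∫ ξ, (∫ b : ℂ, f (ξ + b) * max 0 (r - ‖b‖)) ∂ρ =
        ∫ a : ℂ, f a * ∫ ξ, max 0 (r - ‖ξ - a‖) ∂ρ := by
    intro ρ _
    have e1 : ∀ ξ : ℂ, ∫ b : ℂ, f (ξ + b) * max 0 (r - ‖b‖) =
        ∫ a : ℂ, f a * max 0 (r - ‖ξ - a‖) := by
      intro ξ
      rw [← integral_add_left_eq_self (μ := (volume : Measure ℂ))
        (fun a : ℂ => f a * max 0 (r - ‖ξ - a‖)) ξ]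
      simp
    have htint : Integrable fun b : ℂ => max 0 (r - ‖b‖) :=
      (continuous_tent r).integrable_of_hasCompactSupport (hasCompactSupport_tent r)
    have hint : Integrable (Function.uncurry fun ξ a : ℂ => f a * max 0 (r - ‖ξ - a‖))
        (ρ.prod volume) := by
      have hc : Continuous (Function.uncurry fun ξ a : ℂ => f a * max 0 (r - ‖ξ - a‖)) := by
        unfold Function.uncurry; fun_prop
      rw [integrable_prod_iff hc.aestronglyMeasurable]
      have hb : ∀ ξ : ℂ, Integrable fun a : ℂ => max 0 (r - ‖ξ - a‖) := fun ξ =>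
        htint.comp_sub_left ξ
      have hb' : ∀ ξ : ℂ, Integrable fun a : ℂ => f a * max 0 (r - ‖ξ - a‖) := fun ξ =>
        (hb ξ).bdd_mul (c := ‖f‖) f.continuous.aestronglyMeasurable
          (Eventually.of_forall fun a => f.norm_coe_le_norm a)
      refine ⟨Eventually.of_forall hb', ?_⟩
      refine Integrable.of_bound (C := ‖f‖ * ∫ b : ℂ, max 0 (r - ‖b‖)) ?_
        (Eventually.of_forall fun ξ => ?_)
      · exact (hc.norm.stronglyMeasurable.integral_prod_right (ν := volume)).aestronglyMeasurable
      · rw [Real.norm_of_nonneg (integral_nonneg fun _ => norm_nonneg _)]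
        have e2 : ∫ b : ℂ, max 0 (r - ‖b‖) = ∫ a : ℂ, max 0 (r - ‖ξ - a‖) :=
          (integral_sub_left_eq_self (fun b : ℂ => max 0 (r - ‖b‖)) volume ξ).symm
        rw [e2, ← integral_const_mul]
        refine integral_mono (hb' ξ).norm ((hb ξ).const_mul _) fun a => ?_
        simp only [Function.uncurry, norm_mul]
        rw [Real.norm_of_nonneg (le_max_left 0 (r - ‖ξ - a‖))]
        exact mul_le_mul_of_nonneg_right (f.norm_coe_le_norm a) (le_max_left _ _)
    simp_rw [e1]
    rw [integral_integral_swap hint]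
    simp_rw [integral_const_mul]
  rw [key μ inferInstance, key ν inferInstance]
  simp_rw [h r]

/-- Rescaled tents form an approximate identity. The exponent 3 is two for the area plus one for the
homogeneity of the tent. -/
theorem tendsto_tent_average (f : BoundedContinuousFunction ℂ ℝ) (ξ : ℂ) :
    Tendsto (fun n : ℕ => ((1 / ((n : ℝ) + 1)) ^ 3)⁻¹ *
      ∫ b : ℂ, f (ξ + b) * max 0 (1 / ((n : ℝ) + 1) - ‖b‖)) atTop
      (𝓝 (f ξ * ∫ b : ℂ, max 0 (1 - ‖b‖))) ∧
    ∀ n : ℕ, ((1 / ((n : ℝ) + 1)) ^ 3)⁻¹ *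
      ∫ b : ℂ, f (ξ + b) * max 0 (1 / ((n : ℝ) + 1) - ‖b‖) =
      ∫ b : ℂ, f (ξ + (1 / ((n : ℝ) + 1)) • b) * max 0 (1 - ‖b‖) := by
  have e : ∀ n : ℕ, ((1 / ((n : ℝ) + 1)) ^ 3)⁻¹ *
      ∫ b : ℂ, f (ξ + b) * max 0 (1 / ((n : ℝ) + 1) - ‖b‖) =
      ∫ b : ℂ, f (ξ + (1 / ((n : ℝ) + 1)) • b) * max 0 (1 - ‖b‖) := by
    intro n
    set s : ℝ := 1 / ((n : ℝ) + 1) with hs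
    have hs0 : 0 < s := by positivity
    have h := Measure.integral_comp_smul (volume : Measure ℂ)
      (fun b : ℂ => f (ξ + b) * max 0 (s - ‖b‖)) s
    have h2 : ∀ b : ℂ, f (ξ + s • b) * max 0 (s - ‖s • b‖) =
        s * (f (ξ + s • b) * max 0 (1 - ‖b‖)) := by
      intro b
      rw [norm_smul, Real.norm_of_nonneg hs0.le]
      have : max 0 (s - s * ‖b‖) = s * max 0 (1 - ‖b‖) := by
        rw [mul_max_of_nonneg _ _ hs0.le]; congr 1 <;> ring
      rw [this]; ring
    simp only [h2] at h
    rw [integral_const_mul, Complex.finrank_real_complex, abs_of_pos (by positivity), smul_eq_mul] at h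
    rw [pow_succ, mul_inv, mul_comm _ s⁻¹, mul_assoc, ← h]
    field_simp
  refine ⟨?_, e⟩
  simp_rw [e]
  rw [← integral_const_mul]
  have htint : Integrable fun b : ℂ => max 0 (1 - ‖b‖) :=
    (continuous_tent 1).integrable_of_hasCompactSupport (hasCompactSupport_tent 1)
  refine tendsto_integral_of_dominated_convergence (fun b => ‖f‖ * max 0 (1 - ‖b‖)) ?_
    (htint.const_mul _) ?_ ?_
  · intro n
    exact Continuous.aestronglyMeasurable (by fun_prop)
  · intro n
    refine Eventually.of_forall fun b => ?_
    rw [norm_mul, Real.norm_of_nonneg (le_max_left 0 (1 - ‖b‖))]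
    exact mul_le_mul_of_nonneg_right (f.norm_coe_le_norm _) (le_max_left _ _)
  · refine Eventually.of_forall fun b => Tendsto.mul_const _ ?_
    have h1 : Tendsto (fun n : ℕ => ξ + (1 / ((n : ℝ) + 1)) • b) atTop (𝓝 (ξ + (0 : ℝ) • b)) :=
      tendsto_const_nhds.add (tendsto_one_div_add_atTop_nhds_zero_nat.smul_const b)
    rw [zero_smul, add_zero] at h1
    exact (f.continuous.tendsto ξ).comp h1

theorem measure_eq_of_cauchyTransform_ae_eq {μ ν : Measure ℂ} [IsProbabilityMeasure μ]
    [IsProbabilityMeasure ν] (h : ∀ᵐ z : ℂ, cauchyTransform μ z = cauchyTransform ν z) : μ = ν := by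
  have htent : ∀ (r : ℝ) (a : ℂ), ∫ ξ, max 0 (r - ‖ξ - a‖) ∂μ = ∫ ξ, max 0 (r - ‖ξ - a‖) ∂ν := by
    intro r a
    have h1 := integral_tent_eq_integral_cauchyTransform μ r a
    have h2 := integral_tent_eq_integral_cauchyTransform ν r a
    have h3 : ∫ z, radialField r (z - a) * cauchyTransform μ z =
        ∫ z, radialField r (z - a) * cauchyTransform ν z :=
      integral_congr_ae (h.mono fun z hz => by simp only [hz])
    rw [← h1, ← h2] at h3
    have h4 : ∫ ξ, 2 * Real.pi * max 0 (r - ‖ξ - a‖) ∂μ = ∫ ξ, 2 * Real.pi * max 0 (r - ‖ξ - a‖) ∂ν := by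
      exact_mod_cast h3
    rw [integral_const_mul, integral_const_mul] at h4
    exact mul_left_cancel₀ (by positivity) h4
  refine ext_of_forall_integral_eq_of_IsFiniteMeasure fun f => ?_
  set c := ∫ b : ℂ, max 0 (1 - ‖b‖) with hc
  have hc0 : 0 < c := integral_tent_pos
  have htint : Integrable fun b : ℂ => max 0 (1 - ‖b‖) :=
    (continuous_tent 1).integrable_of_hasCompactSupport (hasCompactSupport_tent 1)
  have key : ∀ ρ : Measure ℂ, IsProbabilityMeasure ρ →
      Tendsto (fun n : ℕ => ((1 / ((n : ℝ) + 1)) ^ 3)⁻¹ *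
        ∫ ξ, (∫ b : ℂ, f (ξ + b) * max 0 (1 / ((n : ℝ) + 1) - ‖b‖)) ∂ρ) atTop
        (𝓝 ((∫ ξ, f ξ ∂ρ) * c)) := by
    intro ρ _
    have e : ∀ n : ℕ, ((1 / ((n : ℝ) + 1)) ^ 3)⁻¹ *
        ∫ ξ, (∫ b : ℂ, f (ξ + b) * max 0 (1 / ((n : ℝ) + 1) - ‖b‖)) ∂ρ =
        ∫ ξ, (((1 / ((n : ℝ) + 1)) ^ 3)⁻¹ *
          ∫ b : ℂ, f (ξ + b) * max 0 (1 / ((n : ℝ) + 1) - ‖b‖)) ∂ρ :=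
      fun n => (integral_const_mul _ _).symm
    simp_rw [e]
    rw [← integral_mul_const]
    refine tendsto_integral_of_dominated_convergence (fun _ => ‖f‖ * c) ?_ (integrable_const _) ?_ ?_
    · intro n
      simp_rw [(tendsto_tent_average f _).2]
      have hcont : Continuous (Function.uncurry fun ξ b : ℂ =>
          f (ξ + (1 / ((n : ℝ) + 1)) • b) * max 0 (1 - ‖b‖)) := by
        unfold Function.uncurry; fun_prop
      exact (hcont.stronglyMeasurable.integral_prod_right (ν := volume)).aestronglyMeasurable
    · intro n
      refine Eventually.of_forall fun ξ => ?_
      rw [(tendsto_tent_average f ξ).2, hc, ← integral_const_mul]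
      refine norm_integral_le_of_norm_le (htint.const_mul _) (Eventually.of_forall fun b => ?_)
      rw [norm_mul, Real.norm_of_nonneg (le_max_left 0 (1 - ‖b‖))]
      exact mul_le_mul_of_nonneg_right (f.norm_coe_le_norm _) (le_max_left _ _)
    · exact Eventually.of_forall fun ξ => (tendsto_tent_average f ξ).1
  have h1 := key μ inferInstance
  simp_rw [integral_mul_tent_eq_of_forall_integral_tent_eq htent f] at h1
  exact mul_right_cancel₀ hc0.ne' (tendsto_nhds_unique h1 (key ν inferInstance))

/-! ### From convergence of Cauchy transforms to weak convergence -/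

/-- Probability measures carried by K form a compact set, and every cluster point has Cauchy
transform c almost everywhere; hence there is only one cluster point. -/
theorem exists_tendsto_of_ae_tendsto_cauchyTransform {ν : ℕ → ProbabilityMeasure ℂ} {K : Set ℂ}
    (hK : IsCompact K) (hν : ∀ n, (ν n : Measure ℂ) Kᶜ = 0) {c : ℂ → ℂ}
    (hc : ∀ᵐ z : ℂ, Tendsto (fun n => cauchyTransform (ν n : Measure ℂ) z) atTop (𝓝 (c z))) :
    ∃ μ : ProbabilityMeasure ℂ, Tendsto ν atTop (𝓝 μ) ∧
      ∀ᵐ z : ℂ, cauchyTransform (μ : Measure ℂ) z = c z := by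
  have hcomp : IsCompact {μ : ProbabilityMeasure ℂ | ∀ _n : ℕ, μ Kᶜ ≤ (0 : NNReal)} :=
    isCompact_setOfPred_probabilityMeasure_mass_eq_compl_isCompact_le
      (u := fun _ => 0) (K := fun _ => K) tendsto_const_nhds (fun _ => hK) (Or.inr monotone_const)
  have hmem : ∀ n, ν n ∈ {μ : ProbabilityMeasure ℂ | ∀ _n : ℕ, μ Kᶜ ≤ (0 : NNReal)} := by
    intro n _
    rw [nonpos_iff_eq_zero, ProbabilityMeasure.null_iff_toMeasure_null]
    exact hν n
  have hclus : ∀ μ, MapClusterPt μ atTop ν →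
      ∀ᵐ z : ℂ, cauchyTransform (μ : Measure ℂ) z = c z := by
    intro μ hμ
    obtain ⟨ψ, hψ, hlim⟩ := hμ.tendsto_subseq
    refine ae_cauchyTransform_eq_of_tendsto hlim ?_
    filter_upwards [hc] with z hz using hz.comp hψ.tendsto_atTop
  obtain ⟨μ, -, hμ⟩ := hcomp.exists_mapClusterPt (f := atTop) (u := ν)
    (by rw [le_principal_iff]; exact mem_map.2 (Eventually.of_forall hmem))
  refine ⟨μ, ?_, hclus μ hμ⟩
  refine hcomp.tendsto_nhds_of_unique_mapClusterPt (Eventually.of_forall hmem) fun μ' _ hμ' => ?_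
  apply Subtype.ext
  refine measure_eq_of_cauchyTransform_ae_eq (μ := (μ' : Measure ℂ)) (ν := (μ : Measure ℂ)) ?_
  filter_upwards [hclus μ hμ, hclus μ' hμ'] with z h1 h2
  exact h2.trans h1.symm

/-! ### Root-counting measures -/

theorem integrable_sum_pointMass (s : Multiset ℂ) (f : ℂ → ℂ) :
    Integrable f (((s.map pointMass).sum : FiniteMeasure ℂ) : Measure ℂ) := by
  induction s using Multiset.induction with
  | empty => simp
  | cons a s ih =>
    rw [Multiset.map_cons, Multiset.sum_cons, FiniteMeasure.toMeasure_add]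
    exact Integrable.add_measure (integrable_dirac (by simp)) ih

theorem integral_sum_pointMass (s : Multiset ℂ) (f : ℂ → ℂ) :
    ∫ x, f x ∂(((s.map pointMass).sum : FiniteMeasure ℂ) : Measure ℂ) = (s.map f).sum := by
  induction s using Multiset.induction with
  | empty => simp
  | cons a s ih =>
    rw [Multiset.map_cons, Multiset.sum_cons, FiniteMeasure.toMeasure_add,
      pointMass, FiniteMeasure.toMeasure_mk,
      integral_add_measure (integrable_dirac (by simp)) (integrable_sum_pointMass s f), ih]
    simp

theorem sum_pointMass_apply (s : Multiset ℂ) {K : Set ℂ} (hK : MeasurableSet K)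
    (h : ∀ x ∈ s, x ∈ K) :
    (((s.map pointMass).sum : FiniteMeasure ℂ) : Measure ℂ) K = s.card ∧
    (((s.map pointMass).sum : FiniteMeasure ℂ) : Measure ℂ) Kᶜ = 0 := by
  induction s using Multiset.induction with
  | empty => simp
  | cons a s ih =>
    have ih' := ih fun x hx => h x (Multiset.mem_cons_of_mem hx)
    have ha : a ∈ K := h a (Multiset.mem_cons_self a s)
    rw [Multiset.map_cons, Multiset.sum_cons, FiniteMeasure.toMeasure_add]
    simp only [Measure.add_apply, ih'.1, ih'.2, pointMass]
    constructor
    · simp [ha, add_comm, Measure.dirac_apply' a hK]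
    · simp [ha, Measure.dirac_apply' a hK.compl]

theorem rootCountingMeasure_toMeasure (Q : ℂ[X]) :
    (rootCountingMeasure Q : Measure ℂ) =
      ((Q.natDegree : NNReal)⁻¹) • (((Q.roots.map pointMass).sum : FiniteMeasure ℂ) : Measure ℂ) := by
  rw [rootCountingMeasure, FiniteMeasure.toMeasure_smul]

theorem rootCountingMeasure_compl_eq_zero {Q : ℂ[X]} {K : Set ℂ} (hK : MeasurableSet K)
    (h : ∀ x ∈ Q.roots, x ∈ K) : (rootCountingMeasure Q : Measure ℂ) Kᶜ = 0 := by
  rw [rootCountingMeasure_toMeasure, Measure.smul_apply, (sum_pointMass_apply _ hK h).2]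
  simp

theorem isProbabilityMeasure_rootCountingMeasure {Q : ℂ[X]} (hQ : 0 < Q.natDegree) :
    IsProbabilityMeasure (rootCountingMeasure Q : Measure ℂ) := by
  constructor
  rw [rootCountingMeasure_toMeasure, Measure.smul_apply,
    (sum_pointMass_apply Q.roots MeasurableSet.univ fun x _ => Set.mem_univ x).1,
    ← (IsAlgClosed.splits Q).natDegree_eq_card_roots]
  have h0 : (Q.natDegree : NNReal) ≠ 0 := by exact_mod_cast hQ.ne'
  rw [ENNReal.smul_def, smul_eq_mul, ENNReal.coe_inv h0]
  simp only [ENNReal.coe_natCast]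
  exact ENNReal.inv_mul_cancel (by exact_mod_cast hQ.ne') (ENNReal.natCast_ne_top _)

theorem cauchyTransform_rootCountingMeasure {Q : ℂ[X]} {z : ℂ} (hz : Q.eval z ≠ 0) :
    cauchyTransform (rootCountingMeasure Q : Measure ℂ) z =
      Q.derivative.eval z / ((Q.natDegree : ℂ) * Q.eval z) := by
  rw [cauchyTransform, rootCountingMeasure_toMeasure, integral_smul_nnreal_measure,
    integral_sum_pointMass]
  have h := (IsAlgClosed.splits Q).eval_derivative_div_eval_of_ne_zero hz
  simp only [one_div] at h
  rw [← h, NNReal.smul_def]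
  simp only [NNReal.coe_inv, NNReal.coe_natCast, Complex.real_smul, Complex.ofReal_inv,
    Complex.ofReal_natCast]
  field_simp

/-- Gauss–Lucas, iterated: the convex hull of the roots of P serves for all m and n at once. -/
theorem exists_roots_iterate_derivative_subset (P : ℂ[X]) :
    ∃ K : Set ℂ, IsCompact K ∧ Convex ℝ K ∧ ∀ m n : ℕ, 0 < n → ∀ x ∈ (derivative^[m] (P ^ n)).roots,
      x ∈ K := by
  refine ⟨convexHull ℝ (P.rootSet ℂ), (P.rootSet_finite ℂ).isCompact_convexHull ℝ,
    convex_convexHull ℝ _, ?_⟩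
  intro m n hn
  induction m with
  | zero =>
    intro x hx
    apply subset_convexHull
    rw [Function.iterate_zero, id, roots_pow] at hx
    have := Multiset.mem_of_mem_nsmul hx
    rw [mem_roots'] at this
    rw [mem_rootSet]
    simpa using this
  | succ m ih =>
    intro x hx
    rw [Function.iterate_succ_apply'] at hx
    set Q := derivative^[m] (P ^ n)
    have hQ' : derivative Q ≠ 0 := (mem_roots'.1 hx).1
    have hdeg : 0 < Q.degree := by
      rw [← natDegree_pos_iff_degree_pos, Nat.pos_iff_ne_zero]
      intro h0
      rw [eq_C_of_natDegree_eq_zero h0] at hQ'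
      simp at hQ'
    have h1 : x ∈ (derivative Q).rootSet ℂ := by
      rw [mem_rootSet]; simpa using mem_roots'.1 hx
    refine convexHull_min ?_ (convex_convexHull ℝ _)
      (rootSet_derivative_subset_convexHull_rootSet hdeg h1)
    intro y hy
    apply ih
    rw [mem_rootSet] at hy
    rw [mem_roots']; simpa using hy

theorem natDegree_rodrigues (m n : ℕ) (P : ℂ[X]) :
    (rodrigues m n P).natDegree = n * P.natDegree - m := by
  have h := congrFun (factorial_smul_hasseDeriv (R := ℂ) (k := m)) (P ^ n)
  rw [rodrigues, ← h, LinearMap.smul_apply, natDegree_smul_of_smul_regular, natDegree_hasseDeriv,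
    natDegree_pow]
  exact (IsSMulRegular.of_ne_zero m.factorial_ne_zero)

theorem floor_lt_mul_natDegree {P : ℂ[X]} {α : ℝ} (hα : 0 < α) (hαd : α < (P.natDegree : ℝ)) {n : ℕ}
    (hn : 0 < n) : ⌊α * n⌋₊ < n * P.natDegree := by
  rw [Nat.floor_lt (by positivity)]
  have : (0 : ℝ) < n := by exact_mod_cast hn
  push_cast
  nlinarith

theorem natDegree_rodrigues_cast {P : ℂ[X]} {α : ℝ} (hα : 0 < α) (hαd : α < (P.natDegree : ℝ)) {n : ℕ}
    (hn : 0 < n) : ((rodrigues ⌊α * n⌋₊ n P).natDegree : ℂ) = (P.natDegree : ℂ) * n - ⌊α * n⌋₊ := by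
  rw [natDegree_rodrigues, Nat.cast_sub (floor_lt_mul_natDegree hα hαd hn).le]
  push_cast; ring

theorem exists_tendsto_rootCountingMeasure {P : ℂ[X]} {α : ℝ} (hα : 0 < α)
    (hαd : α < (P.natDegree : ℝ)) {c : ℂ → ℂ}
    (hc : ∀ᵐ z : ℂ, (∀ᶠ n : ℕ in atTop, (rodrigues ⌊α * n⌋₊ n P).eval z ≠ 0) ∧
      Tendsto (fun n : ℕ => rodriguesCauchy ⌊α * n⌋₊ n P z) atTop (𝓝 (c z))) :
    ∃ μ : ProbabilityMeasure ℂ,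
      Tendsto (fun n : ℕ => rootCountingMeasure (rodrigues ⌊α * n⌋₊ n P)) atTop
        (𝓝 μ.toFiniteMeasure) ∧
      ∀ᵐ z : ℂ, cauchyTransform (μ : Measure ℂ) z = c z := by
  have hdeg : ∀ n : ℕ, 0 < (rodrigues ⌊α * (n + 1 : ℕ)⌋₊ (n + 1) P).natDegree := by
    intro n
    rw [natDegree_rodrigues]
    exact Nat.sub_pos_of_lt (floor_lt_mul_natDegree hα hαd n.succ_pos)
  -- The index is shifted by one because P^0 is constant and its root-counting measure is zero.
  set ν : ℕ → ProbabilityMeasure ℂ := fun n =>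
    ⟨(rootCountingMeasure (rodrigues ⌊α * (n + 1 : ℕ)⌋₊ (n + 1) P) : Measure ℂ),
      isProbabilityMeasure_rootCountingMeasure (hdeg n)⟩ with hν
  obtain ⟨K, hK, -, hroots⟩ := exists_roots_iterate_derivative_subset P
  obtain ⟨μ, hμ, hμc⟩ := exists_tendsto_of_ae_tendsto_cauchyTransform (ν := ν) hK
    (fun n => rootCountingMeasure_compl_eq_zero hK.isClosed.measurableSet
      (hroots _ _ n.succ_pos)) (c := c) (by
      filter_upwards [hc] with z hz
      refine (hz.2.comp (tendsto_add_atTop_nat 1)).congr' ?_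
      filter_upwards [(tendsto_add_atTop_nat 1).eventually hz.1] with n hn
      simp only [hν, Function.comp, ProbabilityMeasure.coe_mk]
      rw [cauchyTransform_rootCountingMeasure hn, natDegree_rodrigues_cast hα hαd n.succ_pos]
      rfl)
  refine ⟨μ, ?_, hμc⟩
  rw [← tendsto_add_atTop_iff_nat 1]
  exact ProbabilityMeasure.tendsto_nhds_iff_toFiniteMeasure_tendsto_nhds _|>.1 hμ

/-! ### Coefficients as contour integrals on a square grid -/

/-- The integral of `f` along the boundary of the rectangle `[x₀, x₁] × [y₀, y₁]`. -/
noncomputable def rectIntegral (f : ℂ → ℂ) (x₀ x₁ y₀ y₁ : ℝ) : ℂ :=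
  (∫ x in x₀..x₁, f (x + y₀ * Complex.I)) - (∫ x in x₀..x₁, f (x + y₁ * Complex.I)) +
    Complex.I * (∫ y in y₀..y₁, f (x₁ + y * Complex.I)) -
    Complex.I * (∫ y in y₀..y₁, f (x₀ + y * Complex.I))

theorem rectIntegral_eq_zero_of_differentiableOn {f : ℂ → ℂ} {x₀ x₁ y₀ y₁ : ℝ} (hx : x₀ ≤ x₁)
    (hy : y₀ ≤ y₁) (hf : ∀ z : ℂ, z.re ∈ Set.Icc x₀ x₁ → z.im ∈ Set.Icc y₀ y₁ →
      DifferentiableAt ℂ f z) : rectIntegral f x₀ x₁ y₀ y₁ = 0 := by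
  have h := Complex.integral_boundary_rect_eq_zero_of_differentiableOn f (⟨x₀, y₀⟩ : ℂ) ⟨x₁, y₁⟩ (by
    rintro z ⟨h1, h2⟩
    simp only [Set.mem_preimage, Set.uIcc_of_le hx, Set.uIcc_of_le hy] at h1 h2
    exact (hf z h1 h2).differentiableWithinAt)
  simpa [rectIntegral, smul_eq_mul] using h

theorem horizontal_ne_zero {x y : ℝ} (h : y ≠ 0) : (x + y * Complex.I : ℂ) ≠ 0 := by
  intro h0
  have := congrArg Complex.im h0
  simp at this
  exact h this

theorem vertical_ne_zero {x y : ℝ} (h : x ≠ 0) : (x + y * Complex.I : ℂ) ≠ 0 := by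
  intro h0
  have := congrArg Complex.re h0
  simp at this
  exact h this

theorem continuous_horizontal {f : ℂ → ℂ} (hf : ∀ t, t ≠ 0 → ContinuousAt f t) {y : ℝ} (h : y ≠ 0) :
    Continuous fun x : ℝ => f (x + y * Complex.I) := by
  refine continuous_iff_continuousAt.2 fun x => ?_
  exact ContinuousAt.comp (f := fun x : ℝ => (x + y * Complex.I : ℂ)) (hf _ (horizontal_ne_zero h))
    (by fun_prop)

theorem continuous_vertical {f : ℂ → ℂ} (hf : ∀ t, t ≠ 0 → ContinuousAt f t) {x : ℝ} (h : x ≠ 0) :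
    Continuous fun y : ℝ => f (x + y * Complex.I) := by
  refine continuous_iff_continuousAt.2 fun y => ?_
  exact ContinuousAt.comp (f := fun y : ℝ => (x + y * Complex.I : ℂ)) (hf _ (vertical_ne_zero h))
    (by fun_prop)

theorem hasDerivAt_comp_line {F : ℂ → ℂ} {F' a b : ℂ} {x : ℝ} (h : HasDerivAt F F' (a + x * b)) :
    HasDerivAt (fun x : ℝ => F (a + x * b)) (b * F') x := by
  have h1 : HasDerivAt (fun u : ℂ => a + u * b) b (x : ℂ) := by
    simpa using ((hasDerivAt_id (x : ℂ)).mul_const b).const_add a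
  have h2 := (HasDerivAt.comp (x : ℂ) h h1).comp_ofReal
  rw [mul_comm] at h2
  exact h2

theorem rectIntegral_eq_zero_of_hasDerivAt {f F : ℂ → ℂ} (hf : ∀ t, t ≠ 0 → ContinuousAt f t)
    (hF : ∀ t, t ≠ 0 → HasDerivAt F (f t) t) {h : ℝ} (hh : 0 < h) :
    rectIntegral f (-h) h (-h) h = 0 := by
  have hhor : ∀ y : ℝ, y ≠ 0 → ∫ x in (-h)..h, f (x + y * Complex.I) =
      F ((h : ℝ) + y * Complex.I) - F ((-h : ℝ) + y * Complex.I) := by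
    intro y hy
    refine intervalIntegral.integral_eq_sub_of_hasDerivAt (f := fun x : ℝ => F (x + y * Complex.I))
      (fun x _ => ?_) ((continuous_horizontal hf hy).intervalIntegrable _ _)
    have h0 := hF _ (horizontal_ne_zero (x := x) hy)
    have h1 := hasDerivAt_comp_line (F := F) (F' := f (x + y * Complex.I))
      (a := y * Complex.I) (b := 1) (x := x) (by rw [mul_one, add_comm (y * Complex.I : ℂ)]; exact h0)
    simpa [add_comm] using h1
  have hver : ∀ x : ℝ, x ≠ 0 → Complex.I * ∫ y in (-h)..h, f (x + y * Complex.I) =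
      F (x + (h : ℝ) * Complex.I) - F (x + (-h : ℝ) * Complex.I) := by
    intro x hx
    rw [← intervalIntegral.integral_const_mul]
    refine intervalIntegral.integral_eq_sub_of_hasDerivAt (f := fun y : ℝ => F (x + y * Complex.I))
      (fun y _ => ?_) (((continuous_vertical hf hx).const_smul Complex.I).intervalIntegrable _ _)
    exact hasDerivAt_comp_line (hF _ (vertical_ne_zero (y := y) hx))
  rw [rectIntegral, hhor _ (neg_ne_zero.2 hh.ne'), hhor _ hh.ne', hver _ hh.ne',
    hver _ (neg_ne_zero.2 hh.ne')]
  ring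

/-- The right side of the square lies in the slit plane, where the principal logarithm is a
primitive; the argument runs from -π/4 to π/4. Quarter turns give the other sides. -/
theorem integral_inv_side {h : ℝ} (hh : 0 < h) :
    ∫ y in (-h)..h, ((h : ℂ) + y * Complex.I)⁻¹ = Real.pi / 2 := by
  have hmem : ∀ y : ℝ, ((h : ℂ) + y * Complex.I) ∈ Complex.slitPlane := fun y =>
    Or.inl (by simpa using hh)
  have h1 : ∫ y in (-h)..h, Complex.I * ((h : ℂ) + y * Complex.I)⁻¹ =
      Complex.log ((h : ℂ) + (h : ℝ) * Complex.I) - Complex.log ((h : ℂ) + (-h : ℝ) * Complex.I) := by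
    refine intervalIntegral.integral_eq_sub_of_hasDerivAt
      (f := fun y : ℝ => Complex.log ((h : ℂ) + y * Complex.I)) (fun y _ => ?_) ?_
    · exact hasDerivAt_comp_line (Complex.hasDerivAt_log (hmem y))
    · exact ((continuous_vertical (f := fun t => t⁻¹) (fun t ht => continuousAt_inv₀ ht)
        hh.ne').const_smul Complex.I).intervalIntegrable _ _
  have e1 : (h : ℂ) + (h : ℝ) * Complex.I = h * (1 + Complex.I) := by ring
  have e2 : (h : ℂ) + (-h : ℝ) * Complex.I = h * (1 - Complex.I) := by push_cast; ring
  have hconj : (1 - Complex.I) = (starRingEnd ℂ) (1 + Complex.I) := by simp [sub_eq_add_neg]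
  have harg : Complex.arg (1 + Complex.I) = Real.pi / 4 := by
    have : (1 + Complex.I) = ((√2 : ℝ) : ℂ) *
        (Complex.cos ((Real.pi / 4 : ℝ) : ℂ) + Complex.sin ((Real.pi / 4 : ℝ) : ℂ) * Complex.I) := by
      rw [← Complex.ofReal_cos, ← Complex.ofReal_sin, Real.cos_pi_div_four, Real.sin_pi_div_four]
      have h2 : ((√2 : ℝ) : ℂ) * ((√2 : ℝ) : ℂ) = 2 := by
        rw [← Complex.ofReal_mul, Real.mul_self_sqrt (by norm_num)]; norm_num
      push_cast
      linear_combination (-(1 + Complex.I) / 2) * h2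
    rw [this, Complex.arg_mul_cos_add_sin_mul_I (by positivity)]
    constructor <;> linarith [Real.pi_pos]
  rw [intervalIntegral.integral_const_mul, e1, e2, Complex.log_ofReal_mul hh (by
    intro h0; have := congrArg Complex.re h0; simp at this),
    Complex.log_ofReal_mul hh (by intro h0; have := congrArg Complex.re h0; simp at this), hconj,
    Complex.log_conj _ (by rw [harg]; linarith [Real.pi_pos])] at h1
  have h3 : Complex.log (1 + Complex.I) - (starRingEnd ℂ) (Complex.log (1 + Complex.I)) =
      Complex.I * (Real.pi / 2) := by
    rw [Complex.sub_conj, Complex.log_im, harg]; push_cast; ring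
  refine mul_left_cancel₀ Complex.I_ne_zero ?_
  rw [h1, ← h3]; ring

theorem rectIntegral_inv {h : ℝ} (hh : 0 < h) :
    rectIntegral (fun t => t⁻¹) (-h) h (-h) h = 2 * Real.pi * Complex.I := by
  have hJ := integral_inv_side hh
  have hJ' : ∫ y in (-h)..h, ((h : ℂ) - y * Complex.I)⁻¹ = Real.pi / 2 := by
    rw [← hJ]
    have := intervalIntegral.integral_comp_neg (a := -h) (b := h)
      (fun y : ℝ => ((h : ℂ) + y * Complex.I)⁻¹)
    rw [neg_neg] at this
    rw [← this]
    refine intervalIntegral.integral_congr fun y _ => ?_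
    simp only [Complex.ofReal_neg]
    rw [neg_mul, ← sub_eq_add_neg]
  have b1 : ∫ x in (-h)..h, ((x : ℂ) + (-h : ℝ) * Complex.I)⁻¹ = Complex.I * (Real.pi / 2) := by
    rw [← hJ, ← intervalIntegral.integral_const_mul]
    refine intervalIntegral.integral_congr fun x _ => ?_
    have : (x : ℂ) + (-h : ℝ) * Complex.I = -Complex.I * ((h : ℂ) + x * Complex.I) := by
      push_cast; linear_combination (x : ℂ) * Complex.I_mul_I
    rw [this, mul_inv, inv_neg, Complex.inv_I, neg_neg]
  have b2 : ∫ x in (-h)..h, ((x : ℂ) + (h : ℝ) * Complex.I)⁻¹ = -Complex.I * (Real.pi / 2) := by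
    rw [← hJ', ← intervalIntegral.integral_const_mul]
    refine intervalIntegral.integral_congr fun x _ => ?_
    have : (x : ℂ) + (h : ℝ) * Complex.I = Complex.I * ((h : ℂ) - x * Complex.I) := by
      linear_combination (x : ℂ) * (Complex.I_mul_I)
    rw [this, mul_inv, Complex.inv_I]
  have b3 : ∫ y in (-h)..h, (((-h : ℝ) : ℂ) + y * Complex.I)⁻¹ = -(Real.pi / 2) := by
    rw [← hJ', ← intervalIntegral.integral_neg]
    refine intervalIntegral.integral_congr fun x _ => ?_
    rw [← inv_neg]
    congr 1
    push_cast; ring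
  rw [rectIntegral, b1, b2, b3, hJ]
  ring

/-- Every term of the Laurent polynomial except the one in 1/t has a single-valued primitive away
from 0. -/
theorem rectIntegral_eval_div_pow (q : ℂ[X]) (k : ℕ) {h : ℝ} (hh : 0 < h) :
    rectIntegral (fun t => q.eval t / t ^ (k + 1)) (-h) h (-h) h =
      2 * Real.pi * Complex.I * q.coeff k := by
  set f : ℂ → ℂ := fun t => q.eval t / t ^ (k + 1)
  set g : ℂ → ℂ := fun t => q.eval t / t ^ (k + 1) - q.coeff k * t⁻¹ with hg
  set F : ℂ → ℂ := fun t => ∑ i ∈ (Finset.range (q.natDegree + 1)).erase k,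
    q.coeff i * (((i : ℤ) - k : ℤ) : ℂ)⁻¹ * t ^ ((i : ℤ) - k) with hF
  have hgc : ∀ t, t ≠ 0 → ContinuousAt g t := by
    intro t ht
    exact ((q.continuous.continuousAt).div (continuousAt_id.pow _) (pow_ne_zero _ ht)).sub
      (continuousAt_const.mul (continuousAt_inv₀ ht))
  have hFd : ∀ t, t ≠ 0 → HasDerivAt F (g t) t := by
    intro t ht
    have h1 : HasDerivAt F (∑ i ∈ (Finset.range (q.natDegree + 1)).erase k,
        q.coeff i * (((i : ℤ) - k : ℤ) : ℂ)⁻¹ * ((((i : ℤ) - k : ℤ) : ℂ) * t ^ ((i : ℤ) - k - 1))) t :=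
      HasDerivAt.fun_sum fun i _ => (hasDerivAt_zpow _ t (Or.inl ht)).const_mul _
    convert h1 using 1
    have h2 : ∀ i ∈ (Finset.range (q.natDegree + 1)).erase k,
        q.coeff i * (((i : ℤ) - k : ℤ) : ℂ)⁻¹ * ((((i : ℤ) - k : ℤ) : ℂ) * t ^ ((i : ℤ) - k - 1)) =
        q.coeff i * t ^ i / t ^ (k + 1) := by
      intro i hi
      have hik : ((i : ℤ) - k : ℤ) ≠ 0 := by
        have := (Finset.mem_erase.1 hi).1; omega
      have : (((i : ℤ) - k : ℤ) : ℂ) ≠ 0 := by exact_mod_cast hik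
      rw [mul_assoc, inv_mul_cancel_left₀ this, mul_div_assoc]
      congr 1
      rw [show (i : ℤ) - k - 1 = (i : ℤ) - ((k + 1 : ℕ) : ℤ) by push_cast; ring, zpow_sub₀ ht,
        zpow_natCast, zpow_natCast]
    rw [Finset.sum_congr rfl h2, hg]
    simp only
    rw [eval_eq_sum_range, Finset.sum_div]
    by_cases hk : k ∈ Finset.range (q.natDegree + 1)
    · rw [← Finset.add_sum_erase _ _ hk, pow_succ]
      field_simp
      ring
    · rw [Finset.erase_eq_of_notMem hk, coeff_eq_zero_of_natDegree_lt (by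
        rw [Finset.mem_range] at hk; omega)]
      ring
  have h0 := rectIntegral_eq_zero_of_hasDerivAt hgc hFd hh
  have hic : ∀ t : ℂ, t ≠ 0 → ContinuousAt (fun t : ℂ => q.coeff k * t⁻¹) t := fun t ht =>
    continuousAt_const.mul (continuousAt_inv₀ ht)
  have hneg : -h ≠ 0 := neg_ne_zero.2 hh.ne'
  have hsum : rectIntegral f (-h) h (-h) h = rectIntegral g (-h) h (-h) h +
      q.coeff k * rectIntegral (fun t => t⁻¹) (-h) h (-h) h := by
    have hfg : ∀ t, f t = g t + q.coeff k * t⁻¹ := fun t => by simp [f, g]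
    simp only [rectIntegral, hfg]
    rw [intervalIntegral.integral_add ((continuous_horizontal hgc hneg).intervalIntegrable _ _)
        ((continuous_horizontal hic hneg).intervalIntegrable _ _),
      intervalIntegral.integral_add ((continuous_horizontal hgc hh.ne').intervalIntegrable _ _)
        ((continuous_horizontal hic hh.ne').intervalIntegrable _ _),
      intervalIntegral.integral_add ((continuous_vertical hgc hneg).intervalIntegrable _ _)
        ((continuous_vertical hic hneg).intervalIntegrable _ _),
      intervalIntegral.integral_add ((continuous_vertical hgc hh.ne').intervalIntegrable _ _)
        ((continuous_vertical hic hh.ne').intervalIntegrable _ _)]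
    simp only [intervalIntegral.integral_const_mul]
    ring
  rw [hsum, h0, rectIntegral_inv hh]
  ring

/-- Cancellation of interior edges: φ is the integral over one edge of a square, the shifted term
the opposite edge, and only edges between S and its complement survive. -/
theorem norm_sum_sub_sum_shift_le (S : Finset (ℤ × ℤ)) (e : ℤ × ℤ) (φ : ℤ × ℤ → ℂ) {c : ℝ}
    (hc : 0 ≤ c) (h1 : ∀ s ∈ S, s - e ∉ S → ‖φ s‖ ≤ c) (h2 : ∀ s ∉ S, s - e ∈ S → ‖φ s‖ ≤ c) :
    ‖∑ s ∈ S, φ s - ∑ s ∈ S, φ (s + e)‖ ≤ 2 * (S.card * c) := by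
  set S' : Finset (ℤ × ℤ) := S.map (addRightEmbedding e) with hS'
  have hmem : ∀ s, s ∈ S' ↔ s - e ∈ S := by
    intro s
    rw [hS', Finset.mem_map]
    constructor
    · rintro ⟨a, ha, rfl⟩; simpa using ha
    · intro h; exact ⟨s - e, h, by simp⟩
  have e1 : ∑ s ∈ S, φ (s + e) = ∑ s ∈ S', φ s := by
    rw [hS', Finset.sum_map]; rfl
  rw [e1, ← Finset.sum_sdiff_sub_sum_sdiff]
  refine (norm_sub_le _ _).trans ?_
  rw [two_mul]
  refine add_le_add ?_ ?_
  · refine (norm_sum_le_of_le _ (f := φ) (n := fun _ => c) fun s hs => ?_).trans ?_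
    · rw [Finset.mem_sdiff, hmem] at hs
      exact h1 s hs.1 hs.2
    · rw [Finset.sum_const, nsmul_eq_mul]
      gcongr
      exact Finset.sdiff_subset
  · refine (norm_sum_le_of_le _ (f := φ) (n := fun _ => c) fun s hs => ?_).trans ?_
    · rw [Finset.mem_sdiff, hmem] at hs
      exact h2 s hs.2 hs.1
    · rw [Finset.sum_const, nsmul_eq_mul]
      refine mul_le_mul_of_nonneg_right ?_ hc
      have := Finset.card_le_card (Finset.sdiff_subset (s := S') (t := S))
      rw [hS', Finset.card_map] at this
      exact_mod_cast this

/-- The square of side `2 h` with index `s` in the square grid centred at the origin. -/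
def gridSquare (h : ℝ) (s : ℤ × ℤ) : Set ℂ :=
  {t | |t.re - 2 * h * s.1| ≤ h ∧ |t.im - 2 * h * s.2| ≤ h}

/-- Cauchy's estimate on the boundary of a union of grid squares. Summing rectangle integrals over S
avoids any description of that boundary as a curve: the central square gives the coefficient, the
others give 0, and interior edges cancel. -/
theorem norm_coeff_le_of_grid (q : ℂ[X]) (k : ℕ) {h : ℝ} (hh : 0 < h) (S : Finset (ℤ × ℤ))
    (h0 : (0, 0) ∈ S) {B : ℝ} (hB0 : 0 ≤ B)
    (hB : ∀ s ∈ S, ∀ s' ∉ S, ∀ t ∈ gridSquare h s, t ∈ gridSquare h s' →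
      ‖q.eval t‖ ≤ B * ‖t‖ ^ (k + 1)) :
    ‖q.coeff k‖ ≤ 2 * h * S.card * B := by
  set f : ℂ → ℂ := fun t => q.eval t / t ^ (k + 1) with hf
  have hfB : ∀ s ∈ S, ∀ s' ∉ S, ∀ t ∈ gridSquare h s, t ∈ gridSquare h s' → ‖f t‖ ≤ B := by
    intro s hs s' hs' t ht ht'
    rw [hf]
    simp only [norm_div, norm_pow]
    exact div_le_of_le_mul₀ (by positivity) hB0 (hB s hs s' hs' t ht ht')
  set Φ : ℤ × ℤ → ℂ := fun s => ∫ x in (2 * h * s.1 - h)..(2 * h * s.1 + h),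
    f (x + ((2 * h * s.2 - h : ℝ) : ℂ) * Complex.I) with hΦ
  set Ψ : ℤ × ℤ → ℂ := fun s => ∫ y in (2 * h * s.2 - h)..(2 * h * s.2 + h),
    f (((2 * h * s.1 - h : ℝ) : ℂ) + y * Complex.I) with hΨ
  set J : ℤ × ℤ → ℂ := fun s => rectIntegral f (2 * h * s.1 - h) (2 * h * s.1 + h)
    (2 * h * s.2 - h) (2 * h * s.2 + h) with hJ
  have hJeq : ∀ s, J s = (Φ s - Φ (s + (0, 1))) - Complex.I * (Ψ s - Ψ (s + (1, 0))) := by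
    intro s
    have e1 : (2 * h * ((s.2 + 1 : ℤ) : ℝ) - h : ℝ) = 2 * h * s.2 + h := by push_cast; ring
    have e2 : (2 * h * ((s.1 + 1 : ℤ) : ℝ) - h : ℝ) = 2 * h * s.1 + h := by push_cast; ring
    simp only [hJ, hΦ, hΨ, rectIntegral, Prod.fst_add, Prod.snd_add, add_zero, e1, e2]
    ring
  have hJ0 : J (0, 0) = 2 * Real.pi * Complex.I * q.coeff k := by
    rw [← rectIntegral_eval_div_pow q k hh]
    simp [hJ, hf]
  have hJs : ∀ s ∈ S, s ≠ (0, 0) → J s = 0 := by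
    intro s _ hs
    refine rectIntegral_eq_zero_of_differentiableOn (by linarith) (by linarith) fun z hx hy => ?_
    have hz : z ≠ 0 := by
      rintro rfl
      apply hs
      simp only [Complex.zero_re, Complex.zero_im, Set.mem_Icc] at hx hy
      have hone : ∀ i : ℤ, 2 * h * (i : ℝ) - h ≤ 0 → 0 ≤ 2 * h * (i : ℝ) + h → i = 0 := by
        intro i hi1 hi2
        have a1 : (i : ℝ) < 1 := by
          by_contra hc; push Not at hc; nlinarith
        have a2 : (-1 : ℝ) < i := by
          by_contra hc; push Not at hc; nlinarith
        have b1 : i < 1 := by exact_mod_cast a1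
        have b2 : -1 < i := by exact_mod_cast a2
        omega
      exact Prod.ext (hone _ hx.1 hx.2) (hone _ hy.1 hy.2)
    exact (q.differentiable.differentiableAt).div (differentiableAt_id.pow _) (pow_ne_zero _ hz)
  have hsum : ∑ s ∈ S, J s = 2 * Real.pi * Complex.I * q.coeff k := by
    rw [Finset.sum_eq_single_of_mem (0, 0) h0 hJs, hJ0]
  have hsum2 : ∑ s ∈ S, J s = (∑ s ∈ S, Φ s - ∑ s ∈ S, Φ (s + (0, 1))) -
      Complex.I * (∑ s ∈ S, Ψ s - ∑ s ∈ S, Ψ (s + (1, 0))) := by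
    simp_rw [hJeq, Finset.sum_sub_distrib, ← Finset.mul_sum, Finset.sum_sub_distrib]
  have hΦb : ∀ s : ℤ × ℤ, (∀ t ∈ gridSquare h s, t ∈ gridSquare h (s - (0, 1)) → ‖f t‖ ≤ B) →
      ‖Φ s‖ ≤ B * (2 * h) := by
    intro s hs
    have := intervalIntegral.norm_integral_le_of_norm_le_const (C := B)
      (a := 2 * h * s.1 - h) (b := 2 * h * s.1 + h)
      (f := fun x : ℝ => f (x + ((2 * h * s.2 - h : ℝ) : ℂ) * Complex.I)) (by
        intro x hx
        rw [Set.uIoc_of_le (by linarith)] at hx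
        apply hs
        · constructor
          · simp [abs_le]; constructor <;> linarith [hx.1, hx.2]
          · simp [abs_le]; linarith
        · constructor
          · simp [abs_le]; constructor <;> linarith [hx.1, hx.2]
          · simp [abs_le]; constructor <;> linarith)
    rw [show (2 * h * s.1 + h) - (2 * h * s.1 - h) = 2 * h by ring, abs_of_pos (by linarith)] at this
    exact this
  have hΨb : ∀ s : ℤ × ℤ, (∀ t ∈ gridSquare h s, t ∈ gridSquare h (s - (1, 0)) → ‖f t‖ ≤ B) →
      ‖Ψ s‖ ≤ B * (2 * h) := by
    intro s hs
    have := intervalIntegral.norm_integral_le_of_norm_le_const (C := B)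
      (a := 2 * h * s.2 - h) (b := 2 * h * s.2 + h)
      (f := fun y : ℝ => f (((2 * h * s.1 - h : ℝ) : ℂ) + y * Complex.I)) (by
        intro x hx
        rw [Set.uIoc_of_le (by linarith)] at hx
        apply hs
        · constructor
          · simp [abs_le]; linarith
          · simp [abs_le]; constructor <;> linarith [hx.1, hx.2]
        · constructor
          · simp [abs_le]; constructor <;> linarith
          · simp [abs_le]; constructor <;> linarith [hx.1, hx.2])
    rw [show (2 * h * s.2 + h) - (2 * h * s.2 - h) = 2 * h by ring, abs_of_pos (by linarith)] at this
    exact this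
  have b1 := norm_sum_sub_sum_shift_le S (0, 1) Φ (c := B * (2 * h)) (by positivity)
    (fun s hs hs' => hΦb s (hfB s hs _ hs'))
    (fun s hs hs' => hΦb s fun t ht ht' => hfB _ hs' s hs t ht' ht)
  have b2 := norm_sum_sub_sum_shift_le S (1, 0) Ψ (c := B * (2 * h)) (by positivity)
    (fun s hs hs' => hΨb s (hfB s hs _ hs'))
    (fun s hs hs' => hΨb s fun t ht ht' => hfB _ hs' s hs t ht' ht)
  have hfin : ‖2 * Real.pi * Complex.I * q.coeff k‖ ≤ 4 * (S.card * (B * (2 * h))) := by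
    rw [← hsum, hsum2]
    refine (norm_sub_le _ _).trans ?_
    rw [norm_mul, Complex.norm_I, one_mul]
    linarith
  rw [norm_mul, norm_mul, norm_mul, Complex.norm_I, mul_one, Complex.norm_real,
    Real.norm_of_nonneg Real.pi_pos.le, Complex.norm_two] at hfin
  -- The edge count bounds 2π |q_k| by 8 h |S| B, and 8/(2π) < 2.
  have hpi := Real.pi_gt_three
  have hn := norm_nonneg (q.coeff k)
  have hcard : (0 : ℝ) ≤ S.card * B * h := by positivity
  nlinarith

/-! ### Superlevel sets, basins and the mountain pass level -/

/-- The set of `w` with `‖P w‖ / ‖w - z‖ ^ α > l`. -/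
def superlevel (P : ℂ[X]) (α : ℝ) (z : ℂ) (l : ℝ) : Set ℂ :=
  {w | l * ‖w - z‖ ^ α < ‖P.eval w‖}

/-- The connected component of `z` in the superlevel set. -/
def basin (P : ℂ[X]) (α : ℝ) (z : ℂ) (l : ℝ) : Set ℂ :=
  connectedComponentIn (superlevel P α z l) z

/-- The mountain pass level: the smallest `l` for which the basin of `z` is bounded. -/
noncomputable def passLevel (P : ℂ[X]) (α : ℝ) (z : ℂ) : ℝ :=
  sInf {l | 0 < l ∧ Bornology.IsBounded (basin P α z l)}

theorem continuous_norm_sub_rpow {α : ℝ} (hα : 0 < α) (z : ℂ) :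
    Continuous fun w : ℂ => ‖w - z‖ ^ α :=
  (continuous_id.sub continuous_const).norm.rpow_const fun _ => Or.inr hα.le

theorem isOpen_superlevel (P : ℂ[X]) {α : ℝ} (hα : 0 < α) (z : ℂ) (l : ℝ) :
    IsOpen (superlevel P α z l) :=
  isOpen_lt (continuous_const.mul (continuous_norm_sub_rpow hα z)) P.continuous.norm

theorem mem_superlevel_self {P : ℂ[X]} {α : ℝ} (hα : 0 < α) {z : ℂ} (hz : P.eval z ≠ 0) (l : ℝ) :
    z ∈ superlevel P α z l := by
  simp [superlevel, Real.zero_rpow hα.ne', hz]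

theorem superlevel_anti (P : ℂ[X]) (α : ℝ) (z : ℂ) {l l' : ℝ} (h : l ≤ l') :
    superlevel P α z l' ⊆ superlevel P α z l := fun w hw =>
  (mul_le_mul_of_nonneg_right h (by positivity)).trans_lt hw

theorem isOpen_basin (P : ℂ[X]) {α : ℝ} (hα : 0 < α) (z : ℂ) (l : ℝ) : IsOpen (basin P α z l) :=
  (isOpen_superlevel P hα z l).connectedComponentIn

theorem basin_subset (P : ℂ[X]) (α : ℝ) (z : ℂ) (l : ℝ) : basin P α z l ⊆ superlevel P α z l :=
  connectedComponentIn_subset _ _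

theorem mem_basin_self {P : ℂ[X]} {α : ℝ} (hα : 0 < α) {z : ℂ} (hz : P.eval z ≠ 0) (l : ℝ) :
    z ∈ basin P α z l :=
  mem_connectedComponentIn (mem_superlevel_self hα hz l)

theorem basin_anti (P : ℂ[X]) (α : ℝ) (z : ℂ) {l l' : ℝ} (h : l ≤ l') :
    basin P α z l' ⊆ basin P α z l :=
  connectedComponentIn_mono _ (superlevel_anti P α z h)

theorem exists_norm_eval_ge (P : ℂ[X]) (hP : P ≠ 0) :
    ∃ R > 0, ∀ w : ℂ, R ≤ ‖w‖ → ‖P.leadingCoeff‖ / 2 * ‖w‖ ^ P.natDegree ≤ ‖P.eval w‖ := by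
  have hlead : 0 < ‖P.leadingCoeff‖ := by simpa using hP
  have hc : ContinuousAt (fun u : ℂ => ‖P.reverse.eval u‖) 0 := P.reverse.continuous.norm.continuousAt
  have h0 : ‖P.reverse.eval 0‖ = ‖P.leadingCoeff‖ := by
    rw [← coeff_zero_eq_eval_zero, coeff_zero_reverse]
  have hev : ∀ᶠ u in 𝓝 (0 : ℂ), ‖P.leadingCoeff‖ / 2 < ‖P.reverse.eval u‖ := by
    apply hc.eventually_const_lt
    simp only [h0]; linarith
  obtain ⟨δ, hδ, hball⟩ := Metric.eventually_nhds_iff.1 hev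
  refine ⟨2 / δ, by positivity, fun w hw => ?_⟩
  have hw0 : 0 < ‖w‖ := lt_of_lt_of_le (by positivity) hw
  have hwne : w ≠ 0 := norm_pos_iff.1 hw0
  have h1 := hball (y := w⁻¹) (by
    rw [dist_zero_right, norm_inv, inv_lt_comm₀ hw0 hδ]
    refine lt_of_lt_of_le ?_ hw
    rw [inv_eq_one_div]
    gcongr
    norm_num)
  let _ := invertibleOfNonzero hwne
  have h2 := eval₂_reverse_mul_pow (RingHom.id ℂ) w P
  rw [invOf_eq_inv, eval₂_id, eval₂_id] at h2
  rw [← h2, norm_mul, norm_pow]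
  gcongr

/-- As α < d, the quotient |P(w)|/|w - z|^α tends to infinity with w, uniformly for bounded z. -/
theorem exists_mem_superlevel_of_norm_ge {P : ℂ[X]} {α : ℝ} (hα : 0 < α)
    (hαd : α < (P.natDegree : ℝ)) (A L : ℝ) :
    ∃ R > 0, ∀ z : ℂ, ‖z‖ ≤ A → ∀ l ≤ L, ∀ w : ℂ, R ≤ ‖w‖ → w ∈ superlevel P α z l := by
  have hP : P ≠ 0 := by
    rintro rfl; simp at hαd; linarith
  obtain ⟨R₀, hR₀, hR⟩ := exists_norm_eval_ge P hP
  have hlead : 0 < ‖P.leadingCoeff‖ := by simpa using hP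
  have ht := tendsto_rpow_atTop (sub_pos.2 hαd)
  obtain ⟨R₁, hR₁⟩ := (ht.eventually_gt_atTop (2 * |L| * 2 ^ α / ‖P.leadingCoeff‖)).exists_forall_of_atTop
  refine ⟨max R₀ (max R₁ (|A| + 1)), lt_max_of_lt_left hR₀, fun z hz l hl w hw => ?_⟩
  have hw0 : R₀ ≤ ‖w‖ := (le_max_left _ _).trans hw
  have hw1 : R₁ ≤ ‖w‖ := ((le_max_left _ _).trans (le_max_right _ _)).trans hw
  have hw2 : |A| + 1 ≤ ‖w‖ := ((le_max_right _ _).trans (le_max_right _ _)).trans hw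
  have hwpos : 0 < ‖w‖ := hR₀.trans_le hw0
  have hsub : ‖w - z‖ ≤ 2 * ‖w‖ := by
    have := norm_sub_le w z
    have := le_abs_self A
    linarith
  have h3 := hR₁ ‖w‖ hw1
  have h4 : ‖w‖ ^ (P.natDegree : ℕ) = ‖w‖ ^ ((P.natDegree : ℝ) - α) * ‖w‖ ^ α := by
    rw [← Real.rpow_add hwpos, sub_add_cancel, Real.rpow_natCast]
  have hwα : 0 < ‖w‖ ^ α := Real.rpow_pos_of_pos hwpos _
  calc l * ‖w - z‖ ^ α ≤ |L| * (2 * ‖w‖) ^ α := by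
        refine mul_le_mul (hl.trans (le_abs_self L)) ?_ (by positivity) (abs_nonneg _)
        exact Real.rpow_le_rpow (norm_nonneg _) hsub hα.le
    _ = |L| * 2 ^ α * ‖w‖ ^ α := by
        rw [Real.mul_rpow (by norm_num) hwpos.le]; ring
    _ < ‖P.leadingCoeff‖ / 2 * ‖w‖ ^ ((P.natDegree : ℝ) - α) * ‖w‖ ^ α := by
        apply mul_lt_mul_of_pos_right _ hwα
        rw [div_lt_iff₀ hlead] at h3
        linarith
    _ = ‖P.leadingCoeff‖ / 2 * ‖w‖ ^ P.natDegree := by rw [h4]; ring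
    _ ≤ ‖P.eval w‖ := hR w hw0

/-- A component reaching the region |w| ≥ R contains the outward ray from there. So a bounded basin
is automatically inside the disc of radius R. -/
theorem not_isBounded_connectedComponentIn_of_ray {F : Set ℂ} {x w : ℂ} {R : ℝ} (hR : 0 < R)
    (hF : ∀ w : ℂ, R ≤ ‖w‖ → w ∈ F) (hw : w ∈ connectedComponentIn F x) (hwR : R ≤ ‖w‖) :
    ¬ Bornology.IsBounded (connectedComponentIn F x) := by
  set ray : Set ℂ := (fun t : ℝ => (t : ℂ) * w) '' Set.Ici 1 with hray
  have hconn : IsPreconnected ray :=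
    isPreconnected_Ici.image _ (by fun_prop)
  have hwray : w ∈ ray := ⟨1, Set.self_mem_Ici, by simp⟩
  have hrayF : ray ⊆ F := by
    rintro _ ⟨t, ht, rfl⟩
    apply hF
    have ht : 1 ≤ t := ht
    rw [norm_mul, Complex.norm_real, Real.norm_of_nonneg (by linarith)]
    nlinarith
  have hsub : ray ⊆ connectedComponentIn F x := by
    rw [connectedComponentIn_eq hw]
    exact hconn.subset_connectedComponentIn hwray hrayF
  intro hb
  obtain ⟨C, hC⟩ := (hb.subset hsub).exists_norm_le
  have h1 := hC (((|C| + 1) / R + 1 : ℝ) * w) ⟨(|C| + 1) / R + 1, by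
    show (1 : ℝ) ≤ _
    have : 0 ≤ (|C| + 1) / R := by positivity
    linarith, rfl⟩
  rw [norm_mul, Complex.norm_real, Real.norm_of_nonneg (by positivity)] at h1
  have h2 : |C| + 1 ≤ (|C| + 1) / R * ‖w‖ := by
    rw [div_mul_eq_mul_div, le_div_iff₀ hR]
    gcongr
  have := le_abs_self C
  nlinarith

theorem basin_subset_ball_of_isBounded {P : ℂ[X]} {α : ℝ} {z : ℂ} {l R : ℝ} (hR : 0 < R)
    (hF : ∀ w : ℂ, R ≤ ‖w‖ → w ∈ superlevel P α z l) (hb : Bornology.IsBounded (basin P α z l)) :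
    basin P α z l ⊆ Metric.ball 0 R := by
  intro w hw
  by_contra hc
  exact not_isBounded_connectedComponentIn_of_ray hR hF hw (by simpa using hc) hb

/-- Once l exceeds |P| on the unit circle about z, that circle misses the superlevel set and traps
the basin. -/
theorem exists_level_isBounded_basin (P : ℂ[X]) (α : ℝ) (A : ℝ) :
    ∃ L > 0, ∀ z : ℂ, ‖z‖ ≤ A → ∀ l ≥ L, Bornology.IsBounded (basin P α z l) := by
  obtain ⟨M, hM⟩ := (isCompact_closedBall (0 : ℂ) (A + 1)).exists_bound_of_continuousOn
    P.continuous.continuousOn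
  refine ⟨max M 1, by positivity, fun z hz l hl => ?_⟩
  refine Metric.isBounded_ball.subset (t := Metric.ball z 1) fun w hw => ?_
  by_contra hwb
  have hpre : IsPreconnected (basin P α z l) := isPreconnected_connectedComponentIn
  have hz : z ∈ basin P α z l := by
    refine mem_connectedComponentIn ?_
    have : (superlevel P α z l).Nonempty ∧ z ∈ superlevel P α z l := by
      by_contra h
      have hz' : z ∉ superlevel P α z l := fun h' => h ⟨⟨z, h'⟩, h'⟩
      rw [basin, connectedComponentIn_eq_empty hz'] at hw
      exact hw
    exact this.2
  have hsph : ∀ x ∈ basin P α z l, ‖x - z‖ ≠ 1 := by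
    intro x hx hx1
    have h1 : l * ‖x - z‖ ^ α < ‖P.eval x‖ := basin_subset P α z l hx
    rw [hx1, Real.one_rpow, mul_one] at h1
    have h2 : ‖P.eval x‖ ≤ M := hM x (by
      rw [mem_closedBall_zero_iff]
      calc ‖x‖ = ‖(x - z) + z‖ := by rw [sub_add_cancel]
        _ ≤ ‖x - z‖ + ‖z‖ := norm_add_le _ _
        _ ≤ A + 1 := by linarith)
    have := le_max_left M 1
    linarith
  obtain ⟨x, hx, hx1⟩ := hpre.intermediate_value hz hw
    (f := fun x : ℂ => ‖x - z‖) (by fun_prop)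
    (show (1 : ℝ) ∈ Set.Icc ‖z - z‖ ‖w - z‖ by
      constructor
      · simp
      · rw [Metric.mem_ball, dist_eq_norm, not_lt] at hwb
        exact hwb)
  exact hsph x hx hx1

theorem mem_basin_of_path {P : ℂ[X]} {α : ℝ} {z w : ℂ} {l : ℝ} (γ : Path z w)
    (h : ∀ t, γ t ∈ superlevel P α z l) : w ∈ basin P α z l := by
  have h1 : IsPreconnected (Set.range γ) := isPreconnected_range γ.continuous
  refine h1.subset_connectedComponentIn ⟨0, γ.source⟩ ?_ ⟨1, γ.target⟩
  rintro _ ⟨t, rfl⟩; exact h t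

/-- A strict inequality on a compact path leaves room to raise the level. -/
theorem exists_mem_basin_of_path {P : ℂ[X]} {α : ℝ} (hα : 0 < α) {z w : ℂ} {l : ℝ} (γ : Path z w)
    (h : ∀ t, γ t ∈ superlevel P α z l) : ∃ l' > l, w ∈ basin P α z l' := by
  have hc : Continuous fun t => ‖P.eval (γ t)‖ - l * ‖γ t - z‖ ^ α :=
    (P.continuous.comp γ.continuous).norm.sub
      (continuous_const.mul ((continuous_norm_sub_rpow hα z).comp γ.continuous))
  obtain ⟨t₀, -, ht₀⟩ := isCompact_univ.exists_isMinOn ⟨0, Set.mem_univ _⟩ hc.continuousOn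
  obtain ⟨M, hM⟩ := isCompact_univ.exists_bound_of_continuousOn
    ((continuous_norm_sub_rpow hα z).comp γ.continuous).continuousOn
  set m := ‖P.eval (γ t₀)‖ - l * ‖γ t₀ - z‖ ^ α with hm
  have hm0 : 0 < m := sub_pos.2 (h t₀)
  have hM0 : 0 ≤ M := (norm_nonneg _).trans (hM 0 (Set.mem_univ _))
  refine ⟨l + m / (M + 1), by have : 0 < m / (M + 1) := by positivity
                              linarith, mem_basin_of_path γ fun t => ?_⟩
  have h1 : m ≤ ‖P.eval (γ t)‖ - l * ‖γ t - z‖ ^ α := ht₀ (Set.mem_univ t)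
  have h2 : ‖γ t - z‖ ^ α ≤ M := (le_abs_self _).trans (hM t (Set.mem_univ t))
  have h3 : m / (M + 1) * ‖γ t - z‖ ^ α ≤ m / (M + 1) * M := by gcongr
  have h4 : m / (M + 1) * M < m := by
    rw [div_mul_eq_mul_div, div_lt_iff₀ (by positivity)]
    nlinarith
  show (l + m / (M + 1)) * ‖γ t - z‖ ^ α < ‖P.eval (γ t)‖
  linarith

theorem exists_path_of_mem_basin {P : ℂ[X]} {α : ℝ} (hα : 0 < α) {z w : ℂ} {l : ℝ}
    (hw : w ∈ basin P α z l) : ∃ γ : Path z w, ∀ t, γ t ∈ superlevel P α z l := by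
  have hz : z ∈ basin P α z l := by
    refine mem_connectedComponentIn ?_
    by_contra hz'
    rw [basin, connectedComponentIn_eq_empty hz'] at hw
    exact hw
  have hpc : IsPathConnected (basin P α z l) :=
    ((isOpen_basin P hα z l).isConnected_iff_isPathConnected).1
      ⟨⟨z, hz⟩, isPreconnected_connectedComponentIn⟩
  obtain ⟨γ, hγ⟩ := hpc.joinedIn z hz w hw
  exact ⟨γ, fun t => basin_subset P α z l (hγ t)⟩

/-- The complement of the finitely many roots is path connected, so z is joined to a far point by a
path on which |P| has a positive minimum. This makes the pass level positive. -/
theorem exists_pos_level_not_isBounded {P : ℂ[X]} {α : ℝ} (hα : 0 < α)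
    (hαd : α < (P.natDegree : ℝ)) {z : ℂ} (hz : P.eval z ≠ 0) :
    ∃ l > 0, ¬ Bornology.IsBounded (basin P α z l) := by
  have hP : P ≠ 0 := by rintro rfl; simp at hz
  obtain ⟨R, hR, hfar⟩ := exists_mem_superlevel_of_norm_ge hα hαd ‖z‖ 1
  have hw : P.eval (R : ℂ) ≠ 0 := by
    have h1 : (0 : ℝ) * ‖(R : ℂ) - z‖ ^ α < ‖P.eval (R : ℂ)‖ :=
      hfar z le_rfl 0 zero_le_one R (by simp [abs_of_pos hR])
    simpa using h1
  have hcount : (P.rootSet ℂ).Countable := (P.rootSet_finite ℂ).countable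
  have hpc := hcount.isPathConnected_compl_of_one_lt_rank (by simp [Complex.rank_real_complex])
  have hmem : ∀ x : ℂ, P.eval x ≠ 0 → x ∈ (P.rootSet ℂ)ᶜ := by
    intro x hx
    rw [Set.mem_compl_iff, mem_rootSet]
    simp [hx]
  obtain ⟨γ, hγ⟩ := hpc.joinedIn z (hmem z hz) R (hmem _ hw)
  have hγ' : ∀ t, γ t ∈ superlevel P α z 0 := by
    intro t
    have := hγ t
    rw [Set.mem_compl_iff, mem_rootSet] at this
    simp only [hP, ne_eq, not_false_eq_true, coe_aeval_eq_eval, true_and] at this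
    simpa [superlevel] using this
  obtain ⟨l, hl, hmemb⟩ := exists_mem_basin_of_path hα γ hγ'
  refine ⟨min l 1, lt_min hl one_pos, ?_⟩
  refine not_isBounded_connectedComponentIn_of_ray hR (fun w hw => hfar z le_rfl _ (min_le_right _ _) w hw)
    (basin_anti P α z (min_le_left l 1) hmemb) (by simp [abs_of_pos hR])

theorem bddBelow_passLevel_set (P : ℂ[X]) (α : ℝ) (z : ℂ) :
    BddBelow {l | 0 < l ∧ Bornology.IsBounded (basin P α z l)} := ⟨0, fun _ hl => hl.1.le⟩

theorem passLevel_pos {P : ℂ[X]} {α : ℝ} (hα : 0 < α)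
    (hαd : α < (P.natDegree : ℝ)) {z : ℂ} (hz : P.eval z ≠ 0) : 0 < passLevel P α z := by
  obtain ⟨l, hl, hub⟩ := exists_pos_level_not_isBounded hα hαd hz
  obtain ⟨L, hL, hLb⟩ := exists_level_isBounded_basin P α ‖z‖
  refine hl.trans_le (le_csInf ⟨L, hL, hLb z le_rfl L le_rfl⟩ fun l' hl' => ?_)
  by_contra hc
  exact hub (hl'.2.subset (basin_anti P α z (not_le.1 hc).le))

theorem passLevel_le {P : ℂ[X]} {α : ℝ} {z : ℂ} {l : ℝ} (hl : 0 < l)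
    (hb : Bornology.IsBounded (basin P α z l)) : passLevel P α z ≤ l :=
  csInf_le (bddBelow_passLevel_set P α z) ⟨hl, hb⟩

theorem not_isBounded_basin_of_lt_passLevel {P : ℂ[X]} {α : ℝ} {z : ℂ} {l : ℝ} (hl : 0 < l)
    (h : l < passLevel P α z) : ¬ Bornology.IsBounded (basin P α z l) := fun hb =>
  (passLevel_le hl hb).not_gt h

/-- The infimum is attained: an unbounded basin would contain a path to a far point, which survives
at slightly higher levels, contrary to the choice of the infimum. -/
theorem isBounded_basin_passLevel {P : ℂ[X]} {α : ℝ} (hα : 0 < α)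
    (hαd : α < (P.natDegree : ℝ)) {z : ℂ} (hz : P.eval z ≠ 0) :
    Bornology.IsBounded (basin P α z (passLevel P α z)) := by
  have hpos := passLevel_pos hα hαd hz
  obtain ⟨R, hR, hfar⟩ := exists_mem_superlevel_of_norm_ge hα hαd ‖z‖ (2 * passLevel P α z)
  obtain ⟨L, hL, hLb⟩ := exists_level_isBounded_basin P α ‖z‖
  refine Metric.isBounded_ball.subset (t := Metric.ball 0 R) fun w hw => ?_
  by_contra hwR
  rw [mem_ball_zero_iff, not_lt] at hwR
  obtain ⟨γ, hγ⟩ := exists_path_of_mem_basin hα hw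
  obtain ⟨l, hl, hwl⟩ := exists_mem_basin_of_path hα γ hγ
  have hne : {l | 0 < l ∧ Bornology.IsBounded (basin P α z l)}.Nonempty :=
    ⟨L, hL, hLb z le_rfl L le_rfl⟩
  obtain ⟨l', ⟨hl'0, hl'b⟩, hl'⟩ := exists_lt_of_csInf_lt hne
    (show passLevel P α z < min l (2 * passLevel P α z) from lt_min hl (by linarith))
  exact not_isBounded_connectedComponentIn_of_ray hR
    (fun w hw => hfar z le_rfl _ (hl'.le.trans (min_le_right _ _)) w hw)
    (basin_anti P α z (hl'.le.trans (min_le_left _ _)) hwl) hwR hl'b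

theorem exists_closedBall_subset_superlevel {P : ℂ[X]} {α : ℝ} (hα : 0 < α) {z₀ : ℂ}
    (hz₀ : P.eval z₀ ≠ 0) (L : ℝ) :
    ∃ r > 0, ∀ z ∈ Metric.closedBall z₀ r, ∀ l ≤ L, Metric.closedBall z₀ r ⊆ superlevel P α z l := by
  have hc : Continuous fun p : ℂ × ℂ => ‖P.eval p.2‖ - |L| * ‖p.2 - p.1‖ ^ α := by
    refine (P.continuous.comp continuous_snd).norm.sub (continuous_const.mul ?_)
    exact (continuous_snd.sub continuous_fst).norm.rpow_const fun _ => Or.inr hα.le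
  have h0 : 0 < ‖P.eval z₀‖ - |L| * ‖z₀ - z₀‖ ^ α := by
    simp [Real.zero_rpow hα.ne', hz₀]
  have hev := (hc.tendsto (z₀, z₀)).eventually_const_lt h0
  obtain ⟨ε, hε, hball⟩ := Metric.eventually_nhds_iff.1 hev
  refine ⟨ε / 2, by positivity, fun z hz l hl w hw => ?_⟩
  have h1 := hball (y := (z, w)) (by
    rw [Prod.dist_eq]
    exact max_lt (lt_of_le_of_lt hz (by linarith)) (lt_of_le_of_lt hw (by linarith)))
  show l * ‖w - z‖ ^ α < ‖P.eval w‖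
  have h2 : l * ‖w - z‖ ^ α ≤ |L| * ‖w - z‖ ^ α :=
    mul_le_mul_of_nonneg_right (hl.trans (le_abs_self L)) (by positivity)
  simp only at h1
  linarith

/-- Within the fixed ball about z₀ every point belongs to the superlevel set; outside it, replacing
z' by z multiplies |w - z'| by at most 1 + |z' - z|/(r/2). Compensating this factor in the level
nests the basins, which gives continuity of the pass level. -/
theorem basin_subset_basin_of_dist {P : ℂ[X]} {α : ℝ} (hα : 0 < α) {z₀ z z' : ℂ} {r L l l' : ℝ}
    (hr : 0 < r)
    (hsub : ∀ z ∈ Metric.closedBall z₀ r, ∀ l ≤ L, Metric.closedBall z₀ r ⊆ superlevel P α z l)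
    (hz : z ∈ Metric.closedBall z₀ (r / 2)) (hz' : z' ∈ Metric.closedBall z₀ (r / 2)) (hl0 : 0 ≤ l)
    (hl : l ≤ L) (hll' : l * (1 + dist z' z / (r / 2)) ^ α ≤ l') :
    basin P α z' l' ⊆ basin P α z l := by
  have hsup : superlevel P α z' l' ⊆ superlevel P α z l := by
    intro w hw
    by_cases hwr : w ∈ Metric.closedBall z₀ r
    · exact hsub z (Metric.closedBall_subset_closedBall (by linarith) hz) l hl hwr
    · have hw1 : r / 2 ≤ ‖w - z'‖ := by
        rw [Metric.mem_closedBall, not_le] at hwr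
        rw [Metric.mem_closedBall] at hz'
        have := dist_triangle w z' z₀
        rw [← dist_eq_norm]; linarith
      have hw0 : 0 < ‖w - z'‖ := by linarith
      have hw2 : ‖w - z‖ ≤ (1 + dist z' z / (r / 2)) * ‖w - z'‖ := by
        have h1 : ‖w - z‖ ≤ ‖w - z'‖ + dist z' z := by
          rw [dist_eq_norm]; simpa using norm_add_le (w - z') (z' - z)
        have h2 : dist z' z ≤ dist z' z / (r / 2) * ‖w - z'‖ := by
          rw [div_mul_eq_mul_div, le_div_iff₀ (by linarith)]
          gcongr
        linarith
      have hd : 0 ≤ dist z' z / (r / 2) := by positivity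
      calc l * ‖w - z‖ ^ α ≤ l * ((1 + dist z' z / (r / 2)) * ‖w - z'‖) ^ α := by
            gcongr
        _ = l * (1 + dist z' z / (r / 2)) ^ α * ‖w - z'‖ ^ α := by
            rw [Real.mul_rpow (by linarith) hw0.le]; ring
        _ ≤ l' * ‖w - z'‖ ^ α := by gcongr
        _ < ‖P.eval w‖ := hw
  have hmem : z' ∈ basin P α z l := by
    have h1 : Metric.closedBall z₀ r ⊆ superlevel P α z l :=
      hsub z (Metric.closedBall_subset_closedBall (by linarith) hz) l hl
    have h2 : Metric.closedBall z₀ r ⊆ basin P α z l :=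
      (convex_closedBall z₀ r).isPreconnected.subset_connectedComponentIn
        (Metric.closedBall_subset_closedBall (by linarith) hz) h1
    exact h2 (Metric.closedBall_subset_closedBall (by linarith) hz')
  have := connectedComponentIn_eq hmem
  rw [basin, basin, this]
  exact connectedComponentIn_mono _ hsup

theorem exists_passLevel_le_mul {P : ℂ[X]} {α : ℝ} (hα : 0 < α) (hαd : α < (P.natDegree : ℝ))
    {z₀ : ℂ} (hz₀ : P.eval z₀ ≠ 0) :
    ∃ r > 0, ∃ L > 0, (∀ z ∈ Metric.closedBall z₀ r, P.eval z ≠ 0 ∧ passLevel P α z ≤ L) ∧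
      (∀ z ∈ Metric.closedBall z₀ r, ∀ l ≤ L, Metric.closedBall z₀ r ⊆ superlevel P α z l) ∧
      ∀ z ∈ Metric.closedBall z₀ (r / 2), ∀ z' ∈ Metric.closedBall z₀ (r / 2),
        passLevel P α z' ≤ passLevel P α z * (1 + dist z' z / (r / 2)) ^ α := by
  obtain ⟨L, hL, hLb⟩ := exists_level_isBounded_basin P α (‖z₀‖ + 1)
  obtain ⟨r₁, hr₁, hsub⟩ := exists_closedBall_subset_superlevel hα hz₀ L
  set r := min r₁ 1 with hr
  have hr0 : 0 < r := lt_min hr₁ one_pos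
  have hsub' : ∀ z ∈ Metric.closedBall z₀ r, ∀ l ≤ L,
      Metric.closedBall z₀ r ⊆ superlevel P α z l := fun z hz l hl =>
    (Metric.closedBall_subset_closedBall (min_le_left _ _)).trans
      (hsub z (Metric.closedBall_subset_closedBall (min_le_left _ _) hz) l hl)
  have hPz : ∀ z ∈ Metric.closedBall z₀ r, P.eval z ≠ 0 := by
    intro z hz
    have h1 : 0 * ‖z - z‖ ^ α < ‖P.eval z‖ := hsub' z hz 0 hL.le hz
    simpa using h1
  have hle : ∀ z ∈ Metric.closedBall z₀ r, passLevel P α z ≤ L := by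
    intro z hz
    refine passLevel_le hL (hLb z ?_ L le_rfl)
    have h1 : dist z z₀ ≤ 1 := le_trans hz (min_le_right _ _)
    have h2 : ‖z‖ ≤ ‖z - z₀‖ + ‖z₀‖ := by simpa using norm_add_le (z - z₀) z₀
    rw [dist_eq_norm] at h1
    linarith
  have hhalf : Metric.closedBall z₀ (r / 2) ⊆ Metric.closedBall z₀ r :=
    Metric.closedBall_subset_closedBall (by linarith)
  refine ⟨r, hr0, L, hL, fun z hz => ⟨hPz z hz, hle z hz⟩, hsub', fun z hz z' hz' => ?_⟩
  have hpos := passLevel_pos hα hαd (hPz z (hhalf hz))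
  have hd : 0 ≤ dist z' z / (r / 2) := by positivity
  refine passLevel_le (by positivity) ?_
  exact (isBounded_basin_passLevel hα hαd (hPz z (hhalf hz))).subset
    (basin_subset_basin_of_dist hα hr0 hsub' hz hz' hpos.le (hle z (hhalf hz)) le_rfl)

theorem continuousAt_passLevel {P : ℂ[X]} {α : ℝ} (hα : 0 < α) (hαd : α < (P.natDegree : ℝ))
    {z₀ : ℂ} (hz₀ : P.eval z₀ ≠ 0) : ContinuousAt (passLevel P α) z₀ := by
  obtain ⟨r, hr, L, hL, -, -, hle⟩ := exists_passLevel_le_mul hα hαd hz₀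
  have hc : ContinuousAt (fun z => (1 + dist z z₀ / (r / 2)) ^ α) z₀ := by
    refine ContinuousAt.rpow_const (by fun_prop) (Or.inr hα.le)
  have h1 : Tendsto (fun z => passLevel P α z₀ * (1 + dist z z₀ / (r / 2)) ^ α) (𝓝 z₀)
      (𝓝 (passLevel P α z₀)) := by
    have := hc.tendsto.const_mul (passLevel P α z₀)
    simpa using this
  have h2 : Tendsto (fun z => passLevel P α z₀ / (1 + dist z z₀ / (r / 2)) ^ α) (𝓝 z₀)
      (𝓝 (passLevel P α z₀)) := by
    have := (tendsto_const_nhds (x := passLevel P α z₀)).div hc.tendsto (by simp)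
    simp only [dist_self, zero_div, add_zero, Real.one_rpow, div_one] at this
    exact this
  have hball : ∀ᶠ z in 𝓝 z₀, z ∈ Metric.closedBall z₀ (r / 2) :=
    Metric.closedBall_mem_nhds _ (by linarith)
  have hz₀mem : z₀ ∈ Metric.closedBall z₀ (r / 2) := Metric.mem_closedBall_self (by linarith)
  refine tendsto_of_tendsto_of_tendsto_of_le_of_le' h2 h1 ?_ ?_
  · filter_upwards [hball] with z hz
    have hd : 0 ≤ dist z z₀ / (r / 2) := by positivity
    rw [div_le_iff₀ (by positivity)]
    have := hle z hz z₀ hz₀mem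
    rwa [dist_comm] at this
  · filter_upwards [hball] with z hz
    exact hle z₀ hz₀mem z hz

/-! ### Local structure of level sets and the pass point -/

/-- A local branch of `log (P w / (w - z) ^ α)` near `w₁`, normalised to vanish at `w₁`. -/
noncomputable def logBranch (P : ℂ[X]) (α : ℝ) (z w₁ w : ℂ) : ℂ :=
  Complex.log (P.eval w / P.eval w₁) - α * Complex.log ((w - z) / (w₁ - z))

theorem logBranch_self {P : ℂ[X]} {α : ℝ} {z w₁ : ℂ} (hw₁ : P.eval w₁ ≠ 0) (hz : w₁ ≠ z) :
    logBranch P α z w₁ w₁ = 0 := by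
  simp [logBranch, hw₁, sub_ne_zero.2 hz]

theorem hasDerivAt_logBranch {P : ℂ[X]} {α : ℝ} {z w₁ w : ℂ} (hw₁ : P.eval w₁ ≠ 0) (hz : w₁ ≠ z)
    (h1 : P.eval w / P.eval w₁ ∈ Complex.slitPlane) (h2 : (w - z) / (w₁ - z) ∈ Complex.slitPlane) :
    HasDerivAt (logBranch P α z w₁) (P.derivative.eval w / P.eval w - α / (w - z)) w := by
  have hz' := sub_ne_zero.2 hz
  have hPw : P.eval w ≠ 0 := by
    intro h; rw [h, zero_div] at h1; exact Complex.slitPlane_ne_zero h1 rfl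
  have hwz : w - z ≠ 0 := by
    intro h; rw [h, zero_div] at h2; exact Complex.slitPlane_ne_zero h2 rfl
  have d1 := ((P.hasDerivAt w).div_const (P.eval w₁)).clog h1
  have d2 := ((((hasDerivAt_id w).sub_const z).div_const (w₁ - z)).clog h2).const_mul (α : ℂ)
  refine (d1.sub d2).congr_deriv ?_
  simp only [id]
  field_simp

theorem eventually_slitPlane {P : ℂ[X]} {z w₁ : ℂ} (hw₁ : P.eval w₁ ≠ 0) (hz : w₁ ≠ z) :
    ∀ᶠ w in 𝓝 w₁, P.eval w / P.eval w₁ ∈ Complex.slitPlane ∧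
      (w - z) / (w₁ - z) ∈ Complex.slitPlane := by
  have hz' := sub_ne_zero.2 hz
  have c1 : ContinuousAt (fun w => P.eval w / P.eval w₁) w₁ := (P.continuous.div_const _).continuousAt
  have c2 : ContinuousAt (fun w => (w - z) / (w₁ - z)) w₁ := by fun_prop
  refine (c1.eventually_mem (Complex.isOpen_slitPlane.mem_nhds ?_)).and
    (c2.eventually_mem (Complex.isOpen_slitPlane.mem_nhds ?_))
  · simp [hw₁]
  · simp [hz']

theorem logBranch_re {P : ℂ[X]} {α : ℝ} {z w₁ w : ℂ} :
    (logBranch P α z w₁ w).re =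
      Real.log ‖P.eval w / P.eval w₁‖ - α * Real.log ‖(w - z) / (w₁ - z)‖ := by
  simp [logBranch, Complex.log_re, Complex.mul_re]

theorem mem_superlevel_iff_logBranch {P : ℂ[X]} {α : ℝ} {z w₁ w : ℂ} (hw₁ : P.eval w₁ ≠ 0)
    (hz : w₁ ≠ z) (hw : P.eval w ≠ 0) (hwz : w ≠ z) :
    w ∈ superlevel P α z (‖P.eval w₁‖ / ‖w₁ - z‖ ^ α) ↔ 0 < (logBranch P α z w₁ w).re := by
  have a1 : 0 < ‖P.eval w₁‖ := norm_pos_iff.2 hw₁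
  have a2 : 0 < ‖P.eval w‖ := norm_pos_iff.2 hw
  have a3 : 0 < ‖w₁ - z‖ := norm_pos_iff.2 (sub_ne_zero.2 hz)
  have a4 : 0 < ‖w - z‖ := norm_pos_iff.2 (sub_ne_zero.2 hwz)
  have b3 : 0 < ‖w₁ - z‖ ^ α := Real.rpow_pos_of_pos a3 _
  have b4 : 0 < ‖w - z‖ ^ α := Real.rpow_pos_of_pos a4 _
  rw [logBranch_re, norm_div, norm_div, Real.log_div a2.ne' a1.ne', Real.log_div a4.ne' a3.ne',
    mul_sub, ← Real.log_rpow a4, ← Real.log_rpow a3, superlevel, Set.mem_ofPred_eq,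
    ← Real.log_lt_log_iff (by positivity) a2, Real.log_mul (by positivity) b4.ne',
    Real.log_div a1.ne' b3.ne']
  constructor <;> intro h <;> linarith

/-- The polynomial whose roots are the critical points of `‖P w‖ / ‖w - z‖ ^ α`. -/
noncomputable def criticalPoly (P : ℂ[X]) (α : ℝ) (z : ℂ) : ℂ[X] :=
  (X - C z) * derivative P - C (α : ℂ) * P

theorem eval_criticalPoly (P : ℂ[X]) (α : ℝ) (z w : ℂ) :
    (criticalPoly P α z).eval w = (w - z) * P.derivative.eval w - α * P.eval w := by
  simp [criticalPoly]

theorem criticalPoly_ne_zero {P : ℂ[X]} {α : ℝ} (hα : 0 < α)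
    (hαd : α < (P.natDegree : ℝ)) (z : ℂ) : criticalPoly P α z ≠ 0 := by
  have hd := natDegree_pos_of_lt hα hαd
  have hP : P ≠ 0 := by rintro rfl; simp at hd
  intro h
  have h1 := congrArg (fun q => q.coeff P.natDegree) h
  obtain ⟨e, he⟩ : ∃ e, P.natDegree = e + 1 := ⟨P.natDegree - 1, by omega⟩
  have h2 : (derivative P).coeff (e + 1) = 0 := by
    apply coeff_eq_zero_of_natDegree_lt
    have := natDegree_derivative_lt (p := P) (by omega)
    omega
  simp only [criticalPoly, coeff_sub, sub_mul, coeff_C_mul, coeff_zero, he, coeff_X_mul, h2] at h1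
  rw [coeff_derivative] at h1
  have h3 : P.coeff (e + 1) ≠ 0 := by rw [← he]; simpa using hP
  have h4 : ((e : ℂ) + 1 - α) * P.coeff (e + 1) = 0 := by linear_combination h1
  rcases mul_eq_zero.1 h4 with h5 | h5
  · rw [he] at hαd
    have : (e : ℝ) + 1 - α = 0 := by exact_mod_cast h5
    push_cast at hαd
    linarith
  · exact h3 h5

theorem deriv_logBranch_eq_zero_iff {P : ℂ[X]} {α : ℝ} {z w : ℂ} (hw : P.eval w ≠ 0) (hwz : w ≠ z) :
    P.derivative.eval w / P.eval w - α / (w - z) = 0 ↔ (criticalPoly P α z).eval w = 0 := by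
  have := sub_ne_zero.2 hwz
  rw [eval_criticalPoly, sub_eq_zero, sub_eq_zero, div_eq_div_iff hw this, mul_comm]

theorem analyticAt_logBranch {P : ℂ[X]} {α : ℝ} {z w₁ : ℂ} (hw₁ : P.eval w₁ ≠ 0) (hz : w₁ ≠ z) :
    AnalyticAt ℂ (logBranch P α z w₁) w₁ := by
  rw [Complex.analyticAt_iff_eventually_differentiableAt]
  filter_upwards [eventually_slitPlane hw₁ hz] with w hw
  exact (hasDerivAt_logBranch hw₁ hz hw.1 hw.2).differentiableAt

/-- A locally constant branch would make the critical polynomial vanish on an open set, but its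
coefficient in degree d is d - α times the leading coefficient of P. -/
theorem not_eventually_eq_logBranch {P : ℂ[X]} {α : ℝ} (hα : 0 < α)
    (hαd : α < (P.natDegree : ℝ)) {z w₁ : ℂ} (hw₁ : P.eval w₁ ≠ 0) (hz : w₁ ≠ z) :
    ¬ ∀ᶠ w in 𝓝 w₁, logBranch P α z w₁ w = logBranch P α z w₁ w₁ := by
  intro h
  have h1 : ∀ᶠ w in 𝓝 w₁, (criticalPoly P α z).eval w = 0 := by
    filter_upwards [eventually_slitPlane hw₁ hz, h.eventually_nhds] with w hw hw'
    have hd := hasDerivAt_logBranch (α := α) hw₁ hz hw.1 hw.2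
    have hd' : HasDerivAt (logBranch P α z w₁) 0 w :=
      (hasDerivAt_const w _).congr_of_eventuallyEq hw'
    have hPw : P.eval w ≠ 0 := by
      intro h; rw [h, zero_div] at hw; exact Complex.slitPlane_ne_zero hw.1 rfl
    have hwz : w ≠ z := by
      rintro rfl; rw [sub_self, zero_div] at hw; exact Complex.slitPlane_ne_zero hw.2 rfl
    exact (deriv_logBranch_eq_zero_iff hPw hwz).1 (hd.unique hd')
  have h2 : {w | (criticalPoly P α z).eval w = 0} ∈ 𝓝 w₁ := h1
  have h3 : {w | (criticalPoly P α z).eval w = 0}.Infinite := infinite_of_mem_nhds w₁ h2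
  exact criticalPoly_ne_zero hα hαd z (eq_zero_of_infinite_isRoot _ h3)

/-- Open mapping theorem for the logarithmic branch: there are no local maxima away from z and the
roots of P. -/
theorem frequently_mem_superlevel {P : ℂ[X]} {α : ℝ} (hα : 0 < α)
    (hαd : α < (P.natDegree : ℝ)) {z w₁ : ℂ} (hw₁ : P.eval w₁ ≠ 0) (hz : w₁ ≠ z) :
    ∃ᶠ w in 𝓝 w₁, w ∈ superlevel P α z (‖P.eval w₁‖ / ‖w₁ - z‖ ^ α) := by
  have hopen := ((analyticAt_logBranch (α := α) hw₁ hz).eventually_constant_or_nhds_le_map_nhds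
    ).resolve_left (not_eventually_eq_logBranch hα hαd hw₁ hz)
  rw [logBranch_self hw₁ hz] at hopen
  have hf : ∃ᶠ u in 𝓝 (0 : ℂ), 0 < u.re := by
    rw [Metric.nhds_basis_ball.frequently_iff]
    intro ε hε
    refine ⟨(ε / 2 : ℝ), ?_, by simpa using hε⟩
    simp [abs_of_pos hε, hε]
  have h1 : ∃ᶠ w in 𝓝 w₁, 0 < (logBranch P α z w₁ w).re :=
    frequently_map.1 (hf.filter_mono hopen)
  refine (h1.and_eventually (eventually_slitPlane hw₁ hz)).mono fun w hw => ?_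
  have hPw : P.eval w ≠ 0 := by
    intro h; rw [h, zero_div] at hw; exact Complex.slitPlane_ne_zero hw.2.1 rfl
  have hwz : w ≠ z := by
    rintro rfl; rw [sub_self, zero_div] at hw; exact Complex.slitPlane_ne_zero hw.2.2 rfl
  exact (mem_superlevel_iff_logBranch hw₁ hz hPw hwz).2 hw.1

/-- Components of an open planar set are open, hence also relatively closed in it. -/
theorem connectedComponentIn_mem_of_mem_closure {U : Set ℂ} (hU : IsOpen U) {x y : ℂ}
    (hy : y ∈ U) (h : y ∈ closure (connectedComponentIn U x)) : y ∈ connectedComponentIn U x := by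
  have hopen : IsOpen (connectedComponentIn U y) := hU.connectedComponentIn
  obtain ⟨a, ha, hax⟩ := mem_closure_iff.1 h _ hopen (mem_connectedComponentIn hy)
  rw [connectedComponentIn_eq hax, ← connectedComponentIn_eq ha]
  exact mem_connectedComponentIn hy

theorem ne_and_eval_ne_zero_of_eq_level {P : ℂ[X]} {α : ℝ} (hα : 0 < α) {z w : ℂ} {l : ℝ}
    (hz : P.eval z ≠ 0) (hl : 0 < l) (h : ‖P.eval w‖ = l * ‖w - z‖ ^ α) :
    w ≠ z ∧ P.eval w ≠ 0 ∧ l = ‖P.eval w‖ / ‖w - z‖ ^ α := by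
  have h1 : w ≠ z := by
    rintro rfl
    rw [sub_self, norm_zero, Real.zero_rpow hα.ne', mul_zero, norm_eq_zero] at h
    exact hz h
  have h2 : 0 < ‖w - z‖ ^ α := Real.rpow_pos_of_pos (norm_pos_iff.2 (sub_ne_zero.2 h1)) _
  refine ⟨h1, ?_, ?_⟩
  · rw [← norm_pos_iff, h]; positivity
  · rw [h, mul_div_cancel_right₀ _ h2.ne']

/-- Existence of the pass. If the closures of the basin and of the rest were disjoint, disjoint open
neighbourhoods would separate them, and by compactness they would still separate the superlevel set
at a slightly lower level. The basin there would remain bounded, contradicting minimality of the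
pass level. -/
theorem exists_mem_closure_basin_inter {P : ℂ[X]} {α : ℝ} (hα : 0 < α)
    (hαd : α < (P.natDegree : ℝ)) {z : ℂ} (hz : P.eval z ≠ 0) :
    ∃ w, w ∈ closure (basin P α z (passLevel P α z)) ∧
      w ∈ closure (superlevel P α z (passLevel P α z) \ basin P α z (passLevel P α z)) ∧
      ‖P.eval w‖ = passLevel P α z * ‖w - z‖ ^ α := by
  set l := passLevel P α z with hl
  set U := superlevel P α z l with hUdef
  set A := basin P α z l with hA
  have hl0 : 0 < l := passLevel_pos hα hαd hz
  have hUo : IsOpen U := isOpen_superlevel P hα z l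
  have hAo : IsOpen A := isOpen_basin P hα z l
  have hAU : A ⊆ U := basin_subset P α z l
  have hzA : z ∈ A := mem_basin_self hα hz l
  have hAb : Bornology.IsBounded A := isBounded_basin_passLevel hα hαd hz
  have hge : ∀ w : ℂ, w ∈ closure U → l * ‖w - z‖ ^ α ≤ ‖P.eval w‖ := by
    have hcl : IsClosed {w : ℂ | l * ‖w - z‖ ^ α ≤ ‖P.eval w‖} :=
      isClosed_le (continuous_const.mul (continuous_norm_sub_rpow hα z)) P.continuous.norm
    intro w hw
    exact closure_minimal (fun x (hx : l * ‖x - z‖ ^ α < ‖P.eval x‖) => hx.le) hcl hw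
  have hle : ∀ w : ℂ, l * ‖w - z‖ ^ α ≤ ‖P.eval w‖ → w ∈ closure U := by
    intro w hw
    rcases hw.lt_or_eq with h | h
    · exact subset_closure h
    · obtain ⟨h1, h2, h3⟩ := ne_and_eval_ne_zero_of_eq_level hα hz hl0 h.symm
      rw [mem_closure_iff_frequently, hUdef, h3]
      exact frequently_mem_superlevel hα hαd h2 h1
  by_cases hdisj : Disjoint (closure A) (closure (U \ A))
  · exfalso
    obtain ⟨W₀, W₁, hW₀, hW₁, hAW, hBW, hWW⟩ :=
      normal_separation isClosed_closure isClosed_closure hdisj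
    -- The non-strict superlevel set is the closure of the strict one, since there are no local
    -- maxima on the level set.
    have hcover : ∀ w : ℂ, l * ‖w - z‖ ^ α ≤ ‖P.eval w‖ → w ∈ W₀ ∪ W₁ := by
      intro w hw
      have h1 := hle w hw
      rw [← Set.union_sdiff_cancel hAU, closure_union] at h1
      exact h1.imp (fun h => hAW h) fun h => hBW h
    obtain ⟨R, hR, hfar⟩ := exists_mem_superlevel_of_norm_ge hα hαd ‖z‖ l
    set K := Metric.closedBall (0 : ℂ) R \ (W₀ ∪ W₁) with hK
    have hKc : IsCompact K := (isCompact_closedBall 0 R).diff (hW₀.union hW₁)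
    have hzK : ∀ w ∈ K, w ≠ z := by
      rintro w hw rfl
      exact hw.2 (Or.inl (hAW (subset_closure hzA)))
    obtain ⟨l', hl'0, hl'l, hl'⟩ : ∃ l', 0 < l' ∧ l' < l ∧
        ∀ w ∈ K, ‖P.eval w‖ ≤ l' * ‖w - z‖ ^ α := by
      rcases K.eq_empty_or_nonempty with hKe | hKne
      · exact ⟨l / 2, by linarith, by linarith, by simp [hKe]⟩
      · have hcont : ContinuousOn (fun w => ‖P.eval w‖ / ‖w - z‖ ^ α) K :=
          P.continuous.norm.continuousOn.div (continuous_norm_sub_rpow hα z).continuousOn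
            fun w hw => (Real.rpow_pos_of_pos (norm_pos_iff.2 (sub_ne_zero.2 (hzK w hw))) _).ne'
        obtain ⟨w₂, hw₂, hmax⟩ := hKc.exists_isMaxOn hKne hcont
        have hpos : ∀ w ∈ K, 0 < ‖w - z‖ ^ α := fun w hw =>
          Real.rpow_pos_of_pos (norm_pos_iff.2 (sub_ne_zero.2 (hzK w hw))) _
        have hlt : ‖P.eval w₂‖ / ‖w₂ - z‖ ^ α < l := by
          rw [div_lt_iff₀ (hpos w₂ hw₂)]
          by_contra hc
          exact hw₂.2 (hcover w₂ (not_lt.1 hc))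
        refine ⟨max (‖P.eval w₂‖ / ‖w₂ - z‖ ^ α) (l / 2), lt_max_of_lt_right (by linarith),
          max_lt hlt (by linarith), fun w hw => ?_⟩
        have h1 : ‖P.eval w‖ / ‖w - z‖ ^ α ≤ ‖P.eval w₂‖ / ‖w₂ - z‖ ^ α := hmax hw
        rw [div_le_iff₀ (hpos w hw)] at h1
        refine h1.trans ?_
        gcongr
        exact le_max_left _ _
    have hsup : superlevel P α z l' ⊆ W₀ ∪ W₁ := by
      intro w hw
      by_contra hc
      have hwR : w ∈ Metric.closedBall (0 : ℂ) R := by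
        by_contra hwR
        rw [mem_closedBall_zero_iff, not_le] at hwR
        exact hc (hcover w (le_of_lt (hfar z le_rfl l le_rfl w hwR.le)))
      have h1 := hl' w ⟨hwR, hc⟩
      have h2 : l' * ‖w - z‖ ^ α < ‖P.eval w‖ := hw
      linarith
    have hW : basin P α z l' ⊆ W₀ := by
      refine IsPreconnected.subset_left_of_subset_union hW₀ hW₁ hWW
        ((basin_subset P α z l').trans hsup) ⟨z, mem_basin_self hα hz l', hAW (subset_closure hzA)⟩
        isPreconnected_connectedComponentIn
    refine not_isBounded_basin_of_lt_passLevel hl'0 hl'l (Metric.isBounded_ball.subset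
      (t := Metric.ball 0 R) fun w hw => ?_)
    by_contra hwR
    rw [mem_ball_zero_iff, not_lt] at hwR
    have hwU : w ∈ U := hfar z le_rfl l le_rfl w hwR
    have hwA : w ∈ A := by
      by_contra hwA
      exact Set.disjoint_left.1 hWW (hW hw) (hBW (subset_closure ⟨hwU, hwA⟩))
    exact not_isBounded_connectedComponentIn_of_ray hR
      (fun w hw => hfar z le_rfl l le_rfl w hw) hwA hwR hAb
  · obtain ⟨w, hw0, hw1⟩ := Set.not_disjoint_iff.1 hdisj
    refine ⟨w, hw0, hw1, le_antisymm ?_ (hge w (closure_mono hAU hw0))⟩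
    by_contra hc
    have hwU : w ∈ U := not_le.1 hc
    have hwA : w ∈ A := connectedComponentIn_mem_of_mem_closure hUo hwU hw0
    obtain ⟨a, haA, -, ha⟩ := mem_closure_iff.1 hw1 A hAo hwA
    exact ha haA

theorem exists_local_inverse {ψ : ℂ → ℂ} {w₁ : ℂ} (hψ : AnalyticAt ℂ ψ w₁) (h0 : ψ w₁ = 0)
    (hd : deriv ψ w₁ ≠ 0) {V : Set ℂ} (hV : V ∈ 𝓝 w₁) :
    ∃ ρ > 0, ∃ g : ℂ → ℂ, ContinuousOn g (Metric.ball 0 ρ) ∧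
      (∀ u ∈ Metric.ball (0 : ℂ) ρ, ψ (g u) = u ∧ g u ∈ V) ∧ g '' Metric.ball 0 ρ ∈ 𝓝 w₁ := by
  have hs : HasStrictDerivAt ψ (deriv ψ w₁) w₁ := hψ.hasStrictDerivAt
  set e := (hs.hasStrictFDerivAt_equiv hd).toOpenPartialHomeomorph ψ with he
  have hcoe : ∀ x, e x = ψ x := fun x => rfl
  have hw₁ : w₁ ∈ e.source := (hs.hasStrictFDerivAt_equiv hd).mem_toOpenPartialHomeomorph_source
  have h0t : (0 : ℂ) ∈ e.target := by
    rw [← h0, ← hcoe]; exact e.map_source hw₁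
  have hsymm0 : e.symm 0 = w₁ := by
    rw [← h0, ← hcoe]; exact e.left_inv hw₁
  have hcont : ContinuousAt e.symm 0 := e.continuousAt_symm h0t
  have hmem : ∀ᶠ u in 𝓝 (0 : ℂ), u ∈ e.target := e.open_target.mem_nhds h0t
  have hev : ∀ᶠ u in 𝓝 (0 : ℂ), u ∈ e.target ∧ e.symm u ∈ V :=
    hmem.and (hcont.eventually_mem (by rw [hsymm0]; exact hV))
  obtain ⟨ρ, hρ, hball⟩ := Metric.eventually_nhds_iff_ball.1 hev
  refine ⟨ρ, hρ, e.symm, e.continuousOn_symm.mono fun u hu => (hball u hu).1, fun u hu => ?_, ?_⟩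
  · exact ⟨by rw [← hcoe]; exact e.right_inv (hball u hu).1, (hball u hu).2⟩
  · have : e.source ∩ e ⁻¹' Metric.ball 0 ρ ∈ 𝓝 w₁ := by
      refine (e.isOpen_inter_preimage Metric.isOpen_ball).mem_nhds ⟨hw₁, ?_⟩
      rw [Set.mem_preimage, hcoe, h0]
      exact Metric.mem_ball_self hρ
    refine Filter.mem_of_superset this ?_
    rintro w ⟨hw, hw'⟩
    exact ⟨e w, hw', e.left_inv hw⟩

theorem mem_nhds_good {P : ℂ[X]} {z w₁ : ℂ} (hw₁ : P.eval w₁ ≠ 0) (hz : w₁ ≠ z) :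
    {w | P.eval w ≠ 0 ∧ w ≠ z} ∈ 𝓝 w₁ :=
  (P.continuous.continuousAt.eventually_ne hw₁).and (eventually_ne_nhds hz)

/-- At a noncritical point the logarithmic branch is a local coordinate, in which the superlevel set
is a half disc. Thus two different components cannot meet there, and the pass is critical. -/
theorem exists_isPreconnected_inter_superlevel {P : ℂ[X]} {α : ℝ} {z w₁ : ℂ}
    (hw₁ : P.eval w₁ ≠ 0) (hz : w₁ ≠ z) (hcrit : (criticalPoly P α z).eval w₁ ≠ 0) :
    ∃ N ∈ 𝓝 w₁, IsPreconnected (N ∩ superlevel P α z (‖P.eval w₁‖ / ‖w₁ - z‖ ^ α)) := by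
  have hd := hasDerivAt_logBranch (α := α) hw₁ hz (eventually_slitPlane hw₁ hz).self_of_nhds.1
    (eventually_slitPlane hw₁ hz).self_of_nhds.2
  obtain ⟨ρ, hρ, g, hg, hgψ, hN⟩ := exists_local_inverse (analyticAt_logBranch (α := α) hw₁ hz)
    (logBranch_self hw₁ hz) (by
      rw [hd.deriv, Ne, deriv_logBranch_eq_zero_iff hw₁ hz]; exact hcrit) (mem_nhds_good hw₁ hz)
  refine ⟨_, hN, ?_⟩
  have : g '' Metric.ball 0 ρ ∩ superlevel P α z (‖P.eval w₁‖ / ‖w₁ - z‖ ^ α) =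
      g '' (Metric.ball 0 ρ ∩ {u | 0 < u.re}) := by
    ext w
    constructor
    · rintro ⟨⟨u, hu, rfl⟩, hw⟩
      obtain ⟨h1, h2⟩ := hgψ u hu
      rw [mem_superlevel_iff_logBranch hw₁ hz h2.1 h2.2, h1] at hw
      exact ⟨u, ⟨hu, hw⟩, rfl⟩
    · rintro ⟨u, ⟨hu, hure⟩, rfl⟩
      obtain ⟨h1, h2⟩ := hgψ u hu
      refine ⟨⟨u, hu, rfl⟩, ?_⟩
      rw [mem_superlevel_iff_logBranch hw₁ hz h2.1 h2.2, h1]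
      exact hure
  rw [this]
  refine IsPreconnected.image ?_ _ (hg.mono Set.inter_subset_left)
  exact ((convex_ball 0 ρ).inter (convex_halfSpace_re_gt 0)).isPreconnected

theorem subset_or_disjoint_connectedComponentIn {U S : Set ℂ} (x : ℂ) (hS : IsPreconnected S)
    (hSU : S ⊆ U) :
    S ⊆ connectedComponentIn U x ∨ Disjoint S (connectedComponentIn U x) := by
  by_cases h : Disjoint S (connectedComponentIn U x)
  · exact Or.inr h
  · obtain ⟨a, haS, hax⟩ := Set.not_disjoint_iff.1 h
    left
    rw [connectedComponentIn_eq hax]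
    exact hS.subset_connectedComponentIn haS hSU

theorem criticalPoly_eval_eq_zero_of_mem_closure {P : ℂ[X]} {α : ℝ} (hα : 0 < α) {z w : ℂ} {l : ℝ}
    (hz : P.eval z ≠ 0) (hl : 0 < l) (h1 : w ∈ closure (basin P α z l))
    (h2 : w ∈ closure (superlevel P α z l \ basin P α z l))
    (h3 : ‖P.eval w‖ = l * ‖w - z‖ ^ α) : (criticalPoly P α z).eval w = 0 := by
  obtain ⟨hwz, hPw, hlw⟩ := ne_and_eval_ne_zero_of_eq_level hα hz hl h3
  by_contra hcrit
  obtain ⟨N, hN, hpre⟩ := exists_isPreconnected_inter_superlevel hPw hwz hcrit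
  rw [← hlw] at hpre
  obtain ⟨a, haN, haA⟩ := mem_closure_iff_nhds.1 h1 N hN
  obtain ⟨b, hbN, hbU, hbA⟩ := mem_closure_iff_nhds.1 h2 N hN
  rcases subset_or_disjoint_connectedComponentIn z hpre Set.inter_subset_right with h | h
  · exact hbA (h ⟨hbN, hbU⟩)
  · exact Set.disjoint_left.1 h ⟨haN, basin_subset P α z l haA⟩ haA

/-- Maximum principle: on the closure of a bounded component avoiding z, the quotient |P(w)|/|w -
z|^α would attain a maximum inside the component. -/
theorem not_isBounded_component {P : ℂ[X]} {α : ℝ} (hα : 0 < α)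
    (hαd : α < (P.natDegree : ℝ)) {z w : ℂ} {l : ℝ} (hz : P.eval z ≠ 0) (hl : 0 < l)
    (hw : w ∈ superlevel P α z l) (hwA : w ∉ basin P α z l) :
    ¬ Bornology.IsBounded (connectedComponentIn (superlevel P α z l) w) := by
  intro hb
  set U := superlevel P α z l with hU
  have hUo : IsOpen U := isOpen_superlevel P hα z l
  set Q := connectedComponentIn U w with hQ
  have hQo : IsOpen Q := hUo.connectedComponentIn
  have hwQ : w ∈ Q := mem_connectedComponentIn hw
  have hzQ : z ∉ closure Q := by
    intro h
    have h1 : z ∈ Q := connectedComponentIn_mem_of_mem_closure hUo (mem_superlevel_self hα hz l) h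
    apply hwA
    rw [basin, ← connectedComponentIn_eq h1]
    exact hwQ
  have hpos : ∀ x ∈ closure Q, 0 < ‖x - z‖ ^ α := by
    intro x hx
    have : x ≠ z := by rintro rfl; exact hzQ hx
    exact Real.rpow_pos_of_pos (norm_pos_iff.2 (sub_ne_zero.2 this)) _
  obtain ⟨w₂, hw₂, hmax⟩ := hb.isCompact_closure.exists_isMaxOn ⟨w, subset_closure hwQ⟩
    (f := fun x => ‖P.eval x‖ / ‖x - z‖ ^ α) (P.continuous.norm.continuousOn.div
      (continuous_norm_sub_rpow hα z).continuousOn fun x hx => (hpos x hx).ne')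
  have h1 : ‖P.eval w‖ / ‖w - z‖ ^ α ≤ ‖P.eval w₂‖ / ‖w₂ - z‖ ^ α := hmax (subset_closure hwQ)
  have h2 : l < ‖P.eval w‖ / ‖w - z‖ ^ α := by
    rw [lt_div_iff₀ (hpos w (subset_closure hwQ))]; exact hw
  have hw₂U : w₂ ∈ U := by
    show l * ‖w₂ - z‖ ^ α < ‖P.eval w₂‖
    rw [← lt_div_iff₀ (hpos w₂ hw₂)]; linarith
  have hw₂Q : w₂ ∈ Q := connectedComponentIn_mem_of_mem_closure hUo hw₂U hw₂
  have hw₂z : w₂ ≠ z := by rintro rfl; exact hzQ hw₂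
  have hPw₂ : P.eval w₂ ≠ 0 := by
    intro h0
    rw [h0, norm_zero, zero_div] at h1
    linarith
  obtain ⟨x, hx, hxQ⟩ := ((frequently_mem_superlevel hα hαd hPw₂ hw₂z).and_eventually
    (hQo.mem_nhds hw₂Q)).exists
  have h3 : ‖P.eval x‖ / ‖x - z‖ ^ α ≤ ‖P.eval w₂‖ / ‖w₂ - z‖ ^ α := hmax (subset_closure hxQ)
  have h4 : ‖P.eval w₂‖ / ‖w₂ - z‖ ^ α * ‖x - z‖ ^ α < ‖P.eval x‖ := hx
  rw [div_le_iff₀ (hpos x (subset_closure hxQ))] at h3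
  linarith

theorem exists_analyticAt_mul_sq {L : ℂ → ℂ} {w₁ q : ℂ} (hL : AnalyticAt ℂ L w₁) (h0 : L w₁ = 0)
    (hq : Tendsto (fun w => L w / (w - w₁) ^ 2) (𝓝[≠] w₁) (𝓝 q)) :
    ∃ g : ℂ → ℂ, AnalyticAt ℂ g w₁ ∧ g w₁ = q ∧ ∀ w, L w = (w - w₁) ^ 2 * g w := by
  classical
  refine ⟨Function.update (fun w => L w / (w - w₁) ^ 2) w₁ q, ?_, by simp, fun w => ?_⟩
  · refine Complex.analyticAt_of_differentiable_on_punctured_nhds_of_continuousAt ?_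
      (continuousAt_update_same.2 hq)
    have h1 := (Complex.analyticAt_iff_eventually_differentiableAt.1 hL).filter_mono
      (nhdsWithin_le_nhds (s := {w₁}ᶜ))
    filter_upwards [h1, self_mem_nhdsWithin] with w hw hne
    have h2 : DifferentiableAt ℂ (fun w => L w / (w - w₁) ^ 2) w :=
      hw.div (by fun_prop) (pow_ne_zero _ (sub_ne_zero.2 hne))
    refine h2.congr_of_eventuallyEq ?_
    filter_upwards [eventually_ne_nhds hne] with x hx
    simp [Function.update_of_ne hx]
  · by_cases h : w = w₁
    · subst h; simp [h0]
    · rw [Function.update_of_ne h, mul_div_cancel₀ _ (pow_ne_zero _ (sub_ne_zero.2 h))]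

/-- Morse lemma in one complex variable. The removable singularity of L/(w - w₁)^2 is nonzero, hence
has an analytic square root; the direction e makes its value at w₁ positive. -/
theorem exists_analyticAt_sq_eq {L : ℂ → ℂ} {w₁ q e : ℂ} {κ : ℝ} (hL : AnalyticAt ℂ L w₁)
    (h0 : L w₁ = 0) (hq : Tendsto (fun w => L w / (w - w₁) ^ 2) (𝓝[≠] w₁) (𝓝 q))
    (hκ : 0 < κ) (he : q * e ^ 2 = κ) :
    ∃ φ : ℂ → ℂ, AnalyticAt ℂ φ w₁ ∧ (∃ c : ℝ, 0 < c ∧ φ w₁ = c) ∧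
      ∀ᶠ w in 𝓝 w₁, L w = ((w - w₁) / e * φ w) ^ 2 := by
  obtain ⟨g, hg, hgq, hLg⟩ := exists_analyticAt_mul_sq hL h0 hq
  have he0 : e ≠ 0 := by
    rintro rfl
    simp only [ne_eq, OfNat.ofNat_ne_zero, not_false_eq_true, zero_pow, mul_zero] at he
    exact hκ.ne (by exact_mod_cast he)
  have hslit : e ^ 2 * g w₁ ∈ Complex.slitPlane := by
    rw [hgq, mul_comm, he]; exact Complex.ofReal_mem_slitPlane.2 hκ
  have han : AnalyticAt ℂ (fun w => e ^ 2 * g w) w₁ := analyticAt_const.mul hg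
  refine ⟨fun w => Complex.exp (Complex.log (e ^ 2 * g w) / 2), ?_, ?_, ?_⟩
  · exact ((han.clog hslit).div_const).cexp
  · refine ⟨Real.exp (Real.log κ / 2), Real.exp_pos _, ?_⟩
    show Complex.exp (Complex.log (e ^ 2 * g w₁) / 2) = _
    rw [hgq, mul_comm, he, ← Complex.ofReal_log hκ.le]
    push_cast; rfl
  · filter_upwards [han.continuousAt.eventually_ne (Complex.slitPlane_ne_zero hslit)] with w hw
    rw [mul_pow, ← Complex.exp_nat_mul, show ((2 : ℕ) : ℂ) * (Complex.log (e ^ 2 * g w) / 2) =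
      Complex.log (e ^ 2 * g w) by push_cast; ring, Complex.exp_log hw, hLg]
    field_simp

theorem convex_sector (s : ℝ) : Convex ℝ {u : ℂ | |u.im| < s * u.re} := by
  have : {u : ℂ | |u.im| < s * u.re} = {u : ℂ | u.im < s * u.re} ∩ {u : ℂ | - u.im < s * u.re} := by
    ext u
    simp only [Set.mem_ofPred_eq, Set.mem_inter_iff, abs_lt]
    constructor <;> rintro ⟨h1, h2⟩ <;> constructor <;> linarith
  rw [this]
  have key : ∀ a : ℝ, Convex ℝ {u : ℂ | a * u.im < s * u.re} := by
    intro a x hx y hy p q hp hq hpq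
    simp only [Set.mem_ofPred_eq, Complex.add_im, Complex.add_re, Complex.real_smul, Complex.mul_im,
      Complex.mul_re, Complex.ofReal_re, Complex.ofReal_im, zero_mul, add_zero, sub_zero] at *
    rcases hp.eq_or_lt with rfl | hp
    · obtain rfl : q = 1 := by linarith
      linarith
    · have h1 := mul_lt_mul_of_pos_left hx hp
      have h2 := mul_le_mul_of_nonneg_left hy.le hq
      linarith
  have h1 := key 1
  have h2 := key (-1)
  simp only [one_mul, neg_mul] at h1 h2
  exact h1.inter h2

theorem sq_re_pos_iff (u : ℂ) : 0 < (u ^ 2).re ↔ |u.im| < 1 * u.re ∨ |u.im| < -1 * u.re := by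
  rw [sq, Complex.mul_re, sub_pos, ← sq, ← sq, sq_lt_sq, one_mul, neg_one_mul, lt_abs]

/-- In the Morse coordinate u the superlevel set is Re u^2 > 0, two opposite connected sectors. Each
lies in the basin or avoids it; as the pass is in the closure of both the basin and the rest,
exactly one lies in it. The rays along e and -e enter these sectors, and s records which one is in
the basin. -/
theorem exists_saddle_sides {P : ℂ[X]} {α : ℝ} (hα : 0 < α) {z w₁ q e : ℂ} {l κ : ℝ}
    (hz : P.eval z ≠ 0) (hl : 0 < l) (h1 : w₁ ∈ closure (basin P α z l))
    (h2 : w₁ ∈ closure (superlevel P α z l \ basin P α z l))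
    (h3 : ‖P.eval w₁‖ = l * ‖w₁ - z‖ ^ α)
    (hq : Tendsto (fun w => logBranch P α z w₁ w / (w - w₁) ^ 2) (𝓝[≠] w₁) (𝓝 q))
    (hκ : 0 < κ) (he : q * e ^ 2 = κ) :
    ∃ s : ℝ, (s = 1 ∨ s = -1) ∧ ∀ᶠ t : ℝ in 𝓝[>] 0, w₁ + (s * t : ℝ) * e ∈ basin P α z l ∧
      w₁ - (s * t : ℝ) * e ∈ superlevel P α z l \ basin P α z l := by
  obtain ⟨hwz, hPw, hlw⟩ := ne_and_eval_ne_zero_of_eq_level hα hz hl h3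
  obtain ⟨φ, hφ, ⟨c, hc, hφc⟩, hLφ⟩ := exists_analyticAt_sq_eq
    (analyticAt_logBranch (α := α) hPw hwz) (logBranch_self hPw hwz) hq hκ he
  have he0 : e ≠ 0 := by
    rintro rfl
    simp only [ne_eq, OfNat.ofNat_ne_zero, not_false_eq_true, zero_pow, mul_zero] at he
    exact hκ.ne (by exact_mod_cast he)
  set ψ : ℂ → ℂ := fun w => (w - w₁) / e * φ w with hψ
  have hψan : AnalyticAt ℂ ψ w₁ :=
    ((analyticAt_id.sub analyticAt_const).div_const).mul hφ
  have hψ0 : ψ w₁ = 0 := by simp [hψ]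
  have hψd : deriv ψ w₁ ≠ 0 := by
    have d := (((hasDerivAt_id w₁).sub_const w₁).div_const e).mul hφ.differentiableAt.hasDerivAt
    have d' : HasDerivAt ψ (1 / e * φ w₁) w₁ := by
      refine d.congr_deriv ?_
      simp
    rw [d'.deriv, hφc]
    exact mul_ne_zero (one_div_ne_zero he0) (by exact_mod_cast hc.ne')
  obtain ⟨ρ, hρ, g, hg, hgψ, hN⟩ := exists_local_inverse hψan hψ0 hψd
    (inter_mem (mem_nhds_good hPw hwz) hLφ)
  set U := superlevel P α z l with hU
  have hmem : ∀ u ∈ Metric.ball (0 : ℂ) ρ, g u ∈ U ↔ 0 < (u ^ 2).re := by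
    intro u hu
    obtain ⟨a1, ⟨a2, a3⟩, a4⟩ := hgψ u hu
    rw [hU, hlw, mem_superlevel_iff_logBranch hPw hwz a2 a3, a4]
    simp only [hψ] at a1
    rw [a1]
  set S : ℝ → Set ℂ := fun s => Metric.ball 0 ρ ∩ {u : ℂ | |u.im| < s * u.re} with hS
  have hpre : ∀ s, IsPreconnected (g '' S s) := fun s =>
    IsPreconnected.image ((convex_ball 0 ρ).inter (convex_sector s)).isPreconnected _
      (hg.mono Set.inter_subset_left)
  have hSU : ∀ s : ℝ, s = 1 ∨ s = -1 → g '' S s ⊆ U := by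
    rintro s hs _ ⟨u, ⟨hu, hu'⟩, rfl⟩
    rw [hmem u hu, sq_re_pos_iff]
    rcases hs with rfl | rfl
    · exact Or.inl hu'
    · exact Or.inr hu'
  have hUS : ∀ w ∈ g '' Metric.ball 0 ρ, w ∈ U → w ∈ g '' S 1 ∨ w ∈ g '' S (-1) := by
    rintro _ ⟨u, hu, rfl⟩ hw
    rw [hmem u hu, sq_re_pos_iff] at hw
    exact hw.imp (fun h => ⟨u, ⟨hu, h⟩, rfl⟩) fun h => ⟨u, ⟨hu, h⟩, rfl⟩
  have hray : ∀ s : ℝ, s = 1 ∨ s = -1 →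
      ∀ᶠ t : ℝ in 𝓝[>] 0, w₁ + (s * t : ℝ) * e ∈ g '' S s := by
    intro s hs
    have hcont : Tendsto (fun t : ℝ => w₁ + (s * t : ℝ) * e) (𝓝[>] 0) (𝓝 w₁) := by
      have : Continuous fun t : ℝ => w₁ + (s * t : ℝ) * e := by fun_prop
      have := (this.tendsto 0).mono_left (nhdsWithin_le_nhds (s := Set.Ioi 0))
      simpa using this
    have hopen : IsOpen {v : ℂ | |v.im| < v.re} :=
      isOpen_lt (Complex.continuous_im.abs) Complex.continuous_re
    have hφev : ∀ᶠ w in 𝓝 w₁, φ w ∈ {v : ℂ | |v.im| < v.re} := by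
      refine hφ.continuousAt.eventually_mem (hopen.mem_nhds ?_)
      rw [hφc]; simpa using hc
    filter_upwards [hcont.eventually hφev, hcont.eventually hN, self_mem_nhdsWithin]
      with t ht1 ht2 ht
    obtain ⟨u, hu, hgu⟩ := ht2
    refine ⟨u, ⟨hu, ?_⟩, hgu⟩
    have h4 := (hgψ u hu).1
    rw [hgu] at h4
    have h5 : u = ((s * t : ℝ) : ℂ) * φ (w₁ + (s * t : ℝ) * e) := by
      rw [← h4]; simp only [hψ]; field_simp; ring
    set v := φ (w₁ + (s * t : ℝ) * e)
    have h6 : |v.im| < v.re := ht1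
    show |u.im| < s * u.re
    rw [h5, Complex.re_ofReal_mul, Complex.im_ofReal_mul, abs_mul, abs_mul,
      abs_of_pos (Set.mem_Ioi.1 ht)]
    rcases hs with rfl | rfl
    · simpa using (mul_lt_mul_of_pos_left h6 ht)
    · have := mul_lt_mul_of_pos_left h6 ht
      simp only [abs_neg, abs_one]
      linarith
  obtain ⟨a, haN, haA⟩ := mem_closure_iff_nhds.1 h1 _ hN
  obtain ⟨b, hbN, hbU, hbA⟩ := mem_closure_iff_nhds.1 h2 _ hN
  have hdich := fun s hs => subset_or_disjoint_connectedComponentIn z (hpre s) (hSU s hs)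
  have hfin : ∀ s : ℝ, s = 1 ∨ s = -1 → g '' S s ⊆ basin P α z l →
      Disjoint (g '' S (-s)) (basin P α z l) →
      ∀ᶠ t : ℝ in 𝓝[>] 0, w₁ + (s * t : ℝ) * e ∈ basin P α z l ∧
      w₁ - (s * t : ℝ) * e ∈ U \ basin P α z l := by
    intro s hs hA hB
    have hs' : -s = 1 ∨ -s = -1 := by
      rcases hs with rfl | rfl
      · exact Or.inr rfl
      · exact Or.inl (neg_neg 1)
    filter_upwards [hray s hs, hray (-s) hs'] with t ht ht'
    have h7 : w₁ - (s * t : ℝ) * e = w₁ + (-s * t : ℝ) * e := by push_cast; ring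
    rw [h7]
    exact ⟨hA ht, hSU _ hs' ht', fun h => Set.disjoint_left.1 hB ht' h⟩
  rcases hdich 1 (Or.inl rfl) with hp | hp <;> rcases hdich (-1) (Or.inr rfl) with hm | hm
  · exact absurd ((hUS b hbN hbU).elim (fun h => hp h) fun h => hm h) hbA
  · exact ⟨1, Or.inl rfl, hfin 1 (Or.inl rfl) hp hm⟩
  · exact ⟨-1, Or.inr rfl, hfin (-1) (Or.inr rfl) hm (by rw [neg_neg]; exact hp)⟩
  · exfalso
    rcases hUS a haN (basin_subset P α z l haA) with h | h
    · exact Set.disjoint_left.1 hp h haA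
    · exact Set.disjoint_left.1 hm h haA

/-! ### Exponential upper bound for Taylor coefficients -/

/-- If |P(e)| were larger, the whole η-ball about e would lie in the superlevel set; being connected
and containing the basin point b, it would lie in the basin. With η of order 1/n the exponential
factor stays bounded after taking n-th powers. -/
theorem norm_eval_le_of_notMem_basin {P : ℂ[X]} {α : ℝ} (hα : 0 < α) {z e b : ℂ}
    {l l₀ ρ η M : ℝ} (hl₀ : 0 < l₀) (hl : l₀ ≤ l) (hρ : 0 < ρ) (hη : 0 ≤ η) (hM : 0 ≤ M)
    (hez : ρ ≤ ‖e - z‖) (hb : b ∈ basin P α z l) (he : e ∉ basin P α z l) (hbe : dist b e ≤ η)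
    (hLip : ∀ x ∈ Metric.closedBall e η, ‖P.eval x - P.eval e‖ ≤ M * η) :
    ‖P.eval e‖ ≤ l * ‖e - z‖ ^ α * Real.exp ((α / ρ + M / (l₀ * ρ ^ α)) * η) := by
  by_contra hc
  rw [not_le] at hc
  apply he
  have hρα : 0 < ρ ^ α := Real.rpow_pos_of_pos hρ _
  have hsub : Metric.closedBall e η ⊆ superlevel P α z l := by
    intro x hx
    show l * ‖x - z‖ ^ α < ‖P.eval x‖
    have h1 : ‖P.eval e‖ - M * η ≤ ‖P.eval x‖ := by
      have h2 : ‖P.eval e‖ - ‖P.eval x‖ ≤ ‖P.eval x - P.eval e‖ := by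
        rw [norm_sub_rev]; exact norm_sub_norm_le _ _
      have := hLip x hx
      linarith
    have h3 : ‖x - z‖ ≤ ‖e - z‖ * Real.exp (η / ρ) := by
      have h4 : ‖x - z‖ ≤ ‖e - z‖ + η := by
        have h5 : ‖x - e‖ ≤ η := by rw [← dist_eq_norm]; exact hx
        have h6 : ‖x - z‖ ≤ ‖x - e‖ + ‖e - z‖ := norm_sub_le_norm_sub_add_norm_sub x e z
        linarith
      have h7 : η ≤ ‖e - z‖ * (η / ρ) := by
        rw [mul_div_assoc', le_div_iff₀ hρ, mul_comm]; gcongr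
      have h8 := Real.add_one_le_exp (η / ρ)
      have h9 : ‖e - z‖ * (η / ρ + 1) ≤ ‖e - z‖ * Real.exp (η / ρ) := by gcongr
      linarith
    have h10 : ‖x - z‖ ^ α ≤ ‖e - z‖ ^ α * Real.exp (α / ρ * η) := by
      calc ‖x - z‖ ^ α ≤ (‖e - z‖ * Real.exp (η / ρ)) ^ α := by gcongr
        _ = ‖e - z‖ ^ α * Real.exp (α / ρ * η) := by
          rw [Real.mul_rpow (norm_nonneg _) (Real.exp_pos _).le, ← Real.exp_mul]
          congr 2; ring
    have hl0 : 0 ≤ l := hl₀.le.trans hl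
    have h11 : l₀ * ρ ^ α ≤ l * ‖e - z‖ ^ α := by gcongr
    have h12 : Real.exp (α / ρ * η) + M / (l₀ * ρ ^ α) * η ≤
        Real.exp ((α / ρ + M / (l₀ * ρ ^ α)) * η) := by
      rw [add_mul, Real.exp_add]
      have h13 := Real.add_one_le_exp (M / (l₀ * ρ ^ α) * η)
      have h14 : 1 ≤ Real.exp (α / ρ * η) := Real.one_le_exp (by positivity)
      have h15 : 0 ≤ M / (l₀ * ρ ^ α) * η := by positivity
      nlinarith
    have h16 : M * η ≤ l * ‖e - z‖ ^ α * (M / (l₀ * ρ ^ α) * η) := by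
      calc M * η = l₀ * ρ ^ α * (M / (l₀ * ρ ^ α) * η) := by field_simp
        _ ≤ _ := by gcongr
    have h17 : l * ‖e - z‖ ^ α * (Real.exp (α / ρ * η) + M / (l₀ * ρ ^ α) * η) ≤
      l * ‖e - z‖ ^ α * Real.exp ((α / ρ + M / (l₀ * ρ ^ α)) * η) := by gcongr
    have h18 : l * ‖x - z‖ ^ α ≤ l * (‖e - z‖ ^ α * Real.exp (α / ρ * η)) := by gcongr
    linarith
  rcases subset_or_disjoint_connectedComponentIn z
    (convex_closedBall e η).isPreconnected hsub with h | h
  · exact h (Metric.mem_closedBall_self hη)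
  · exact absurd hb (Set.disjoint_left.1 h hbe)

/-- Replaces the real exponent αn by the integer k + 1: the difference lies in [-1, D], and T^D or
1/ρ covers t ≥ 1 or t ≤ 1. -/
theorem rpow_le_mul_pow {t ρ T s D : ℝ} {k : ℕ} (hρ : 0 < ρ) (hT : 1 ≤ T)
    (hD : 0 ≤ D) (ht : ρ ≤ t) (htT : t ≤ T) (h1 : s ≤ k + 1 + D) (h2 : (k : ℝ) ≤ s) :
    t ^ s ≤ (T ^ D + ρ⁻¹) * t ^ (k + 1) := by
  have ht0 : 0 < t := hρ.trans_le ht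
  have h3 : t ^ s = t ^ (s - (k + 1)) * t ^ (k + 1) := by
    rw [← Real.rpow_natCast t (k + 1), ← Real.rpow_add ht0]
    congr 1; push_cast; ring
  rw [h3]
  gcongr
  have hTD : 0 ≤ T ^ D := by positivity
  rcases le_total 1 t with h | h
  · calc t ^ (s - (k + 1)) ≤ t ^ D := Real.rpow_le_rpow_of_exponent_le h (by linarith)
      _ ≤ T ^ D := by gcongr
      _ ≤ _ := le_add_of_nonneg_right (by positivity)
  · calc t ^ (s - (k + 1)) ≤ t ^ (-1 : ℝ) :=
        Real.rpow_le_rpow_of_exponent_ge ht0 h (by linarith)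
      _ = t⁻¹ := Real.rpow_neg_one t
      _ ≤ ρ⁻¹ := by gcongr
      _ ≤ _ := le_add_of_nonneg_left hTD

theorem exists_lipschitz_eval (P : ℂ[X]) (R : ℝ) :
    ∃ M ≥ 0, ∀ x ∈ Metric.closedBall (0 : ℂ) R, ∀ y ∈ Metric.closedBall (0 : ℂ) R,
      ‖P.eval x - P.eval y‖ ≤ M * ‖x - y‖ := by
  obtain ⟨M, hM⟩ := (isCompact_closedBall (0 : ℂ) R).exists_bound_of_continuousOn
    P.derivative.continuous.continuousOn
  refine ⟨max M 0, le_max_right _ _, fun x hx y hy => ?_⟩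
  exact (convex_closedBall (0 : ℂ) R).norm_image_sub_le_of_norm_hasDerivWithin_le
    (f := fun w => P.eval w) (fun w _ => (P.hasDerivAt w).hasDerivWithinAt)
    (fun w hw => (hM w hw).trans (le_max_left _ _)) hy hx

theorem dist_le_of_mem_gridSquare {h : ℝ} {s : ℤ × ℤ} {t t' : ℂ} (ht : t ∈ gridSquare h s)
    (ht' : t' ∈ gridSquare h s) : dist t t' ≤ 4 * h := by
  obtain ⟨a, b⟩ := ht
  obtain ⟨a', b'⟩ := ht'
  rw [dist_eq_norm]
  refine (Complex.norm_le_abs_re_add_abs_im _).trans ?_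
  rw [abs_le] at a b a' b'
  have h1 : |(t - t').re| ≤ 2 * h := by
    rw [Complex.sub_re, abs_le]; constructor <;> linarith
  have h2 : |(t - t').im| ≤ 2 * h := by
    rw [Complex.sub_im, abs_le]; constructor <;> linarith
  linarith

theorem index_mem_Icc {n N : ℕ} (hn : 0 < n) {s : ℤ × ℤ} {t : ℂ} {T : ℝ}
    (ht : t ∈ gridSquare (1 / n) s) (htT : ‖t‖ ≤ T) (hN : T + 1 ≤ N) :
    s ∈ Finset.Icc (-((N * n : ℕ) : ℤ)) (N * n : ℕ) ×ˢ Finset.Icc (-((N * n : ℕ) : ℤ)) (N * n : ℕ) := by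
  have hn' : (1 : ℝ) ≤ n := by exact_mod_cast hn
  have hT : 0 ≤ T := (norm_nonneg t).trans htT
  have key : ∀ (x : ℝ) (i : ℤ), |x| ≤ T → |x - 2 * (1 / n) * i| ≤ 1 / n →
      -((N * n : ℕ) : ℤ) ≤ i ∧ i ≤ (N * n : ℕ) := by
    intro x i hx hi
    have h1 : |(i : ℝ)| ≤ N * n := by
      have h2 : (2 * (1 / n) : ℝ) * |(i : ℝ)| ≤ T + 1 / n := by
        have h3 : |2 * (1 / n : ℝ) * i| ≤ |x| + |x - 2 * (1 / n) * i| := by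
          have := abs_sub x (x - 2 * (1 / n : ℝ) * i)
          rwa [sub_sub_cancel] at this
        rw [abs_mul, abs_of_pos (show (0 : ℝ) < 2 * (1 / n) by positivity)] at h3
        linarith
      have h4 : 2 * |(i : ℝ)| ≤ T * n + 1 := by
        have := mul_le_mul_of_nonneg_right h2 (show (0 : ℝ) ≤ n by positivity)
        field_simp at this
        linarith
      nlinarith [abs_nonneg (i : ℝ)]
    rw [abs_le] at h1
    constructor
    · exact_mod_cast h1.1
    · exact_mod_cast h1.2
  rw [Finset.mem_product, Finset.mem_Icc, Finset.mem_Icc]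
  exact ⟨key _ _ ((Complex.abs_re_le_norm t).trans htT) ht.1,
    key _ _ ((Complex.abs_im_le_norm t).trans htT) ht.2⟩

/-- The contour is the boundary of the union of the grid squares of side 2/n meeting the translated
basin. Its points are outside the basin but within 4/n of it, so |P|^n is at most a constant times
l(z)^n |w - z|^(αn) there. The range D lets k run over several indices below αn. -/
theorem exists_norm_coeff_taylor_le {P : ℂ[X]} {α : ℝ} (hα : 0 < α)
    (hαd : α < (P.natDegree : ℝ)) {z₀ : ℂ} (hz₀ : P.eval z₀ ≠ 0) {D : ℝ} (hD : 0 ≤ D) :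
    ∃ δ > 0, ∃ C > 0, ∀ z ∈ Metric.closedBall z₀ δ, ∀ n : ℕ, 0 < n → ∀ k : ℕ,
      α * n ≤ k + 1 + D → (k : ℝ) ≤ α * n →
      ‖(taylor z (P ^ n)).coeff k‖ ≤ C * n ^ 2 * passLevel P α z ^ n := by
  classical
  obtain ⟨r, hr, L, hL, hpass, hsub, -⟩ := exists_passLevel_le_mul hα hαd hz₀
  have hl₀ : 0 < passLevel P α z₀ / 2 := half_pos (passLevel_pos hα hαd hz₀)
  obtain ⟨δ₁, hδ₁, hcont⟩ := Metric.eventually_nhds_iff.1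
    ((continuousAt_passLevel hα hαd hz₀).eventually_const_le
      (half_lt_self (passLevel_pos hα hαd hz₀)))
  obtain ⟨R, hR, hfar⟩ := exists_mem_superlevel_of_norm_ge hα hαd (‖z₀‖ + r) L
  obtain ⟨M, hM0, hM⟩ := exists_lipschitz_eval P (R + 8)
  set l₀ := passLevel P α z₀ / 2 with hl₀def
  set ρ := r / 2 with hρdef
  have hρ : 0 < ρ := half_pos hr
  set K := α / ρ + M / (l₀ * ρ ^ α) with hK
  have hK0 : 0 ≤ K := by positivity
  set T := R + 4 + (‖z₀‖ + r) with hT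
  have hT1 : 1 ≤ T := by have := norm_nonneg z₀; linarith
  obtain ⟨N, hN⟩ := exists_nat_ge (T + 1)
  set δ := min (r / 2) (δ₁ / 2) with hδ
  -- At most (2N + 1)^2 n^2 squares are used; exp(4K) is the n-th power of the loss at distance 4/n.
  refine ⟨δ, by positivity, 2 * (2 * N + 1) ^ 2 * (Real.exp (K * 4) * (T ^ D + ρ⁻¹)),
    by positivity, ?_⟩
  intro z hz n hn k hk1 hk2
  have hn' : (1 : ℝ) ≤ n := by exact_mod_cast hn
  have hzr2 : z ∈ Metric.closedBall z₀ (r / 2) :=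
    Metric.closedBall_subset_closedBall (min_le_left _ _) hz
  have hzr : z ∈ Metric.closedBall z₀ r :=
    Metric.closedBall_subset_closedBall (by linarith) hzr2
  have hzn : ‖z‖ ≤ ‖z₀‖ + r := by
    have h1 : ‖z - z₀‖ ≤ r := by rw [← dist_eq_norm]; exact hzr
    have h2 : ‖z‖ ≤ ‖z - z₀‖ + ‖z₀‖ := by simpa using norm_add_le (z - z₀) z₀
    linarith
  obtain ⟨hPz, hlL⟩ := hpass z hzr
  set l := passLevel P α z with hl
  have hll₀ : l₀ ≤ l := hcont (lt_of_le_of_lt hz (lt_of_le_of_lt (min_le_right _ _) (by linarith)))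
  have hl0 : 0 < l := hl₀.trans_le hll₀
  have hAR : basin P α z l ⊆ Metric.ball 0 R := basin_subset_ball_of_isBounded hR
    (fun w hw => hfar z hzn l hlL w hw) (isBounded_basin_passLevel hα hαd hPz)
  have hball : Metric.closedBall z₀ r ⊆ basin P α z l :=
    (convex_closedBall z₀ r).isPreconnected.subset_connectedComponentIn hzr (hsub z hzr l hlL)
  have hfarz : ∀ e, e ∉ basin P α z l → ρ ≤ ‖e - z‖ := by
    intro e he
    by_contra hc
    rw [not_le] at hc
    refine he (hball ?_)
    rw [Metric.mem_closedBall] at hzr2 ⊢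
    have := dist_triangle e z z₀
    rw [dist_eq_norm e z] at this
    linarith
  set S := (Finset.Icc (-((N * n : ℕ) : ℤ)) (N * n : ℕ) ×ˢ
    Finset.Icc (-((N * n : ℕ) : ℤ)) (N * n : ℕ)).filter
      (fun s => ∃ t ∈ gridSquare (1 / n) s, t + z ∈ basin P α z l) with hS
  have hSmem : ∀ s t, t ∈ gridSquare (1 / n) s → t + z ∈ basin P α z l → s ∈ S := by
    intro s t ht htz
    rw [hS, Finset.mem_filter]
    refine ⟨index_mem_Icc hn ht ?_ hN, t, ht, htz⟩
    have h1 := hAR htz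
    rw [mem_ball_zero_iff] at h1
    have h2 : ‖t‖ ≤ ‖t + z‖ + ‖z‖ := by simpa using norm_sub_le (t + z) z
    linarith
  have hcard : (S.card : ℝ) ≤ (2 * N + 1) ^ 2 * n ^ 2 := by
    have h1 : S.card ≤ (2 * (N * n) + 1) * (2 * (N * n) + 1) := by
      refine (Finset.card_filter_le _ _).trans ?_
      rw [Finset.card_product, Int.card_Icc]
      have : ((N * n : ℕ) + 1 - -((N * n : ℕ) : ℤ)).toNat = 2 * (N * n) + 1 := by omega
      rw [this]
    have h2 : (S.card : ℝ) ≤ (2 * (N * n) + 1) * (2 * (N * n) + 1) := by exact_mod_cast h1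
    have h3 : (2 * (N * n) + 1 : ℝ) ≤ (2 * N + 1) * n := by nlinarith
    calc (S.card : ℝ) ≤ (2 * (N * n) + 1) * (2 * (N * n) + 1) := h2
      _ ≤ ((2 * N + 1) * n) * ((2 * N + 1) * n) := by gcongr
      _ = _ := by ring
  have hmain := norm_coeff_le_of_grid (taylor z (P ^ n)) k (h := 1 / n) (by positivity) S
    (hSmem _ 0 (by simp [gridSquare]) (by simpa using mem_basin_self hα hPz l))
    (B := Real.exp (K * 4) * (T ^ D + ρ⁻¹) * l ^ n) (by positivity) ?_
  · refine hmain.trans ?_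
    have h1 : (2 * (1 / n) : ℝ) ≤ 2 := by
      rw [mul_one_div, div_le_iff₀ (by positivity)]; linarith
    calc (2 * (1 / n) : ℝ) * S.card * (Real.exp (K * 4) * (T ^ D + ρ⁻¹) * l ^ n) ≤
        2 * ((2 * N + 1) ^ 2 * n ^ 2) * (Real.exp (K * 4) * (T ^ D + ρ⁻¹) * l ^ n) := by gcongr
      _ = _ := by ring
  · intro s hs s' hs' t ht ht'
    obtain ⟨-, b, hbs, hbA⟩ := Finset.mem_filter.1 hs
    have heA : t + z ∉ basin P α z l := fun h => hs' (hSmem s' t ht' h)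
    have hη : (4 * (1 / n) : ℝ) ≤ 4 := by
      rw [mul_one_div, div_le_iff₀ (by positivity)]; linarith
    have hbe : dist (b + z) (t + z) ≤ 4 * (1 / n) := by
      rw [dist_add_right]; exact dist_le_of_mem_gridSquare hbs ht
    have hbR := hAR hbA
    rw [mem_ball_zero_iff] at hbR
    have heR : ‖t + z‖ ≤ R + 4 := by
      rw [dist_comm, dist_eq_norm] at hbe
      have h1 : ‖t + z‖ ≤ ‖t + z - (b + z)‖ + ‖b + z‖ := by
        have := norm_add_le (t + z - (b + z)) (b + z)
        rwa [sub_add_cancel] at this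
      linarith
    have key := norm_eval_le_of_notMem_basin hα hl₀ hll₀ hρ (η := 4 * (1 / n)) (by positivity) hM0
      (hfarz _ heA) hbA heA hbe (by
        intro x hx
        have hxe : ‖x - (t + z)‖ ≤ 4 * (1 / n) := by rw [← dist_eq_norm]; exact hx
        refine (hM x ?_ (t + z) ?_).trans (by gcongr)
        · rw [mem_closedBall_zero_iff]
          have h1 : ‖x‖ ≤ ‖x - (t + z)‖ + ‖t + z‖ := by
            simpa using norm_add_le (x - (t + z)) (t + z)
          linarith
        · rw [mem_closedBall_zero_iff]; linarith)
    rw [add_sub_cancel_right] at key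
    have hρt : ρ ≤ ‖t‖ := by simpa using hfarz _ heA
    have htT : ‖t‖ ≤ T := by
      have h2 : ‖t‖ ≤ ‖t + z‖ + ‖z‖ := by simpa using norm_sub_le (t + z) z
      linarith
    rw [taylor_eval, eval_pow, norm_pow]
    calc ‖P.eval (t + z)‖ ^ n ≤ (l * ‖t‖ ^ α * Real.exp (K * (4 * (1 / n)))) ^ n := by gcongr
      _ = Real.exp (K * 4) * ‖t‖ ^ (α * n) * l ^ n := by
        rw [mul_pow, mul_pow, ← Real.rpow_natCast (‖t‖ ^ α) n, ← Real.rpow_mul (norm_nonneg _),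
          ← Real.exp_nat_mul, show (n : ℝ) * (K * (4 * (1 / n))) = K * 4 by field_simp]
        ring
      _ ≤ Real.exp (K * 4) * ((T ^ D + ρ⁻¹) * ‖t‖ ^ (k + 1)) * l ^ n := by
        gcongr
        exact rpow_le_mul_pow hρ hT1 hD hρt htT hk1 hk2
      _ = _ := by ring

/-! ### Heads of Taylor expansions and their limits 0 and 1 -/

/-- The terms of degree less than `m` of a polynomial. -/
noncomputable def headPoly (m : ℕ) (q : ℂ[X]) : ℂ[X] :=
  ∑ k ∈ Finset.range m, monomial k (q.coeff k)

theorem coeff_headPoly (m : ℕ) (q : ℂ[X]) (k : ℕ) :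
    (headPoly m q).coeff k = if k < m then q.coeff k else 0 := by
  simp [headPoly, finsetSum_coeff, coeff_monomial]

theorem eval_headPoly (m : ℕ) (q : ℂ[X]) (t : ℂ) :
    (headPoly m q).eval t = ∑ k ∈ Finset.range m, q.coeff k * t ^ k := by
  simp [headPoly, eval_finsetSum]

/-- The full power satisfies (Q^n)' Q = n Q' Q^n, and a coefficient of index j < m - 1 sees only
coefficients of Q^n of index at most j + 1, which the head retains. -/
theorem coeff_head_wronskian_eq_zero (Q : ℂ[X]) (n m j : ℕ) (hj : j + 1 < m) :
    (derivative (headPoly m (Q ^ n)) * Q - (n : ℂ[X]) * (derivative Q * headPoly m (Q ^ n))).coeff j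
      = 0 := by
  have h1 : derivative (Q ^ n) * Q - (n : ℂ[X]) * (derivative Q * Q ^ n) = 0 := by
    rw [derivative_pow]
    rcases n with _ | n
    · simp
    · simp only [map_natCast, Nat.add_sub_cancel]; ring
  have h2 : (derivative (headPoly m (Q ^ n)) * Q).coeff j = (derivative (Q ^ n) * Q).coeff j := by
    rw [coeff_mul, coeff_mul]
    refine Finset.sum_congr rfl fun p hp => ?_
    have := Finset.HasAntidiagonal.mem_antidiagonal.1 hp
    rw [coeff_derivative, coeff_derivative, coeff_headPoly, if_pos (by omega)]
  have h3 : (derivative Q * headPoly m (Q ^ n)).coeff j = (derivative Q * Q ^ n).coeff j := by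
    rw [coeff_mul, coeff_mul]
    refine Finset.sum_congr rfl fun p hp => ?_
    have := Finset.HasAntidiagonal.mem_antidiagonal.1 hp
    rw [coeff_headPoly, if_pos (by omega)]
  have h4 := congrArg (fun p => p.coeff j) h1
  simp only [coeff_zero] at h4
  rw [← C_eq_natCast, coeff_sub, coeff_C_mul] at h4 ⊢
  rw [h2, h3, h4]

/-- In degree at least m - 1 only the last d coefficients of the head can contribute, since Q has
degree at most d. So a bound near index m is enough. -/
theorem norm_coeff_head_wronskian_le {Q q : ℂ[X]} {n m d j : ℕ} {a b : ℝ} (ha0 : 0 ≤ a)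
    (hb0 : 0 ≤ b) (hd : Q.natDegree ≤ d) (hb : ∀ k, ‖Q.coeff k‖ ≤ b)
    (ha : ∀ k, k < m → m ≤ k + d → ‖q.coeff k‖ ≤ a) (hj : m ≤ j + 1) :
    ‖(derivative (headPoly m q) * Q - (n : ℂ[X]) * (derivative Q * headPoly m q)).coeff j‖ ≤
      (j + 1) * ((m + n * d) * (a * b)) := by
  rw [← C_eq_natCast, coeff_sub, coeff_C_mul, coeff_mul, coeff_mul,
    ← Finset.Nat.sum_antidiagonal_swap (n := j) (f := fun p => (derivative Q).coeff p.1 * _),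
    Finset.mul_sum, ← Finset.sum_sub_distrib]
  have hcard : ((Finset.HasAntidiagonal.antidiagonal j).card : ℝ) = j + 1 := by
    rw [Finset.Nat.card_antidiagonal]; push_cast; rfl
  rw [← hcard, ← nsmul_eq_mul]
  refine (norm_sum_le _ _).trans (Finset.sum_le_card_nsmul _ _ _ fun p hp => ?_)
  have hpj := Finset.HasAntidiagonal.mem_antidiagonal.1 hp
  have h1 : ‖(derivative (headPoly m q)).coeff p.1 * Q.coeff p.2‖ ≤ m * (a * b) := by
    rw [coeff_derivative, coeff_headPoly]
    split_ifs with hlt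
    · by_cases hdeg : d < p.2
      · rw [coeff_eq_zero_of_natDegree_lt (hd.trans_lt hdeg)]; simp; positivity
      · rw [norm_mul, norm_mul]
        have h2 : ‖((p.1 : ℂ) + 1)‖ ≤ m := by
          have : ((p.1 : ℂ) + 1) = ((p.1 + 1 : ℕ) : ℂ) := by push_cast; rfl
          rw [this, Complex.norm_natCast]
          exact_mod_cast hlt.le
        calc ‖q.coeff (p.1 + 1)‖ * ‖((p.1 : ℂ) + 1)‖ * ‖Q.coeff p.2‖ ≤ a * m * b := by
              gcongr
              · exact ha _ hlt (by omega)
              · exact hb _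
          _ = m * (a * b) := by ring
    · simp; positivity
  have h2 : ‖(n : ℂ) * ((derivative Q).coeff p.2 * (headPoly m q).coeff p.1)‖ ≤
      n * d * (a * b) := by
    rw [coeff_derivative, coeff_headPoly]
    split_ifs with hlt
    · by_cases hdeg : d < p.2 + 1
      · rw [coeff_eq_zero_of_natDegree_lt (hd.trans_lt hdeg)]; simp; positivity
      · rw [norm_mul, norm_mul, norm_mul, Complex.norm_natCast]
        have h2 : ‖((p.2 : ℂ) + 1)‖ ≤ d := by
          have : ((p.2 : ℂ) + 1) = ((p.2 + 1 : ℕ) : ℂ) := by push_cast; rfl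
          rw [this, Complex.norm_natCast]
          exact_mod_cast (not_lt.1 hdeg)
        calc (n : ℝ) * (‖Q.coeff (p.2 + 1)‖ * ‖((p.2 : ℂ) + 1)‖ * ‖q.coeff p.1‖) ≤
            n * (b * d * a) := by
              gcongr
              · exact hb _
              · exact ha _ hlt (by omega)
          _ = n * d * (a * b) := by ring
    · simp; positivity
  calc _ ≤ _ := norm_sub_le _ _
    _ ≤ m * (a * b) + n * d * (a * b) := add_le_add h1 h2
    _ = _ := by ring

theorem norm_eval_head_wronskian_le {Q : ℂ[X]} {n m d : ℕ} {a b τ : ℝ} (ha0 : 0 ≤ a)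
    (hb0 : 0 ≤ b) (hm : 0 < m) (hd : Q.natDegree ≤ d) (hb : ∀ k, ‖Q.coeff k‖ ≤ b)
    (ha : ∀ k, k < m → m ≤ k + d → ‖(Q ^ n).coeff k‖ ≤ a) {t : ℂ} (hτ : 1 ≤ τ) (ht : ‖t‖ ≤ τ) :
    ‖(derivative (headPoly m (Q ^ n))).eval t * Q.eval t -
        n * ((derivative Q).eval t * (headPoly m (Q ^ n)).eval t)‖ ≤
      (m + d) ^ 2 * ((m + n * d) * (a * b)) * (τ ^ d * ‖t‖ ^ (m - 1)) := by
  set W := derivative (headPoly m (Q ^ n)) * Q -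
    (n : ℂ[X]) * (derivative Q * headPoly m (Q ^ n)) with hW
  have hWe : (derivative (headPoly m (Q ^ n))).eval t * Q.eval t -
      n * ((derivative Q).eval t * (headPoly m (Q ^ n)).eval t) = W.eval t := by
    simp [hW]
  have hH : (headPoly m (Q ^ n)).natDegree ≤ m - 1 := by
    rw [natDegree_le_iff_coeff_eq_zero]
    intro N hN
    rw [coeff_headPoly, if_neg (by omega)]
  have hWd : W.natDegree < m + d := by
    rw [hW, ← C_eq_natCast]
    have h1 := natDegree_mul_le (p := derivative (headPoly m (Q ^ n))) (q := Q)
    have h2 := natDegree_C_mul_le (n : ℂ) (derivative Q * headPoly m (Q ^ n))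
    have h3 := natDegree_mul_le (p := derivative Q) (q := headPoly m (Q ^ n))
    have h4 := natDegree_derivative_le (headPoly m (Q ^ n))
    have h5 := natDegree_derivative_le Q
    refine (natDegree_sub_le _ _).trans_lt (max_lt ?_ ?_) <;> omega
  rw [hWe, eval_eq_sum_range' hWd]
  have hcard : (((Finset.range (m + d)).card : ℕ) : ℝ) = m + d := by simp
  calc ‖∑ j ∈ Finset.range (m + d), W.coeff j * t ^ j‖
      ≤ ∑ j ∈ Finset.range (m + d), ‖W.coeff j * t ^ j‖ := norm_sum_le _ _
    _ ≤ (Finset.range (m + d)).card • ((m + d) * ((m + n * d) * (a * b)) *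
        (τ ^ d * ‖t‖ ^ (m - 1))) := by
        refine Finset.sum_le_card_nsmul _ _ _ fun j hj => ?_
        have hj' := Finset.mem_range.1 hj
        by_cases hjm : j + 1 < m
        · rw [hW, coeff_head_wronskian_eq_zero Q n m j hjm]
          simp only [zero_mul, norm_zero]; positivity
        · rw [norm_mul, norm_pow]
          have h1 := norm_coeff_head_wronskian_le (n := n) (q := Q ^ n) ha0 hb0 hd hb ha
            (not_lt.1 hjm)
          have h2 : ((j : ℝ) + 1) ≤ m + d := by exact_mod_cast hj'
          have h3 : ‖t‖ ^ j ≤ τ ^ d * ‖t‖ ^ (m - 1) := by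
            obtain ⟨i, rfl⟩ : ∃ i, j = i + (m - 1) := ⟨j - (m - 1), by omega⟩
            rw [pow_add]
            gcongr
            calc ‖t‖ ^ i ≤ τ ^ i := by gcongr
              _ ≤ τ ^ d := pow_le_pow_right₀ hτ (by omega)
          calc ‖W.coeff j‖ * ‖t‖ ^ j ≤ ((j + 1) * ((m + n * d) * (a * b))) *
              (τ ^ d * ‖t‖ ^ (m - 1)) := by gcongr
            _ ≤ _ := by gcongr
    _ = _ := by rw [nsmul_eq_mul, hcard]; ring

/-- The quotient by `P w ^ n` of the Taylor polynomial of degree less than `m` of `P ^ n` at `z`. -/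
noncomputable def headRatio (P : ℂ[X]) (m n : ℕ) (z w : ℂ) : ℂ :=
  (headPoly m (taylor z (P ^ n))).eval (w - z) / P.eval w ^ n

theorem headRatio_self {P : ℂ[X]} {m n : ℕ} (hm : 0 < m) {z : ℂ} (hz : P.eval z ≠ 0) :
    headRatio P m n z z = 1 := by
  rw [headRatio, sub_self, ← coeff_zero_eq_eval_zero, coeff_headPoly, if_pos hm, taylor_coeff_zero,
    eval_pow, div_self (pow_ne_zero _ hz)]

theorem hasDerivAt_coeff_taylor (f : ℂ[X]) (k : ℕ) (z : ℂ) :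
    HasDerivAt (fun z => (taylor z f).coeff k) ((k + 1) * (taylor z f).coeff (k + 1)) z := by
  simp only [taylor_coeff]
  have h1 := (hasseDeriv k f).hasDerivAt z
  refine h1.congr_deriv ?_
  have h2 := LinearMap.congr_fun (hasseDeriv_comp (R := ℂ) 1 k) f
  rw [LinearMap.comp_apply, hasseDeriv_one] at h2
  rw [h2, LinearMap.smul_apply, eval_smul, Nat.choose_one_right, add_comm 1 k, nsmul_eq_mul]
  push_cast; ring

/-- The derivative of the k-th term is (k+1) A_{k+1} (w-z)^k - k A_k (w-z)^(k-1), so the sum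
telescopes. -/
theorem hasDerivAt_eval_headPoly_taylor (f : ℂ[X]) (m : ℕ) (z w : ℂ) :
    HasDerivAt (fun z => (headPoly m (taylor z f)).eval (w - z))
      (m * (taylor z f).coeff m * (w - z) ^ (m - 1)) z := by
  simp only [eval_headPoly]
  induction m with
  | zero => simpa using hasDerivAt_const z (0 : ℂ)
  | succ m ih =>
    simp only [Finset.sum_range_succ]
    have h1 := (hasDerivAt_coeff_taylor f m z).mul (((hasDerivAt_id z).const_sub w).pow m)
    refine (ih.add h1).congr_deriv ?_
    simp only [id, Nat.add_sub_cancel, Pi.pow_apply]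
    push_cast
    ring

theorem hasDerivAt_headRatio_left {P : ℂ[X]} (m n : ℕ) (z w : ℂ) :
    HasDerivAt (fun z => headRatio P m n z w)
      (m * (taylor z (P ^ n)).coeff m * (w - z) ^ (m - 1) / P.eval w ^ n) z :=
  (hasDerivAt_eval_headPoly_taylor (P ^ n) m z w).div_const _

theorem hasDerivAt_headRatio_right {P : ℂ[X]} (m n : ℕ) {z w : ℂ} (hw : P.eval w ≠ 0) :
    HasDerivAt (headRatio P m n z)
      (((derivative (headPoly m (taylor z P ^ n))).eval (w - z) * (taylor z P).eval (w - z) -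
        n * ((derivative (taylor z P)).eval (w - z) * (headPoly m (taylor z P ^ n)).eval (w - z))) /
          P.eval w ^ (n + 1)) w := by
  have h1 : taylor z (P ^ n) = taylor z P ^ n := taylor_pow ..
  have h2 : HasDerivAt (fun w => (headPoly m (taylor z P ^ n)).eval (w - z))
      ((derivative (headPoly m (taylor z P ^ n))).eval (w - z)) w := by
    have := ((headPoly m (taylor z P ^ n)).hasDerivAt (w - z)).comp w ((hasDerivAt_id w).sub_const z)
    simpa [Function.comp_def] using this
  have h3 : (taylor z P).eval (w - z) = P.eval w := by rw [taylor_eval]; simp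
  have h4 : (derivative (taylor z P)).eval (w - z) = P.derivative.eval w := by
    have h5 := ((taylor z P).hasDerivAt (w - z)).comp w ((hasDerivAt_id w).sub_const z)
    have h6 : (fun x => (taylor z P).eval x) ∘ (fun x => id x - z) = fun w => P.eval w := by
      ext x; simp [taylor_eval]
    rw [h6, mul_one] at h5
    exact h5.unique (P.hasDerivAt w)
  have h7 := h2.div ((P.hasDerivAt w).pow n) (pow_ne_zero n hw)
  rw [h3, h4]
  unfold headRatio
  rw [h1]
  refine h7.congr_deriv ?_
  simp only [Pi.pow_apply]
  rcases n with _ | n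
  · simp [hw]
  · simp only [Nat.add_sub_cancel]
    field_simp
    ring

/-- The exponent m - 1 - αn lies in (-2, -1], hence the square. -/
theorem pow_floor_sub_one_le {α τ : ℝ} (hα : 0 < α) (hτ : 0 < τ) {n : ℕ} (hm : 0 < ⌊α * n⌋₊) :
    τ ^ (⌊α * n⌋₊ - 1) ≤ (1 + τ⁻¹) ^ 2 * (τ ^ α) ^ n := by
  set m := ⌊α * n⌋₊ with hmdef
  have h1 : (m : ℝ) ≤ α * n := Nat.floor_le (by positivity)
  have h2 : α * n < m + 1 := Nat.lt_floor_add_one _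
  have h3 : τ ^ (m - 1) = τ ^ ((m : ℝ) - 1 - α * n) * (τ ^ α) ^ n := by
    rw [← Real.rpow_natCast (τ ^ α) n, ← Real.rpow_mul hτ.le, ← Real.rpow_add hτ,
      ← Real.rpow_natCast τ (m - 1), Nat.cast_sub hm]
    congr 1; push_cast; ring
  rw [h3]
  gcongr
  have h4 : τ ^ ((m : ℝ) - 1 - α * n) = (τ⁻¹) ^ (α * n + 1 - m) := by
    rw [Real.inv_rpow hτ.le, ← Real.rpow_neg hτ.le]; congr 1; ring
  rw [h4]
  have h5 : 0 < τ⁻¹ := inv_pos.2 hτ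
  calc (τ⁻¹) ^ (α * n + 1 - m) ≤ (1 + τ⁻¹) ^ (α * n + 1 - m) := by
        gcongr
        · linarith
        · linarith
    _ ≤ (1 + τ⁻¹) ^ (2 : ℝ) := Real.rpow_le_rpow_of_exponent_le (by linarith) (by linarith)
    _ = _ := by norm_cast

theorem exists_norm_coeff_taylor_self_le (P : ℂ[X]) (z₀ : ℂ) :
    ∃ b ≥ 0, ∀ z ∈ Metric.closedBall z₀ 1, ∀ k, ‖(taylor z P).coeff k‖ ≤ b := by
  have hc : Continuous fun z => ∑ k ∈ Finset.range (P.natDegree + 1), ‖(taylor z P).coeff k‖ := by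
    simp only [taylor_coeff]
    exact continuous_finsetSum _ fun k _ => (hasseDeriv k P).continuous.norm
  obtain ⟨b, hb⟩ := (isCompact_closedBall z₀ 1).exists_bound_of_continuousOn hc.continuousOn
  have hb0 : 0 ≤ b := (norm_nonneg _).trans (hb z₀ (by simp))
  refine ⟨b, hb0, fun z hz k => ?_⟩
  by_cases hk : k < P.natDegree + 1
  · refine le_trans ?_ ((le_abs_self _).trans (hb z hz))
    exact Finset.single_le_sum (f := fun k => ‖(taylor z P).coeff k‖) (fun _ _ => norm_nonneg _)
      (Finset.mem_range.2 hk)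
  · rw [coeff_eq_zero_of_natDegree_lt (by rw [natDegree_taylor]; omega)]
    simpa using hb0

theorem eventually_floor_pos {α : ℝ} (hα : 0 < α) : ∀ᶠ n : ℕ in atTop, 0 < ⌊α * n⌋₊ := by
  have h : Tendsto (fun n : ℕ => α * n) atTop atTop :=
    tendsto_natCast_atTop_atTop.const_mul_atTop hα
  exact (tendsto_nat_floor_atTop.comp h).eventually_gt_atTop 0

theorem exists_superlevel_margin {P : ℂ[X]} {α : ℝ} (hα : 0 < α) {z₀ w₁ : ℂ}
    {l : ℝ} (hl : 0 ≤ l) (hw : w₁ ∈ superlevel P α z₀ l) :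
    ∃ r > 0, r < 1 ∧ ∃ s₁ > 0, ∃ s₂ > s₁, (l + r) * (‖w₁ - z₀‖ + 2 * r) ^ α ≤ s₁ ∧
      ∀ x ∈ Metric.ball w₁ r, s₂ ≤ ‖P.eval x‖ := by
  obtain ⟨s₁, h1, h2⟩ := exists_between (show l * ‖w₁ - z₀‖ ^ α < ‖P.eval w₁‖ from hw)
  obtain ⟨s₂, h3, h4⟩ := exists_between h2
  have hc : Continuous fun r : ℝ => (l + r) * (‖w₁ - z₀‖ + 2 * r) ^ α := by
    refine (by fun_prop : Continuous fun r : ℝ => l + r).mul ?_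
    exact (by fun_prop : Continuous fun r : ℝ => ‖w₁ - z₀‖ + 2 * r).rpow_const
      fun _ => Or.inr hα.le
  have e1 : ∀ᶠ r : ℝ in 𝓝 0, (l + r) * (‖w₁ - z₀‖ + 2 * r) ^ α ≤ s₁ :=
    (hc.tendsto 0).eventually_le_const (by simpa using h1)
  obtain ⟨ε, hε, e2⟩ := Metric.eventually_nhds_iff_ball.1
    (P.continuous.norm.continuousAt.eventually_const_le h4)
  have e3 : ∀ᶠ r : ℝ in 𝓝[>] 0, r < min ε 1 :=
    (eventually_lt_nhds (lt_min hε one_pos)).filter_mono nhdsWithin_le_nhds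
  obtain ⟨r, ⟨h5, h6⟩, h7⟩ := (((e1.filter_mono nhdsWithin_le_nhds).and e3).and
    self_mem_nhdsWithin).exists
  have h0 : 0 ≤ l * ‖w₁ - z₀‖ ^ α := by positivity
  refine ⟨r, h7, h6.trans_le (min_le_right _ _), s₁, h0.trans_lt h1, s₂, h3, h5, fun x hx => ?_⟩
  exact e2 x (Metric.ball_subset_ball (h6.le.trans (min_le_left _ _)) hx)

set_option maxHeartbeats 1000000 in
-- Both derivatives are at most a power of n times (l(z) |w - z|^α / |P(w)|)^n, and on the
-- superlevel set this base is below some c < 1, uniformly near (z₀, w₁) by continuity of the pass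
-- level.
theorem exists_norm_deriv_headRatio_le {P : ℂ[X]} {α : ℝ} (hα : 0 < α)
    (hαd : α < (P.natDegree : ℝ)) {z₀ w₁ : ℂ} (hz₀ : P.eval z₀ ≠ 0)
    (hw : w₁ ∈ superlevel P α z₀ (passLevel P α z₀)) :
    ∃ r > 0, ∃ ε : ℕ → ℝ, Tendsto ε atTop (𝓝 0) ∧ ∀ᶠ n : ℕ in atTop,
      ∀ z ∈ Metric.ball z₀ r, ∀ x ∈ Metric.ball w₁ r,
        ‖deriv (fun z => headRatio P ⌊α * n⌋₊ n z x) z‖ ≤ ε n ∧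
        DifferentiableAt ℂ (headRatio P ⌊α * n⌋₊ n z) x ∧
        ‖deriv (headRatio P ⌊α * n⌋₊ n z) x‖ ≤ ε n := by
  set d := P.natDegree with hd
  have hd0 : 1 ≤ d := natDegree_pos_of_lt hα hαd
  have hl0 := passLevel_pos hα hαd hz₀
  obtain ⟨r₁, hr₁, hr₁1, s₁, hs₁, s₂, hs₂, hlev, hPx⟩ := exists_superlevel_margin hα hl0.le hw
  obtain ⟨δ, hδ, C, hC, hA⟩ := exists_norm_coeff_taylor_le hα hαd hz₀ (D := d) (by positivity)
  obtain ⟨b, hb0, hb⟩ := exists_norm_coeff_taylor_self_le P z₀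
  obtain ⟨δ', hδ', hcont⟩ := Metric.eventually_nhds_iff.1
    ((continuousAt_passLevel hα hαd hz₀).eventually_le_const
      (show passLevel P α z₀ < passLevel P α z₀ + r₁ by linarith))
  set r := min r₁ (min δ δ') with hr
  have hs₂0 : 0 < s₂ := hs₁.trans hs₂
  set τ := ‖w₁ - z₀‖ + 2 * r₁ with hτ
  have hτ0 : 0 < τ := by positivity
  set E := (1 + τ⁻¹) ^ 2 with hE
  set c := s₁ / s₂ with hc
  have hc1 : c < 1 := (div_lt_one hs₂0).2 hs₂
  have hc0 : 0 < c := div_pos hs₁ hs₂0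
  set K := C * E * (d + (2 * d) ^ 2 * (2 * d) * b * (1 + τ) ^ d / s₂) with hK
  refine ⟨r, by positivity, fun n => K * ((n : ℝ) ^ 5 * c ^ n), ?_, ?_⟩
  · have := (tendsto_pow_const_mul_const_pow_of_lt_one 5 hc0.le hc1).const_mul K
    simpa using this
  filter_upwards [eventually_floor_pos hα, eventually_gt_atTop 0] with n hm hn z hz x hx
  set m := ⌊α * n⌋₊ with hmdef
  have hn1 : (1 : ℝ) ≤ n := by exact_mod_cast hn
  have hd1 : (1 : ℝ) ≤ d := by exact_mod_cast hd0
  have hm1 : (m : ℝ) ≤ α * n := Nat.floor_le (by positivity)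
  have hm2 : α * n < m + 1 := Nat.lt_floor_add_one _
  have hmd : (m : ℝ) ≤ d * n := hm1.trans (by gcongr)
  have hzδ : z ∈ Metric.closedBall z₀ δ := Metric.ball_subset_closedBall
    (Metric.ball_subset_ball ((min_le_right _ _).trans (min_le_left _ _)) hz)
  have hzr₁ : dist z z₀ < r₁ := lt_of_lt_of_le hz (min_le_left _ _)
  have hxr₁ : dist x w₁ < r₁ := lt_of_lt_of_le hx (min_le_left _ _)
  have hz1 : z ∈ Metric.closedBall z₀ 1 := (hzr₁.trans hr₁1).le
  have hl : passLevel P α z ≤ passLevel P α z₀ + r₁ :=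
    hcont (lt_of_lt_of_le hz ((min_le_right _ _).trans (min_le_right _ _)))
  have hlpos : 0 ≤ passLevel P α z := Real.sInf_nonneg fun l hl => hl.1.le
  have hxz : ‖x - z‖ ≤ τ := by
    have h1 := dist_triangle4 x w₁ z₀ z
    rw [dist_comm z₀ z, dist_eq_norm x z, dist_eq_norm w₁ z₀] at h1
    linarith
  have hP := hPx x hxr₁
  have hPx0 : P.eval x ≠ 0 := norm_pos_iff.1 (hs₂0.trans_le hP)
  have hpow : passLevel P α z ^ n * ‖x - z‖ ^ (m - 1) ≤ E * s₁ ^ n := by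
    calc passLevel P α z ^ n * ‖x - z‖ ^ (m - 1) ≤ (passLevel P α z₀ + r₁) ^ n * τ ^ (m - 1) := by
          gcongr
      _ ≤ (passLevel P α z₀ + r₁) ^ n * (E * (τ ^ α) ^ n) := by
          gcongr
          exact pow_floor_sub_one_le hα hτ0 hm
      _ = E * ((passLevel P α z₀ + r₁) * τ ^ α) ^ n := by rw [mul_pow]; ring
      _ ≤ E * s₁ ^ n := by gcongr
  have hcn : s₁ ^ n / s₂ ^ n = c ^ n := (div_pow _ _ _).symm
  have hterm : ∀ k, k ≤ m → m ≤ k + d → ‖(taylor z (P ^ n)).coeff k‖ ≤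
      C * n ^ 2 * passLevel P α z ^ n := by
    intro k hk1 hk2
    have h1 : (k : ℝ) ≤ m := by exact_mod_cast hk1
    have h2 : (m : ℝ) ≤ k + d := by exact_mod_cast hk2
    exact hA z hzδ n hn k (by linarith) (by linarith)
  refine ⟨?_, (hasDerivAt_headRatio_right m n hPx0).differentiableAt, ?_⟩
  · rw [(hasDerivAt_headRatio_left m n z x).deriv, norm_div, norm_mul, norm_mul, norm_pow, norm_pow,
      Complex.norm_natCast]
    calc m * ‖(taylor z (P ^ n)).coeff m‖ * ‖x - z‖ ^ (m - 1) / ‖P.eval x‖ ^ n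
        ≤ (d * n) * (C * n ^ 2 * passLevel P α z ^ n) * ‖x - z‖ ^ (m - 1) / s₂ ^ n := by
          gcongr
          exact hterm m le_rfl (by omega)
      _ = (d * n) * (C * n ^ 2) * (passLevel P α z ^ n * ‖x - z‖ ^ (m - 1)) / s₂ ^ n := by ring
      _ ≤ (d * n) * (C * n ^ 2) * (E * s₁ ^ n) / s₂ ^ n := by gcongr
      _ = C * E * d * (n ^ 3 * c ^ n) := by rw [← hcn]; ring
      _ ≤ K * (n ^ 5 * c ^ n) := by
        have h1 : (n : ℝ) ^ 3 ≤ n ^ 5 := pow_le_pow_right₀ hn1 (by norm_num)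
        have h2 : C * E * d ≤ K := by
          rw [hK]
          gcongr
          exact le_add_of_nonneg_right (by positivity)
        gcongr
  · rw [(hasDerivAt_headRatio_right m n hPx0).deriv, norm_div, norm_pow]
    have hW := norm_eval_head_wronskian_le (Q := taylor z P) (n := n) (m := m) (d := d)
      (a := C * n ^ 2 * passLevel P α z ^ n) (τ := 1 + τ) (t := x - z) (by positivity) hb0 hm
      (by rw [natDegree_taylor]) (hb z hz1) (fun k hk1 hk2 => by
        rw [← taylor_pow]; exact hterm k hk1.le hk2) (by linarith) (by linarith)
    calc _ ≤ (m + d) ^ 2 * ((m + n * d) * (C * n ^ 2 * passLevel P α z ^ n * b)) *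
          ((1 + τ) ^ d * ‖x - z‖ ^ (m - 1)) / s₂ ^ (n + 1) := by gcongr
      _ ≤ (2 * d * n) ^ 2 * ((2 * d * n) * (C * n ^ 2 * passLevel P α z ^ n * b)) *
          ((1 + τ) ^ d * ‖x - z‖ ^ (m - 1)) / s₂ ^ (n + 1) := by
          have h0 : (d : ℝ) ≤ d * n := le_mul_of_one_le_right (by positivity) hn1
          have h1 : (m + d : ℝ) ≤ 2 * d * n := by linarith
          have h2 : (m + n * d : ℝ) ≤ 2 * d * n := by linarith
          gcongr
      _ = C * ((2 * d) ^ 2 * (2 * d) * b * (1 + τ) ^ d / s₂) * n ^ 5 *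
          (passLevel P α z ^ n * ‖x - z‖ ^ (m - 1)) / s₂ ^ n := by
          rw [pow_succ s₂]; field_simp
      _ ≤ C * ((2 * d) ^ 2 * (2 * d) * b * (1 + τ) ^ d / s₂) * n ^ 5 *
          (E * s₁ ^ n) / s₂ ^ n := by gcongr
      _ = C * E * ((2 * d) ^ 2 * (2 * d) * b * (1 + τ) ^ d / s₂) * (n ^ 5 * c ^ n) := by
          rw [← hcn]; ring
      _ ≤ K * (n ^ 5 * c ^ n) := by
        rw [hK]
        gcongr
        exact le_add_of_nonneg_left (by positivity)

theorem exists_norm_headRatio_sub_le {P : ℂ[X]} {α : ℝ} (hα : 0 < α)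
    (hαd : α < (P.natDegree : ℝ)) {z₀ w₁ : ℂ} (hz₀ : P.eval z₀ ≠ 0)
    (hw : w₁ ∈ superlevel P α z₀ (passLevel P α z₀)) :
    ∃ r > 0, ∃ ε : ℕ → ℝ, Tendsto ε atTop (𝓝 0) ∧ ∀ᶠ n : ℕ in atTop,
      ∀ z ∈ Metric.ball z₀ r, ∀ x ∈ Metric.ball w₁ r,
        ‖headRatio P ⌊α * n⌋₊ n z x - headRatio P ⌊α * n⌋₊ n z₀ w₁‖ ≤ ε n := by
  obtain ⟨r, hr, ε, hε, hev⟩ := exists_norm_deriv_headRatio_le hα hαd hz₀ hw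
  refine ⟨r, hr, fun n => ε n * r + ε n * r, by simpa using (hε.mul_const r).add (hε.mul_const r),
    ?_⟩
  filter_upwards [hev] with n hn z hz x hx
  have hw₁ : w₁ ∈ Metric.ball w₁ r := Metric.mem_ball_self hr
  have hz₀' : z₀ ∈ Metric.ball z₀ r := Metric.mem_ball_self hr
  have hε0 : 0 ≤ ε n := (norm_nonneg _).trans (hn z₀ hz₀' w₁ hw₁).1
  have h1 := (convex_ball w₁ r).norm_image_sub_le_of_norm_deriv_le
    (fun x hx => (hn z hz x hx).2.1) (fun x hx => (hn z hz x hx).2.2) hw₁ hx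
  have h2 := (convex_ball z₀ r).norm_image_sub_le_of_norm_deriv_le
    (fun z _ => (hasDerivAt_headRatio_left (P := P) ⌊α * n⌋₊ n z w₁).differentiableAt)
    (fun z hz => (hn z hz w₁ hw₁).1) hz₀' hz
  have h3 : ‖x - w₁‖ ≤ r := by rw [← dist_eq_norm]; exact le_of_lt hx
  have h4 : ‖z - z₀‖ ≤ r := by rw [← dist_eq_norm]; exact le_of_lt hz
  calc _ ≤ _ := norm_sub_le_norm_sub_add_norm_sub _ (headRatio P ⌊α * n⌋₊ n z w₁) _
    _ ≤ ε n * r + ε n * r := add_le_add (h1.trans (by gcongr)) (h2.trans (by gcongr))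

/-- Having the same limiting behaviour is a locally constant relation, so it spreads over a
connected component. -/
theorem tendsto_headRatio_sub_of_mem_component {P : ℂ[X]} {α : ℝ} (hα : 0 < α)
    (hαd : α < (P.natDegree : ℝ)) {z w x y : ℂ} (hz : P.eval z ≠ 0)
    (hx : x ∈ connectedComponentIn (superlevel P α z (passLevel P α z)) w)
    (hy : y ∈ connectedComponentIn (superlevel P α z (passLevel P α z)) w) :
    Tendsto (fun n : ℕ => headRatio P ⌊α * n⌋₊ n z y - headRatio P ⌊α * n⌋₊ n z x) atTop (𝓝 0) := by
  refine (isPreconnected_connectedComponentIn (F := superlevel P α z (passLevel P α z))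
    (x := w)).induction₂ (fun x y => Tendsto (fun n : ℕ => headRatio P ⌊α * n⌋₊ n z y -
      headRatio P ⌊α * n⌋₊ n z x) atTop (𝓝 0)) (fun x hx => ?_) ?_ ?_ hx hy
  · obtain ⟨r, hr, ε, hε, hev⟩ := exists_norm_headRatio_sub_le hα hαd hz
      (connectedComponentIn_subset _ _ hx)
    refine Filter.Eventually.filter_mono nhdsWithin_le_nhds ?_
    filter_upwards [Metric.ball_mem_nhds x hr] with y hy
    refine squeeze_zero_norm' ?_ hε
    filter_upwards [hev] with n hn
    exact hn z (Metric.mem_ball_self hr) y hy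
  · intro a b c _ _ _ h1 h2
    simpa using h1.add h2
  · intro a b _ _ h
    simpa using h.neg

theorem tendsto_headRatio_of_mem_basin {P : ℂ[X]} {α : ℝ} (hα : 0 < α)
    (hαd : α < (P.natDegree : ℝ)) {z w : ℂ} (hz : P.eval z ≠ 0)
    (hw : w ∈ basin P α z (passLevel P α z)) :
    Tendsto (fun n : ℕ => headRatio P ⌊α * n⌋₊ n z w) atTop (𝓝 1) := by
  have h1 := tendsto_headRatio_sub_of_mem_component hα hαd hz
    (mem_basin_self hα hz (passLevel P α z)) hw
  have h2 : Tendsto (fun n : ℕ => headRatio P ⌊α * n⌋₊ n z z) atTop (𝓝 1) := by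
    refine tendsto_const_nhds.congr' ?_
    filter_upwards [eventually_floor_pos hα] with n hn
    rw [headRatio_self hn hz]
  simpa using h1.add h2

/-- The grid estimate for the single square of half-side 1, whose boundary lies in 1 ≤ |t| ≤ 2. -/
theorem norm_coeff_pow_le (Q : ℂ[X]) {M : ℝ} (hM : ∀ t : ℂ, ‖t‖ ≤ 2 → ‖Q.eval t‖ ≤ M) (n k : ℕ) :
    ‖(Q ^ n).coeff k‖ ≤ 2 * M ^ n := by
  have hM0 : 0 ≤ M := (norm_nonneg _).trans (hM 0 (by simp))
  have := norm_coeff_le_of_grid (Q ^ n) k (h := 1) one_pos {(0, 0)} (by simp) (B := M ^ n)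
    (by positivity) ?_
  · simpa using this
  · rintro s hs s' hs' t ht ht'
    rw [Finset.mem_singleton] at hs hs'
    subst hs
    simp only [gridSquare, Set.mem_ofPred_eq, Int.cast_zero, mul_zero, sub_zero, mul_one] at ht ht'
    have h2 : ‖t‖ ≤ 2 := by
      have := Complex.norm_le_abs_re_add_abs_im t
      linarith
    have h1 : 1 ≤ ‖t‖ := by
      have hne : s'.1 ≠ 0 ∨ s'.2 ≠ 0 := by
        by_contra hc
        push Not at hc
        exact hs' (Prod.ext hc.1 hc.2)
      have key : ∀ (x : ℝ) (i : ℤ), i ≠ 0 → |x - 2 * i| ≤ 1 → 1 ≤ |x| := by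
        intro x i hi hx
        have h3 : (1 : ℝ) ≤ |(i : ℝ)| := by
          have := Int.one_le_abs hi
          exact_mod_cast this
        have h4 : |2 * (i : ℝ)| ≤ |x| + |x - 2 * i| := by
          have := abs_sub x (x - 2 * (i : ℝ))
          rwa [sub_sub_cancel] at this
        rw [abs_mul, abs_two] at h4
        linarith
      rcases hne with h | h
      · exact (key _ _ h ht'.1).trans (Complex.abs_re_le_norm t)
      · exact (key _ _ h ht'.2).trans (Complex.abs_im_le_norm t)
    rw [eval_pow, norm_pow]
    calc ‖Q.eval t‖ ^ n ≤ M ^ n := by gcongr; exact hM t h2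
      _ ≤ M ^ n * ‖t‖ ^ (k + 1) := le_mul_of_one_le_right (by positivity) (one_le_pow₀ h1)

/-- Far from z one has |P(w)| > 2(M+1) |w - z|^α, with M bounding |P| on the disc of radius 2 about
z, so each term of the head is at most 2 · 2^(-n) times P(w)^n in modulus. -/
theorem exists_tendsto_headRatio_zero {P : ℂ[X]} {α : ℝ} (hα : 0 < α)
    (hαd : α < (P.natDegree : ℝ)) (z : ℂ) :
    ∃ R : ℝ, ∀ w : ℂ, R ≤ ‖w‖ → Tendsto (fun n : ℕ => headRatio P ⌊α * n⌋₊ n z w) atTop (𝓝 0) := by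
  obtain ⟨M, hM⟩ := (isCompact_closedBall (0 : ℂ) 2).exists_bound_of_continuousOn
    (taylor z P).continuous.continuousOn
  have hM0 : 0 ≤ M := (norm_nonneg _).trans (hM 0 (by simp))
  obtain ⟨R, hR, hfar⟩ := exists_mem_superlevel_of_norm_ge hα hαd ‖z‖ (2 * (M + 1))
  refine ⟨max R (‖z‖ + 1), fun w hw => ?_⟩
  have h1 : 2 * (M + 1) * ‖w - z‖ ^ α < ‖P.eval w‖ :=
    hfar z le_rfl _ le_rfl w ((le_max_left _ _).trans hw)
  have h2 : 1 ≤ ‖w - z‖ := by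
    have := norm_sub_norm_le w z
    have := (le_max_right R (‖z‖ + 1)).trans hw
    linarith
  have hg : Tendsto (fun n : ℕ => 2 * α * ((n : ℝ) ^ 1 * (1 / 2 : ℝ) ^ n)) atTop (𝓝 0) := by
    have := (tendsto_pow_const_mul_const_pow_of_lt_one 1 (r := 1 / 2) (by norm_num)
      (by norm_num)).const_mul (2 * α)
    simpa using this
  refine squeeze_zero_norm (fun n => ?_) hg
  set m := ⌊α * n⌋₊ with hm
  have hm1 : (m : ℝ) ≤ α * n := Nat.floor_le (by positivity)
  rw [headRatio, eval_headPoly, norm_div, norm_pow]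
  have hpow : ‖w - z‖ ^ m ≤ (‖w - z‖ ^ α) ^ n := by
    rw [← Real.rpow_natCast (‖w - z‖ ^ α) n, ← Real.rpow_mul (by positivity), ← Real.rpow_natCast]
    exact Real.rpow_le_rpow_of_exponent_le h2 hm1
  have h3 : ‖∑ k ∈ Finset.range m, (taylor z (P ^ n)).coeff k * (w - z) ^ k‖ ≤
      m * (2 * M ^ n * (‖w - z‖ ^ α) ^ n) := by
    refine (norm_sum_le _ _).trans ?_
    refine (Finset.sum_le_card_nsmul _ _ (2 * M ^ n * (‖w - z‖ ^ α) ^ n) fun k hk => ?_).trans ?_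
    · rw [norm_mul, norm_pow, taylor_pow]
      have := norm_coeff_pow_le (taylor z P) (fun t ht => hM t (by simpa using ht)) n k
      gcongr
      exact (pow_le_pow_right₀ h2 (Finset.mem_range.1 hk).le).trans hpow
    · rw [Finset.card_range, nsmul_eq_mul]
  have h0 : 0 < ‖w - z‖ ^ α := Real.rpow_pos_of_pos (by linarith) _
  have h4 : 0 < 2 * (M + 1) * ‖w - z‖ ^ α := by positivity
  rw [div_le_iff₀ (pow_pos (h4.trans h1) n)]
  calc _ ≤ _ := h3
    _ ≤ (α * n) * (2 * (M + 1) ^ n * (‖w - z‖ ^ α) ^ n) := by gcongr; linarith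
    _ = 2 * α * ((n : ℝ) ^ 1 * (1 / 2 : ℝ) ^ n) * (2 * (M + 1) * ‖w - z‖ ^ α) ^ n := by
      rw [mul_pow, mul_pow, div_pow, one_pow]; field_simp
    _ ≤ _ := by gcongr

/-- Components other than the basin are unbounded, so the limit 0 at far points propagates to all of
them. -/
theorem tendsto_headRatio_of_notMem_basin {P : ℂ[X]} {α : ℝ} (hα : 0 < α)
    (hαd : α < (P.natDegree : ℝ)) {z w : ℂ} (hz : P.eval z ≠ 0)
    (hw : w ∈ superlevel P α z (passLevel P α z) \ basin P α z (passLevel P α z)) :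
    Tendsto (fun n : ℕ => headRatio P ⌊α * n⌋₊ n z w) atTop (𝓝 0) := by
  obtain ⟨R, hR⟩ := exists_tendsto_headRatio_zero hα hαd z
  have hub := not_isBounded_component hα hαd hz (passLevel_pos hα hαd hz) hw.1 hw.2
  obtain ⟨x, hx, hxR⟩ : ∃ x ∈ connectedComponentIn (superlevel P α z (passLevel P α z)) w,
      R ≤ ‖x‖ := by
    by_contra hc
    push Not at hc
    refine hub (Metric.isBounded_ball.subset (t := Metric.ball 0 R) fun x hx => ?_)
    rw [mem_ball_zero_iff]
    exact hc x hx
  have h1 := tendsto_headRatio_sub_of_mem_component hα hαd hz hx (mem_connectedComponentIn hw.1)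
  simpa using h1.add (hR x hxR)

/-! ### Gaussian averages and the bootstrap -/

theorem integral_exp_neg_mul_sq_le {b ρ : ℝ} (hb : 0 < b) (hρ : 0 ≤ ρ) :
    ∫ x in (-ρ)..ρ, Real.exp (-b * x ^ 2) ≤ Real.sqrt (Real.pi / b) := by
  rw [← integral_gaussian b, intervalIntegral.integral_of_le (by linarith)]
  exact setIntegral_le_integral (integrable_exp_neg_mul_sq hb)
    (Eventually.of_forall fun x => (Real.exp_pos _).le)

theorem integral_exp_neg_quarter_le {n : ℕ} (hn : 0 < n) {ρ : ℝ} (hρ : 0 ≤ ρ) :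
    ∫ x in (-ρ)..ρ, Real.exp (-(n / 4 : ℝ) * x ^ 2) ≤ 4 / Real.sqrt n := by
  have hn' : (0 : ℝ) < n := by exact_mod_cast hn
  refine (integral_exp_neg_mul_sq_le (by positivity) hρ).trans ?_
  rw [show Real.pi / (n / 4 : ℝ) = (4 * Real.pi) / n by field_simp, Real.sqrt_div (by positivity)]
  gcongr
  rw [Real.sqrt_le_left (by norm_num)]
  linarith [Real.pi_le_four]

theorem integral_abs_mul_exp_le {n : ℕ} (hn : 0 < n) {ρ : ℝ} (hρ : 0 ≤ ρ) :
    ∫ x in (-ρ)..ρ, |x| * Real.exp (-(n / 8 : ℝ) * x ^ 2) ≤ 32 / n := by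
  have hn' : (0 : ℝ) < n := by exact_mod_cast hn
  have hs : 0 < Real.sqrt n := Real.sqrt_pos.2 hn'
  have hss : Real.sqrt n * Real.sqrt n = n := Real.mul_self_sqrt hn'.le
  have h1 : ∀ x : ℝ, |x| * Real.exp (-(n / 8 : ℝ) * x ^ 2) ≤
      4 / Real.sqrt n * Real.exp (-(n / 16 : ℝ) * x ^ 2) := by
    intro x
    have h2 : Real.exp (-(n / 8 : ℝ) * x ^ 2) =
        Real.exp (-(n / 16 : ℝ) * x ^ 2) * Real.exp (-(n / 16 : ℝ) * x ^ 2) := by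
      rw [← Real.exp_add]; congr 1; ring
    have h3 : |x| * Real.exp (-(n / 16 : ℝ) * x ^ 2) ≤ 4 / Real.sqrt n := by
      rw [le_div_iff₀ hs, show -(n / 16 : ℝ) * x ^ 2 = -(n / 16 * x ^ 2) by ring, Real.exp_neg,
        mul_assoc, inv_mul_eq_div, mul_div_assoc', div_le_iff₀ (Real.exp_pos _)]
      have h4 := Real.add_one_le_exp (n / 16 * x ^ 2 : ℝ)
      have h5 : (n / 16 * x ^ 2 : ℝ) = (Real.sqrt n * |x|) ^ 2 / 16 := by
        rw [mul_pow, sq_abs, Real.sq_sqrt hn'.le]; ring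
      nlinarith [sq_nonneg (Real.sqrt n * |x| - 2)]
    rw [h2, ← mul_assoc]
    gcongr
  calc _ ≤ ∫ x in (-ρ)..ρ, 4 / Real.sqrt n * Real.exp (-(n / 16 : ℝ) * x ^ 2) :=
        intervalIntegral.integral_mono_on (by linarith)
          (Continuous.intervalIntegrable (by fun_prop) _ _)
          (Continuous.intervalIntegrable (by fun_prop) _ _) fun x _ => h1 x
    _ = 4 / Real.sqrt n * ∫ x in (-ρ)..ρ, Real.exp (-(n / 16 : ℝ) * x ^ 2) :=
        intervalIntegral.integral_const_mul _ _
    _ ≤ 4 / Real.sqrt n * (8 / Real.sqrt n) := by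
        gcongr
        refine (integral_exp_neg_mul_sq_le (by positivity) hρ).trans ?_
        rw [show Real.pi / (n / 16 : ℝ) = (16 * Real.pi) / n by field_simp,
          Real.sqrt_div (by positivity)]
        gcongr
        rw [Real.sqrt_le_left (by norm_num)]
        linarith [Real.pi_le_four]
    _ = 32 / n := by rw [div_mul_div_comm, hss]; norm_num

/-- On the window |x| ≤ 1/√n the integrand is at least 1/e ≥ 0.35. -/
theorem le_integral_exp_neg {n : ℕ} (hn : 0 < n) {ρ : ℝ} (hρ : 1 / Real.sqrt n ≤ ρ) :
    7 / 10 / Real.sqrt n ≤ ∫ x in (-ρ)..ρ, Real.exp (-(n : ℝ) * x ^ 2) := by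
  have hn' : (0 : ℝ) < n := by exact_mod_cast hn
  have hs : 0 < Real.sqrt n := Real.sqrt_pos.2 hn'
  set s := 1 / Real.sqrt n with hsdef
  have hs0 : 0 < s := by positivity
  have hint : ∀ a b : ℝ, IntervalIntegrable (fun x : ℝ => Real.exp (-(n : ℝ) * x ^ 2)) volume a b :=
    fun a b => Continuous.intervalIntegrable (by fun_prop) _ _
  calc 7 / 10 / Real.sqrt n ≤ ∫ x in (-s)..s, Real.exp (-1) := by
        rw [intervalIntegral.integral_const, smul_eq_mul, Real.exp_neg]
        have h1 : (0.35 : ℝ) ≤ (Real.exp 1)⁻¹ := by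
          rw [le_inv_comm₀ (by norm_num) (Real.exp_pos _)]
          refine Real.exp_one_lt_d9.le.trans (by norm_num)
        have h2 : 7 / 10 / Real.sqrt n = (s - -s) * 0.35 := by rw [hsdef]; ring
        rw [h2]
        exact mul_le_mul_of_nonneg_left h1 (by linarith)
    _ ≤ ∫ x in (-s)..s, Real.exp (-(n : ℝ) * x ^ 2) := by
        refine intervalIntegral.integral_mono_on (by linarith) (by simp) (hint _ _) fun x hx => ?_
        rw [Real.exp_le_exp]
        have h3 : x ^ 2 ≤ s ^ 2 := sq_le_sq' hx.1 hx.2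
        have h4 : (n : ℝ) * s ^ 2 = 1 := by
          rw [hsdef, div_pow, Real.sq_sqrt hn'.le]; field_simp
        nlinarith
    _ ≤ _ := by
        refine intervalIntegral.integral_mono_interval (by linarith) (by linarith) (by linarith)
          (Eventually.of_forall fun x => (Real.exp_pos _).le) (hint _ _)

theorem norm_le_two_mul_exp {n : ℕ} {x : ℝ} {E : ℂ}
    (h : ‖E - Real.exp (-(n : ℝ) * x ^ 2)‖ ≤ 1 / 20 * Real.exp (-(n / 4 : ℝ) * x ^ 2)) :
    ‖E‖ ≤ 2 * Real.exp (-(n / 4 : ℝ) * x ^ 2) := by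
  have h1 : ‖E‖ ≤ ‖E - Real.exp (-(n : ℝ) * x ^ 2)‖ + ‖(Real.exp (-(n : ℝ) * x ^ 2) : ℂ)‖ := by
    have := norm_add_le (E - Real.exp (-(n : ℝ) * x ^ 2)) (Real.exp (-(n : ℝ) * x ^ 2) : ℂ)
    rwa [sub_add_cancel] at this
  rw [Complex.norm_real, Real.norm_of_nonneg (Real.exp_pos _).le] at h1
  have h2 : Real.exp (-(n : ℝ) * x ^ 2) ≤ Real.exp (-(n / 4 : ℝ) * x ^ 2) := by
    rw [Real.exp_le_exp]
    have : 0 ≤ (n : ℝ) * x ^ 2 := by positivity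
    nlinarith
  linarith [Real.exp_pos (-(n / 4 : ℝ) * x ^ 2)]

/-- The tolerance 1/20 costs at most 0.2/√n in the integral, out of the Gaussian mass of at least
0.7/√n. -/
theorem le_norm_integral_of_near_gaussian {n : ℕ} (hn : 0 < n) {ρ : ℝ} (hρ : 1 / Real.sqrt n ≤ ρ)
    {E : ℝ → ℂ} (hE : ContinuousOn E (Set.Icc (-ρ) ρ))
    (h : ∀ x ∈ Set.Icc (-ρ) ρ,
      ‖E x - Real.exp (-(n : ℝ) * x ^ 2)‖ ≤ 1 / 20 * Real.exp (-(n / 4 : ℝ) * x ^ 2)) :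
    1 / 2 / Real.sqrt n ≤ ‖∫ x in (-ρ)..ρ, E x‖ ∧ ‖∫ x in (-ρ)..ρ, E x‖ ≤ 8 / Real.sqrt n := by
  have hn' : (0 : ℝ) < n := by exact_mod_cast hn
  have hs : 0 < Real.sqrt n := Real.sqrt_pos.2 hn'
  have hρ0 : 0 ≤ ρ := le_trans (by positivity) hρ
  have hEi : IntervalIntegrable E volume (-ρ) ρ :=
    ContinuousOn.intervalIntegrable (by rwa [Set.uIcc_of_le (by linarith)])
  have hgi : IntervalIntegrable (fun x : ℝ => ((Real.exp (-(n : ℝ) * x ^ 2) : ℝ) : ℂ)) volume (-ρ) ρ :=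
    Continuous.intervalIntegrable (by fun_prop) _ _
  have hq := integral_exp_neg_quarter_le hn hρ0
  have h1 : ‖∫ x in (-ρ)..ρ, (E x - Real.exp (-(n : ℝ) * x ^ 2))‖ ≤ 1 / 20 * (4 / Real.sqrt n) := by
    calc _ ≤ ∫ x in (-ρ)..ρ, 1 / 20 * Real.exp (-(n / 4 : ℝ) * x ^ 2) :=
          intervalIntegral.norm_integral_le_of_norm_le (by linarith)
            (Eventually.of_forall fun x hx => h x (Set.Ioc_subset_Icc_self hx))
            (Continuous.intervalIntegrable (by fun_prop) _ _)
      _ = 1 / 20 * ∫ x in (-ρ)..ρ, Real.exp (-(n / 4 : ℝ) * x ^ 2) :=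
          intervalIntegral.integral_const_mul _ _
      _ ≤ _ := by gcongr
  constructor
  · rw [intervalIntegral.integral_sub hEi hgi, intervalIntegral.integral_ofReal] at h1
    have h2 := le_integral_exp_neg hn hρ
    have h3 : ‖((∫ x in (-ρ)..ρ, Real.exp (-(n : ℝ) * x ^ 2) : ℝ) : ℂ)‖ ≤
        ‖∫ x in (-ρ)..ρ, E x‖ +
        ‖(∫ x in (-ρ)..ρ, E x) - ((∫ x in (-ρ)..ρ, Real.exp (-(n : ℝ) * x ^ 2) : ℝ) : ℂ)‖ := by
      have := norm_sub_le (∫ x in (-ρ)..ρ, E x)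
        ((∫ x in (-ρ)..ρ, E x) - ((∫ x in (-ρ)..ρ, Real.exp (-(n : ℝ) * x ^ 2) : ℝ) : ℂ))
      rwa [sub_sub_cancel] at this
    rw [Complex.norm_real] at h3
    have h4 := h2.trans (Real.le_norm_self _)
    have h5 : 1 / 2 / Real.sqrt n = 7 / 10 / Real.sqrt n - 1 / 20 * (4 / Real.sqrt n) := by
      field_simp; norm_num
    linarith
  · calc _ ≤ ∫ x in (-ρ)..ρ, 2 * Real.exp (-(n / 4 : ℝ) * x ^ 2) :=
          intervalIntegral.norm_integral_le_of_norm_le (by linarith)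
            (Eventually.of_forall fun x hx => norm_le_two_mul_exp (h x (Set.Ioc_subset_Icc_self hx)))
            (Continuous.intervalIntegrable (by fun_prop) _ _)
      _ = 2 * ∫ x in (-ρ)..ρ, Real.exp (-(n / 4 : ℝ) * x ^ 2) :=
          intervalIntegral.integral_const_mul _ _
      _ ≤ 2 * (4 / Real.sqrt n) := by gcongr
      _ = _ := by ring

theorem norm_deriv_le_of_bounded {G : ℂ → ℂ} {w₀ v : ℂ} {r M s : ℝ}
    (hG : DifferentiableOn ℂ G (Metric.ball w₀ r)) (hM : ∀ v ∈ Metric.ball w₀ r, ‖G v‖ ≤ M)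
    (hs : 0 < s) (hv : dist v w₀ + s < r) : ‖deriv G v‖ ≤ M / s := by
  have hsub : Metric.closedBall v s ⊆ Metric.ball w₀ r :=
    fun x hx => lt_of_le_of_lt (dist_triangle x v w₀) (by
      have : dist x v ≤ s := hx
      linarith)
  refine Complex.norm_deriv_le_of_forall_mem_sphere_norm_le hs ?_
    fun x hx => hM x (hsub (Metric.sphere_subset_closedBall hx))
  exact hG.diffContOnCl_ball hsub

/-- For |x| ≤ η, Cauchy's estimate makes G Lipschitz with constant of order M, and the first
absolute moment of the Gaussian supplies 1/n. For |x| > η only the crude bound B is available, and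
half of the Gaussian decay absorbs it. -/
theorem norm_mul_integral_sub_le {G : ℂ → ℂ} {E : ℝ → ℂ} {w₀ w e : ℂ} {r ρ η M B : ℝ} {n : ℕ}
    (hn : 0 < n) (hρ : 0 < ρ) (hη : 0 < η) (hB : 0 ≤ B) (hM : 0 ≤ M)
    (hηr : η * ‖e‖ ≤ r / 4)
    (hG : DifferentiableOn ℂ G (Metric.ball w₀ r)) (hGM : ∀ v ∈ Metric.ball w₀ r, ‖G v‖ ≤ M)
    (hr : 0 < r) (hw : w ∈ Metric.ball w₀ (r / 2))
    (hGc : ContinuousOn (fun x : ℝ => G (w + x * e)) (Set.Icc (-ρ) ρ))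
    (hGB : ∀ x ∈ Set.Icc (-ρ) ρ, ‖G (w + x * e) - G w‖ ≤ B)
    (hBη : B * Real.exp (-(n / 8 : ℝ) * η ^ 2) ≤ M * η)
    (hE : ContinuousOn E (Set.Icc (-ρ) ρ))
    (h : ∀ x ∈ Set.Icc (-ρ) ρ, ‖E x‖ ≤ 2 * Real.exp (-(n / 4 : ℝ) * x ^ 2)) :
    ‖(∫ x in (-ρ)..ρ, G (w + x * e) * E x) - G w * ∫ x in (-ρ)..ρ, E x‖ ≤
      M * (1 + 8 * ‖e‖ / r) * 64 / n := by
  have hn' : (0 : ℝ) < n := by exact_mod_cast hn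
  have hIcc : Set.uIcc (-ρ) ρ = Set.Icc (-ρ) ρ := Set.uIcc_of_le (by linarith)
  have hEi : IntervalIntegrable E volume (-ρ) ρ :=
    ContinuousOn.intervalIntegrable (by rwa [hIcc])
  have hGEi : IntervalIntegrable (fun x : ℝ => G (w + x * e) * E x) volume (-ρ) ρ :=
    ContinuousOn.intervalIntegrable (by rw [hIcc]; exact hGc.mul hE)
  rw [← intervalIntegral.integral_const_mul,
    ← intervalIntegral.integral_sub hGEi (hEi.const_mul _)]
  have hd : ∀ v ∈ Metric.ball w₀ (3 * r / 4), ‖deriv G v‖ ≤ 8 / r * M := by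
    intro v hv
    rw [Metric.mem_ball] at hv
    have := norm_deriv_le_of_bounded hG hGM (v := v) (s := r / 8) (by positivity) (by linarith)
    refine this.trans (le_of_eq ?_)
    field_simp
  have key : ∀ x ∈ Set.Icc (-ρ) ρ, ‖G (w + x * e) * E x - G w * E x‖ ≤
      2 * M * (1 + 8 * ‖e‖ / r) * (|x| * Real.exp (-(n / 8 : ℝ) * x ^ 2)) := by
    intro x hx
    rw [← sub_mul, norm_mul]
    have h8 : Real.exp (-(n / 4 : ℝ) * x ^ 2) =
        Real.exp (-(n / 8 : ℝ) * x ^ 2) * Real.exp (-(n / 8 : ℝ) * x ^ 2) := by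
      rw [← Real.exp_add]; congr 1; ring
    have hle1 : Real.exp (-(n / 8 : ℝ) * x ^ 2) ≤ 1 := by
      rw [Real.exp_le_one_iff]
      have : 0 ≤ (n / 8 : ℝ) * x ^ 2 := by positivity
      linarith
    by_cases hxη : |x| ≤ η
    · have hwb : w ∈ Metric.ball w₀ (3 * r / 4) := by
        rw [Metric.mem_ball] at hw ⊢; linarith
      have hxb : w + x * e ∈ Metric.ball w₀ (3 * r / 4) := by
        rw [Metric.mem_ball] at hw ⊢
        have h1 : dist (w + x * e) w ≤ r / 4 := by
          rw [dist_eq_norm, add_sub_cancel_left, norm_mul, Complex.norm_real, Real.norm_eq_abs]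
          refine le_trans ?_ hηr
          gcongr
        have := dist_triangle (w + x * e) w w₀
        linarith
      have h2 := (convex_ball w₀ (3 * r / 4)).norm_image_sub_le_of_norm_deriv_le
        (fun v hv => hG.differentiableAt (Metric.isOpen_ball.mem_nhds
          (Metric.ball_subset_ball (by linarith) hv))) hd hwb hxb
      rw [add_sub_cancel_left, norm_mul, Complex.norm_real, Real.norm_eq_abs] at h2
      calc ‖G (w + x * e) - G w‖ * ‖E x‖
          ≤ (8 / r * M * (|x| * ‖e‖)) * (2 * Real.exp (-(n / 4 : ℝ) * x ^ 2)) := by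
            gcongr; exact h x hx
        _ ≤ (8 / r * M * (|x| * ‖e‖)) * (2 * (Real.exp (-(n / 8 : ℝ) * x ^ 2) * 1)) := by
            rw [h8]; gcongr
        _ = 2 * M * (8 * ‖e‖ / r) * (|x| * Real.exp (-(n / 8 : ℝ) * x ^ 2)) := by
            field_simp
        _ ≤ _ := by gcongr; linarith
    · rw [not_le] at hxη
      have h3 : Real.exp (-(n / 8 : ℝ) * x ^ 2) ≤ Real.exp (-(n / 8 : ℝ) * η ^ 2) := by
        rw [Real.exp_le_exp]
        have h4 : η ^ 2 ≤ x ^ 2 := by rw [← sq_abs x]; gcongr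
        have : (n / 8 : ℝ) * η ^ 2 ≤ n / 8 * x ^ 2 := by gcongr
        linarith
      calc ‖G (w + x * e) - G w‖ * ‖E x‖
          ≤ B * (2 * Real.exp (-(n / 4 : ℝ) * x ^ 2)) := by
            gcongr
            · exact hGB x hx
            · exact h x hx
        _ = 2 * (B * Real.exp (-(n / 8 : ℝ) * x ^ 2)) * Real.exp (-(n / 8 : ℝ) * x ^ 2) := by
            rw [h8]; ring
        _ ≤ 2 * (B * Real.exp (-(n / 8 : ℝ) * η ^ 2)) * Real.exp (-(n / 8 : ℝ) * x ^ 2) := by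
            gcongr
        _ ≤ 2 * (M * |x|) * Real.exp (-(n / 8 : ℝ) * x ^ 2) := by
            have h9 : M * η ≤ M * |x| := by gcongr
            have h10 := hBη.trans h9
            gcongr 2 * ?_ * _
        _ = 2 * M * 1 * (|x| * Real.exp (-(n / 8 : ℝ) * x ^ 2)) := by ring
        _ ≤ _ := by
            gcongr
            have : 0 ≤ 8 * ‖e‖ / r := by positivity
            linarith
  calc _ ≤ ∫ x in (-ρ)..ρ, 2 * M * (1 + 8 * ‖e‖ / r) * (|x| * Real.exp (-(n / 8 : ℝ) * x ^ 2)) :=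
        intervalIntegral.norm_integral_le_of_norm_le (by linarith)
          (Eventually.of_forall fun x hx => key x (Set.Ioc_subset_Icc_self hx))
          (Continuous.intervalIntegrable (by fun_prop) _ _)
    _ = 2 * M * (1 + 8 * ‖e‖ / r) * ∫ x in (-ρ)..ρ, |x| * Real.exp (-(n / 8 : ℝ) * x ^ 2) :=
        intervalIntegral.integral_const_mul _ _
    _ ≤ 2 * M * (1 + 8 * ‖e‖ / r) * (32 / n) := by
        gcongr
        exact integral_abs_mul_exp_le hn hρ.le
    _ = _ := by ring

theorem exists_norm_mul_integral_sub_le {G : ℕ → ℂ → ℂ} {E : ℕ → ℂ → ℝ → ℂ} {w₀ e a : ℂ}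
    {r₀ r₁ r ρ C K : ℝ} {ε : ℕ → ℝ} {p : ℕ} (hρ : 0 < ρ) (hC : 0 < C)
    (hmaps : ∀ w ∈ Metric.ball w₀ r₁, ∀ x ∈ Set.Icc (-ρ) ρ, w + (x : ℂ) * e ∈ Metric.ball w₀ r₀)
    (hG : ∀ n, DifferentiableOn ℂ (G n) (Metric.ball w₀ r₀))
    (hGb : ∀ᶠ n : ℕ in atTop, ∀ v ∈ Metric.ball w₀ r₀, ‖G n v‖ ≤ C * n ^ 3)
    (hE : ∀ᶠ n : ℕ in atTop, ∀ w ∈ Metric.ball w₀ r₁, ContinuousOn (E n w) (Set.Icc (-ρ) ρ) ∧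
      ∀ x ∈ Set.Icc (-ρ) ρ,
        ‖E n w x - Real.exp (-(n : ℝ) * x ^ 2)‖ ≤ 1 / 20 * Real.exp (-(n / 4 : ℝ) * x ^ 2))
    (hI : ∀ᶠ n : ℕ in atTop, ∀ w ∈ Metric.ball w₀ r₁,
      ‖(∫ x in (-ρ)..ρ, G n (w + x * e) * E n w x) - a‖ ≤ ε n)
    (hr : 0 < r) (hr0 : r ≤ r₀) (hr1 : r ≤ r₁) (hK : 0 < K)
    (hp : ∀ᶠ n : ℕ in atTop, ∀ v ∈ Metric.ball w₀ r, ‖G n v‖ ≤ K * Real.sqrt n ^ p) :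
    ∃ K' > 0, ∀ᶠ n : ℕ in atTop, ∀ w ∈ Metric.ball w₀ (r / 2),
      ‖G n w * (∫ x in (-ρ)..ρ, E n w x) - a‖ ≤ ε n + K' * Real.sqrt n ^ p / n := by
  obtain ⟨η, hη, hηr⟩ : ∃ η > 0, η * ‖e‖ ≤ r / 4 := by
    refine ⟨r / 4 / (‖e‖ + 1), by positivity, ?_⟩
    rw [div_mul_eq_mul_div, div_le_iff₀ (by positivity)]
    gcongr
    linarith
  refine ⟨K * (1 + 8 * ‖e‖ / r) * 64, by positivity, ?_⟩
  have hexp : ∀ᶠ n : ℕ in atTop, 2 * C * ((n : ℝ) ^ 3 * Real.exp (-(η ^ 2 / 8)) ^ n) < K * η := by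
    have := (tendsto_pow_const_mul_const_pow_of_lt_one 3 (Real.exp_pos (-(η ^ 2 / 8))).le
      (by rw [Real.exp_lt_one_iff]; have : 0 < η ^ 2 := by positivity
          linarith)).const_mul (2 * C)
    rw [mul_zero] at this
    exact this.eventually_lt_const (by positivity)
  filter_upwards [hGb, hE, hI, hp, hexp, eventually_gt_atTop 0] with n hGb hE hI hp hexp hn w hw
  have hn1 : (1 : ℝ) ≤ n := by exact_mod_cast hn
  have hw1 : w ∈ Metric.ball w₀ r₁ := Metric.ball_subset_ball (by linarith) hw
  have hw0 : w ∈ Metric.ball w₀ r₀ := Metric.ball_subset_ball (by linarith) hw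
  have hGc : ContinuousOn (fun x : ℝ => G n (w + x * e)) (Set.Icc (-ρ) ρ) :=
    (hG n).continuousOn.comp (by fun_prop) fun x hx => hmaps w hw1 x hx
  have h1 := norm_mul_integral_sub_le hn hρ hη (B := 2 * C * n ^ 3) (by positivity)
    (M := K * Real.sqrt n ^ p) (by positivity) hηr
    ((hG n).mono (Metric.ball_subset_ball hr0)) hp hr hw hGc (fun x hx => by
      refine (norm_sub_le _ _).trans ?_
      have := hGb _ (hmaps w hw1 x hx)
      have := hGb _ hw0
      linarith) (by
      have h2 : Real.exp (-(n / 8 : ℝ) * η ^ 2) = Real.exp (-(η ^ 2 / 8)) ^ n := by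
        rw [← Real.exp_nat_mul]; congr 1; ring
      have h3 : 1 ≤ Real.sqrt n ^ p := one_le_pow₀ (Real.one_le_sqrt.2 hn1)
      rw [h2]
      calc _ = 2 * C * ((n : ℝ) ^ 3 * Real.exp (-(η ^ 2 / 8)) ^ n) := by ring
        _ ≤ K * 1 * η := by linarith
        _ ≤ _ := by gcongr) (hE w hw1).1 (fun x hx => norm_le_two_mul_exp ((hE w hw1).2 x hx))
  have h4 := hI w hw1
  rw [norm_sub_rev] at h1
  calc _ ≤ _ := norm_sub_le_norm_sub_add_norm_sub _ (∫ x in (-ρ)..ρ, G n (w + x * e) * E n w x) _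
    _ ≤ _ := by
      rw [add_comm]
      refine add_le_add h4 (h1.trans (le_of_eq ?_))
      ring

/-- If G_n = O(M) near w₀, then G_n(w) ∫E = a + o(1) + O(M/n), and ∫E has order 1/√n; so G_n = O(√n
+ M/√n) on a smaller ball. Iterating brings the bound down to √n, when the error tends to 0 and a ≠
0 gives a matching lower bound at w₀. Cauchy's estimate then yields G_n'/G_n = O(1). -/
theorem tendsto_logDeriv_of_integral_tendsto {G : ℕ → ℂ → ℂ} {E : ℕ → ℂ → ℝ → ℂ} {w₀ e a : ℂ}
    {r₀ r₁ ρ C : ℝ} {ε : ℕ → ℝ} (hρ : 0 < ρ) (hC : 0 < C) (hr₀ : 0 < r₀) (hr₁ : 0 < r₁)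
    (hmaps : ∀ w ∈ Metric.ball w₀ r₁, ∀ x ∈ Set.Icc (-ρ) ρ, w + (x : ℂ) * e ∈ Metric.ball w₀ r₀)
    (hG : ∀ n, DifferentiableOn ℂ (G n) (Metric.ball w₀ r₀))
    (hGb : ∀ᶠ n : ℕ in atTop, ∀ v ∈ Metric.ball w₀ r₀, ‖G n v‖ ≤ C * n ^ 3)
    (hE : ∀ᶠ n : ℕ in atTop, ∀ w ∈ Metric.ball w₀ r₁, ContinuousOn (E n w) (Set.Icc (-ρ) ρ) ∧
      ∀ x ∈ Set.Icc (-ρ) ρ,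
        ‖E n w x - Real.exp (-(n : ℝ) * x ^ 2)‖ ≤ 1 / 20 * Real.exp (-(n / 4 : ℝ) * x ^ 2))
    (hI : ∀ᶠ n : ℕ in atTop, ∀ w ∈ Metric.ball w₀ r₁,
      ‖(∫ x in (-ρ)..ρ, G n (w + x * e) * E n w x) - a‖ ≤ ε n)
    (hε : Tendsto ε atTop (𝓝 0)) (ha : a ≠ 0) :
    (∀ᶠ n in atTop, G n w₀ ≠ 0) ∧
      Tendsto (fun n : ℕ => deriv (G n) w₀ / (n * G n w₀)) atTop (𝓝 0) := by
  have hsqrt : Tendsto (fun n : ℕ => Real.sqrt n) atTop atTop :=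
    Real.tendsto_sqrt_atTop.comp tendsto_natCast_atTop_atTop
  have hρev : ∀ᶠ n : ℕ in atTop, 1 / Real.sqrt n ≤ ρ := by
    filter_upwards [hsqrt.eventually_ge_atTop (1 / ρ), eventually_gt_atTop 0] with n hn hn0
    have : 0 < Real.sqrt n := Real.sqrt_pos.2 (by exact_mod_cast hn0)
    rwa [div_le_comm₀ this hρ]
  have hsq : ∀ n : ℕ, Real.sqrt n ^ 2 = n := fun n => Real.sq_sqrt (Nat.cast_nonneg n)
  have step : ∀ p : ℕ, (∃ r > 0, r ≤ r₀ ∧ r ≤ r₁ ∧ ∃ K > 0, ∀ᶠ n : ℕ in atTop,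
      ∀ v ∈ Metric.ball w₀ r, ‖G n v‖ ≤ K * Real.sqrt n ^ (p + 2)) →
      ∃ r > 0, r ≤ r₀ ∧ r ≤ r₁ ∧ ∃ K > 0, ∀ᶠ n : ℕ in atTop,
      ∀ v ∈ Metric.ball w₀ r, ‖G n v‖ ≤ K * Real.sqrt n ^ (p + 1) := by
    rintro p ⟨r, hr, hr0, hr1, K, hK, hp⟩
    obtain ⟨K', hK', hS⟩ := exists_norm_mul_integral_sub_le hρ hC hmaps hG hGb hE hI hr hr0 hr1 hK hp
    refine ⟨r / 2, by positivity, by linarith, by linarith, 2 * (‖a‖ + 1 + K'), by positivity, ?_⟩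
    filter_upwards [hS, hE, hρev, eventually_gt_atTop 0, hε.eventually_le_const one_pos]
      with n hS hE hρn hn hεn v hv
    have hn' : (0 : ℝ) < n := by exact_mod_cast hn
    have hs : 0 < Real.sqrt n := Real.sqrt_pos.2 hn'
    have hs1 : 1 ≤ Real.sqrt n := Real.one_le_sqrt.2 (by exact_mod_cast hn)
    obtain ⟨hEc, hEn⟩ := hE v (Metric.ball_subset_ball (by linarith) hv)
    have h1 := (le_norm_integral_of_near_gaussian hn hρn hEc hEn).1
    have h2 := hS v hv
    have h3 : ‖G n v‖ * ‖∫ x in (-ρ)..ρ, E n v x‖ ≤ ‖a‖ + 1 + K' * Real.sqrt n ^ p := by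
      rw [← norm_mul]
      have h4 : ‖G n v * ∫ x in (-ρ)..ρ, E n v x‖ ≤
          ‖(G n v * ∫ x in (-ρ)..ρ, E n v x) - a‖ + ‖a‖ := by
        simpa using norm_add_le ((G n v * ∫ x in (-ρ)..ρ, E n v x) - a) a
      have h5 : K' * Real.sqrt n ^ (p + 2) / n = K' * Real.sqrt n ^ p := by
        rw [pow_add, hsq]; field_simp
      linarith
    have h6 : ‖G n v‖ * (1 / 2 / Real.sqrt n) ≤ ‖a‖ + 1 + K' * Real.sqrt n ^ p :=
      le_trans (by gcongr) h3
    have h7 : ‖a‖ + 1 + K' * Real.sqrt n ^ p ≤ (‖a‖ + 1 + K') * Real.sqrt n ^ p := by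
      have := one_le_pow₀ hs1 (n := p)
      nlinarith [norm_nonneg a]
    calc ‖G n v‖ = ‖G n v‖ * (1 / 2 / Real.sqrt n) * (2 * Real.sqrt n) := by field_simp
      _ ≤ (‖a‖ + 1 + K') * Real.sqrt n ^ p * (2 * Real.sqrt n) := by
        exact mul_le_mul_of_nonneg_right (h6.trans h7) (by positivity)
      _ = _ := by ring
  have h6 : ∃ r > 0, r ≤ r₀ ∧ r ≤ r₁ ∧ ∃ K > 0, ∀ᶠ n : ℕ in atTop,
      ∀ v ∈ Metric.ball w₀ r, ‖G n v‖ ≤ K * Real.sqrt n ^ (4 + 2) := by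
    refine ⟨min r₀ r₁, lt_min hr₀ hr₁, min_le_left _ _, min_le_right _ _, C, hC, ?_⟩
    filter_upwards [hGb] with n hn v hv
    refine (hn v (Metric.ball_subset_ball (min_le_left _ _) hv)).trans (le_of_eq ?_)
    rw [show 4 + 2 = 2 * 3 by norm_num, pow_mul, hsq]
  -- Each step gains one factor √n and halves the ball; five steps take the initial n^3 = (√n)^6
  -- down to √n.
  obtain ⟨r, hr, hr0, hr1, K, hK, hp⟩ := step 0 (step 1 (step 2 (step 3 (step 4 h6))))
  obtain ⟨K', hK', hS⟩ := exists_norm_mul_integral_sub_le hρ hC hmaps hG hGb hE hI hr hr0 hr1 hK hp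
  have ha0 : 0 < ‖a‖ := norm_pos_iff.2 ha
  have herr : Tendsto (fun n : ℕ => ε n + K' / Real.sqrt n) atTop (𝓝 0) := by
    simpa using hε.add (hsqrt.const_div_atTop K')
  have hlow : ∀ᶠ n : ℕ in atTop, ‖a‖ / 16 * Real.sqrt n ≤ ‖G n w₀‖ := by
    filter_upwards [hS, hE, hρev, eventually_gt_atTop 0,
      herr.eventually_le_const (half_pos ha0)] with n hS hE hρn hn hεn
    have hn' : (0 : ℝ) < n := by exact_mod_cast hn
    have hs : 0 < Real.sqrt n := Real.sqrt_pos.2 hn'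
    obtain ⟨hEc, hEn⟩ := hE w₀ (Metric.mem_ball_self hr₁)
    have h1 := (le_norm_integral_of_near_gaussian hn hρn hEc hEn).2
    have h2 := hS w₀ (Metric.mem_ball_self (by positivity))
    have h3 : K' * Real.sqrt n ^ (0 + 1) / n = K' / Real.sqrt n := by
      rw [zero_add, pow_one, div_eq_div_iff hn'.ne' hs.ne', mul_assoc, ← sq, hsq]
    rw [h3] at h2
    have h4 : ‖a‖ ≤ ‖G n w₀ * ∫ x in (-ρ)..ρ, E n w₀ x‖ +
        ‖(G n w₀ * ∫ x in (-ρ)..ρ, E n w₀ x) - a‖ := by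
      have := norm_sub_le (G n w₀ * ∫ x in (-ρ)..ρ, E n w₀ x)
        ((G n w₀ * ∫ x in (-ρ)..ρ, E n w₀ x) - a)
      rwa [sub_sub_cancel] at this
    rw [norm_mul] at h4
    have h5 : ‖G n w₀‖ * ‖∫ x in (-ρ)..ρ, E n w₀ x‖ ≤ ‖G n w₀‖ * (8 / Real.sqrt n) := by gcongr
    have h6 : ‖a‖ / 2 ≤ ‖G n w₀‖ * (8 / Real.sqrt n) := by linarith
    rw [mul_div_assoc', le_div_iff₀ hs] at h6
    linarith
  refine ⟨?_, ?_⟩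
  · filter_upwards [hlow, eventually_gt_atTop 0] with n hn hn0
    have hs : 0 < Real.sqrt n := Real.sqrt_pos.2 (by exact_mod_cast hn0)
    exact norm_pos_iff.1 (lt_of_lt_of_le (by positivity) hn)
  · have hlim : Tendsto (fun n : ℕ => 16 * K / (r / 2) / ‖a‖ / (n : ℝ)) atTop (𝓝 0) :=
      tendsto_const_nhds.div_atTop tendsto_natCast_atTop_atTop
    refine squeeze_zero_norm' ?_ hlim
    filter_upwards [hlow, hp, eventually_gt_atTop 0] with n hn hp hn0
    have hn' : (0 : ℝ) < n := by exact_mod_cast hn0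
    have hs : 0 < Real.sqrt n := Real.sqrt_pos.2 hn'
    have h1 := norm_deriv_le_of_bounded ((hG n).mono (Metric.ball_subset_ball hr0)) hp
      (v := w₀) (s := r / 2) (by positivity) (by rw [dist_self]; linarith)
    rw [norm_div, norm_mul, Complex.norm_natCast]
    calc ‖deriv (G n) w₀‖ / (n * ‖G n w₀‖) ≤
        (K * Real.sqrt n ^ (0 + 1) / (r / 2)) / (n * (‖a‖ / 16 * Real.sqrt n)) := by gcongr
      _ = _ := by rw [zero_add, pow_one]; field_simp

/-! ### Parametrising base points by their saddles -/

/-- The point `z` for which `v` is a critical point of `‖P w‖ / ‖w - z‖ ^ α`. -/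
noncomputable def saddleBase (P : ℂ[X]) (α : ℝ) (v : ℂ) : ℂ :=
  v - α * P.eval v / P.derivative.eval v

/-- The derivative of `saddleBase P α`. -/
noncomputable def saddleBaseDeriv (P : ℂ[X]) (α : ℝ) (v : ℂ) : ℂ :=
  1 - α + α * P.eval v * P.derivative.derivative.eval v / P.derivative.eval v ^ 2

theorem hasDerivAt_saddleBase {P : ℂ[X]} {α : ℝ} {v : ℂ} (hv : P.derivative.eval v ≠ 0) :
    HasDerivAt (saddleBase P α) (saddleBaseDeriv P α v) v := by
  have h := (hasDerivAt_id v).sub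
    ((((P.hasDerivAt v).const_mul (α : ℂ))).div (P.derivative.hasDerivAt v) hv)
  refine h.congr_deriv ?_
  unfold saddleBaseDeriv
  field_simp
  ring

theorem sub_saddleBase (P : ℂ[X]) (α : ℝ) (v : ℂ) :
    v - saddleBase P α v = α * P.eval v / P.derivative.eval v := by
  unfold saddleBase; ring

theorem sub_saddleBase_ne_zero {P : ℂ[X]} {α : ℝ} (hα : 0 < α) {v : ℂ} (hv : P.eval v ≠ 0)
    (hv' : P.derivative.eval v ≠ 0) : v - saddleBase P α v ≠ 0 := by
  rw [sub_saddleBase]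
  exact div_ne_zero (mul_ne_zero (by exact_mod_cast hα.ne') hv) hv'

theorem eval_derivative_div_eq {P : ℂ[X]} {α : ℝ} (hα : 0 < α) {v : ℂ} (hv : P.eval v ≠ 0)
    (hv' : P.derivative.eval v ≠ 0) :
    P.derivative.eval v / P.eval v = α / (v - saddleBase P α v) := by
  have : (α : ℂ) ≠ 0 := by exact_mod_cast hα.ne'
  rw [sub_saddleBase]
  field_simp

theorem derivative_ne_zero_of_critical {P : ℂ[X]} {α : ℝ} (hα : 0 < α) {z w : ℂ}
    (h : (criticalPoly P α z).eval w = 0) (hw : P.eval w ≠ 0) : P.derivative.eval w ≠ 0 := by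
  intro h0
  rw [eval_criticalPoly, h0, mul_zero, zero_sub, neg_eq_zero, mul_eq_zero] at h
  rcases h with h | h
  · exact hα.ne' (by exact_mod_cast h)
  · exact hw h

theorem saddleBase_eq_of_critical {P : ℂ[X]} {α : ℝ} {z w : ℂ}
    (h : (criticalPoly P α z).eval w = 0) (hw : P.derivative.eval w ≠ 0) :
    saddleBase P α w = z := by
  rw [eval_criticalPoly] at h
  have h1 : α * P.eval w / P.derivative.eval w = w - z := by
    rw [div_eq_iff hw]; linear_combination -h
  rw [saddleBase, h1]; ring

theorem hasStrictDerivAt_saddleBase {P : ℂ[X]} {α : ℝ} {v : ℂ} (hv : P.derivative.eval v ≠ 0) :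
    HasStrictDerivAt (saddleBase P α) (saddleBaseDeriv P α v) v := by
  have h : AnalyticAt ℂ (saddleBase P α) v := by
    rw [Complex.analyticAt_iff_eventually_differentiableAt]
    filter_upwards [P.derivative.continuous.continuousAt.eventually_ne hv] with x hx
    exact (hasDerivAt_saddleBase hx).differentiableAt
  have := h.hasStrictDerivAt
  rwa [(hasDerivAt_saddleBase hv).deriv] at this

/-- Stability of the pass: passes of nearby z stay in a fixed disc and satisfy two equations
continuous in (z, w), which at z₀ have only the solution w₀. Compactness excludes solutions away
from w₀. -/
theorem eventually_pass_mem {P : ℂ[X]} {α : ℝ} (hα : 0 < α) (hαd : α < (P.natDegree : ℝ))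
    {z₀ w₀ : ℂ} (hz₀ : P.eval z₀ ≠ 0)
    (huniq : ∀ w, (criticalPoly P α z₀).eval w = 0 →
      ‖P.eval w‖ = passLevel P α z₀ * ‖w - z₀‖ ^ α → w = w₀) {V : Set ℂ} (hV : V ∈ 𝓝 w₀) :
    ∀ᶠ z in 𝓝 z₀, ∃ w ∈ V, (criticalPoly P α z).eval w = 0 ∧
      ‖P.eval w‖ = passLevel P α z * ‖w - z‖ ^ α := by
  obtain ⟨r, hr, L, hL, hpass, -, -⟩ := exists_passLevel_le_mul hα hαd hz₀
  obtain ⟨R, hR, hfar⟩ := exists_mem_superlevel_of_norm_ge hα hαd (‖z₀‖ + r) L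
  have hK : IsCompact (Metric.closedBall (0 : ℂ) R \ interior V) :=
    (isCompact_closedBall 0 R).diff isOpen_interior
  have hcomp : ∀ᶠ z in 𝓝 z₀, ∀ w ∈ Metric.closedBall (0 : ℂ) R \ interior V,
      ¬ ((criticalPoly P α z).eval w = 0 ∧ ‖P.eval w‖ = passLevel P α z * ‖w - z‖ ^ α) := by
    refine hK.eventually_forall_of_forall_eventually fun w hw => ?_
    have hpl : ContinuousAt (fun p : ℂ × ℂ => passLevel P α p.1) (z₀, w) :=
      ContinuousAt.comp (g := passLevel P α) (f := Prod.fst) (x := (z₀, w))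
        (continuousAt_passLevel hα hαd hz₀) continuousAt_fst
    have c1 : ContinuousAt (fun p : ℂ × ℂ => (p.2 - p.1) * P.derivative.eval p.2 - α * P.eval p.2)
        (z₀, w) := by
      have := P.continuous
      have := P.derivative.continuous
      fun_prop
    have c2 : ContinuousAt (fun p : ℂ × ℂ => ‖P.eval p.2‖ - passLevel P α p.1 * ‖p.2 - p.1‖ ^ α)
        (z₀, w) := by
      refine ContinuousAt.sub ?_ (hpl.mul ?_)
      · exact (P.continuous.comp continuous_snd).norm.continuousAt
      · exact (continuousAt_snd.sub continuousAt_fst).norm.rpow_const (Or.inr hα.le)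
    by_cases h1 : (criticalPoly P α z₀).eval w = 0
    · have h2 : ‖P.eval w‖ - passLevel P α z₀ * ‖w - z₀‖ ^ α ≠ 0 := by
        intro h
        have := huniq w h1 (sub_eq_zero.1 h)
        subst this
        exact hw.2 (mem_interior_iff_mem_nhds.2 hV)
      filter_upwards [c2.eventually_ne h2] with p hp hc
      exact hp (sub_eq_zero.2 hc.2)
    · rw [eval_criticalPoly] at h1
      filter_upwards [c1.eventually_ne h1] with p hp hc
      rw [eval_criticalPoly] at hc
      exact hp hc.1
  filter_upwards [hcomp, Metric.closedBall_mem_nhds z₀ hr] with z hz hzr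
  obtain ⟨hPz, hlL⟩ := hpass z hzr
  obtain ⟨w, hw1, hw2, hw3⟩ := exists_mem_closure_basin_inter hα hαd hPz
  have hcrit := criticalPoly_eval_eq_zero_of_mem_closure hα hPz (passLevel_pos hα hαd hPz) hw1 hw2 hw3
  refine ⟨w, ?_, hcrit, hw3⟩
  by_contra hwV
  have hzn : ‖z‖ ≤ ‖z₀‖ + r := by
    have h1 : ‖z - z₀‖ ≤ r := by rw [← dist_eq_norm]; exact hzr
    have h2 : ‖z‖ ≤ ‖z - z₀‖ + ‖z₀‖ := by simpa using norm_add_le (z - z₀) z₀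
    linarith
  have hAR : basin P α z (passLevel P α z) ⊆ Metric.ball 0 R := basin_subset_ball_of_isBounded hR
    (fun w hw => hfar z hzn _ hlL w hw) (isBounded_basin_passLevel hα hαd hPz)
  refine hz w ⟨?_, fun h => hwV (interior_subset h)⟩ ⟨hcrit, hw3⟩
  exact closure_minimal (hAR.trans Metric.ball_subset_closedBall) Metric.isClosed_closedBall hw1

/-- Nondegeneracy makes v ↦ ξ(v) injective near w₀, so the pass for ξ(v), which is a critical point
near w₀, must be v itself. -/
theorem eventually_passLevel_saddleBase {P : ℂ[X]} {α : ℝ} (hα : 0 < α)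
    (hαd : α < (P.natDegree : ℝ)) {z₀ w₀ : ℂ} (hz₀ : P.eval z₀ ≠ 0) (hw₀ : P.eval w₀ ≠ 0)
    (hcrit : (criticalPoly P α z₀).eval w₀ = 0) (hnd : saddleBaseDeriv P α w₀ ≠ 0)
    (huniq : ∀ w, (criticalPoly P α z₀).eval w = 0 →
      ‖P.eval w‖ = passLevel P α z₀ * ‖w - z₀‖ ^ α → w = w₀) :
    ∀ᶠ v in 𝓝 w₀,
      passLevel P α (saddleBase P α v) = ‖P.eval v‖ / ‖v - saddleBase P α v‖ ^ α := by
  have hd := derivative_ne_zero_of_critical hα hcrit hw₀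
  have hbase := saddleBase_eq_of_critical hcrit hd
  set e := ((hasStrictDerivAt_saddleBase (α := α) hd).hasStrictFDerivAt_equiv hnd
    ).toOpenPartialHomeomorph (saddleBase P α) with he
  have hmem : w₀ ∈ e.source := ((hasStrictDerivAt_saddleBase (α := α) hd).hasStrictFDerivAt_equiv hnd
    ).mem_toOpenPartialHomeomorph_source
  have hV : e.source ∩ {w | P.derivative.eval w ≠ 0} ∈ 𝓝 w₀ :=
    inter_mem (e.open_source.mem_nhds hmem) (P.derivative.continuous.continuousAt.eventually_ne hd)
  have hcont : Tendsto (saddleBase P α) (𝓝 w₀) (𝓝 z₀) := by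
    have := (hasDerivAt_saddleBase (α := α) hd).continuousAt.tendsto
    rwa [hbase] at this
  filter_upwards [hcont.eventually (eventually_pass_mem hα hαd hz₀ huniq hV), hV,
    P.continuous.continuousAt.eventually_ne hw₀] with v hv hvV hPv
  obtain ⟨w, ⟨hws, hwd⟩, hwc, hwl⟩ := hv
  have h1 : saddleBase P α w = saddleBase P α v := saddleBase_eq_of_critical hwc hwd
  have h2 : w = v := e.injOn hws hvV.1 h1
  subst h2
  rw [hwl, mul_div_assoc, div_self, mul_one]
  exact (Real.rpow_pos_of_pos (norm_pos_iff.2 (sub_saddleBase_ne_zero hα hPv hwd)) _).ne'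

/-! ### The phase near the saddle and the Gaussian kernel -/

/-- Second-order Taylor expansion uniform in the centre v: the first derivative of the branch
vanishes at w = v because v is critical for ξ(v), and the second is jointly continuous with value 2q
at (w₀, w₀). The mean value inequality is applied twice. -/
theorem exists_phase_estimate {P : ℂ[X]} {α : ℝ} (hα : 0 < α) {w₀ : ℂ} (hw₀ : P.eval w₀ ≠ 0)
    (hd₀ : P.derivative.eval w₀ ≠ 0) (hnd : saddleBaseDeriv P α w₀ ≠ 0) {ε : ℝ} (hε : 0 < ε) :
    ∃ δ > 0, ∀ v ∈ Metric.ball w₀ δ, ∀ w ∈ Metric.ball w₀ δ,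
      P.eval w ≠ 0 ∧ P.derivative.eval w ≠ 0 ∧ w ≠ saddleBase P α v ∧
      saddleBaseDeriv P α w ≠ 0 ∧
      ‖logBranch P α (saddleBase P α v) v w - P.derivative.eval w₀ ^ 2 * saddleBaseDeriv P α w₀ /
        (2 * α * P.eval w₀ ^ 2) * (w - v) ^ 2‖ ≤ ε * ‖w - v‖ ^ 2 ∧
      ‖Complex.log ((w - saddleBase P α v) / (v - saddleBase P α v))‖ ≤ ε ∧
      ‖Complex.log (saddleBaseDeriv P α w / saddleBaseDeriv P α w₀)‖ ≤ ε := by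
  have hαc : (α : ℂ) ≠ 0 := by exact_mod_cast hα.ne'
  set ξ := saddleBase P α with hξ
  set D := saddleBaseDeriv P α with hD
  set q := P.derivative.eval w₀ ^ 2 * D w₀ / (2 * α * P.eval w₀ ^ 2) with hq
  have cξ : ContinuousAt ξ w₀ := (hasDerivAt_saddleBase hd₀).continuousAt
  have cD : ContinuousAt D w₀ := by
    rw [hD]
    unfold saddleBaseDeriv
    exact continuousAt_const.add (((continuous_const.mul P.continuous).mul
      P.derivative.derivative.continuous).continuousAt.div
        (P.derivative.continuous.pow 2).continuousAt (pow_ne_zero _ hd₀))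
  have cξ1 : ContinuousAt (fun p : ℂ × ℂ => ξ p.1) (w₀, w₀) :=
    ContinuousAt.comp (g := ξ) (f := Prod.fst) (x := (w₀, w₀)) cξ continuousAt_fst
  have hne₀ : w₀ - ξ w₀ ≠ 0 := sub_saddleBase_ne_zero hα hw₀ hd₀
  have cP2 : ContinuousAt (fun p : ℂ × ℂ => P.eval p.2) (w₀, w₀) :=
    (P.continuous.comp continuous_snd).continuousAt
  have cP1 : ContinuousAt (fun p : ℂ × ℂ => P.eval p.1) (w₀, w₀) :=
    (P.continuous.comp continuous_fst).continuousAt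
  have cP' : ContinuousAt (fun p : ℂ × ℂ => P.derivative.eval p.2) (w₀, w₀) :=
    (P.derivative.continuous.comp continuous_snd).continuousAt
  have cP'' : ContinuousAt (fun p : ℂ × ℂ => P.derivative.derivative.eval p.2) (w₀, w₀) :=
    (P.derivative.derivative.continuous.comp continuous_snd).continuousAt
  have cw : ContinuousAt (fun p : ℂ × ℂ => p.2 - ξ p.1) (w₀, w₀) := continuousAt_snd.sub cξ1
  have cv : ContinuousAt (fun p : ℂ × ℂ => p.1 - ξ p.1) (w₀, w₀) := continuousAt_fst.sub cξ1
  have cratio : ContinuousAt (fun p : ℂ × ℂ => (p.2 - ξ p.1) / (p.1 - ξ p.1)) (w₀, w₀) :=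
    cw.div cv hne₀
  have cPratio : ContinuousAt (fun p : ℂ × ℂ => P.eval p.2 / P.eval p.1) (w₀, w₀) :=
    cP2.div cP1 hw₀
  have cDratio : ContinuousAt (fun w : ℂ => D w / D w₀) w₀ := cD.div_const _
  set H : ℂ × ℂ → ℂ := fun p => (P.derivative.derivative.eval p.2 * P.eval p.2 -
    P.derivative.eval p.2 * P.derivative.eval p.2) / P.eval p.2 ^ 2 + α / (p.2 - ξ p.1) ^ 2 with hH
  have cH : ContinuousAt H (w₀, w₀) :=
    (((cP''.mul cP2).sub (cP'.mul cP')).div (cP2.pow 2) (pow_ne_zero _ hw₀)).add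
      (continuousAt_const.div (cw.pow 2) (pow_ne_zero _ hne₀))
  have hH0 : H (w₀, w₀) = 2 * q := by
    simp only [hH, hq, hξ, hD, sub_saddleBase, saddleBaseDeriv]
    field_simp
    ring
  have clog1 : ContinuousAt (fun p : ℂ × ℂ => ‖Complex.log ((p.2 - ξ p.1) / (p.1 - ξ p.1))‖)
      (w₀, w₀) := (cratio.clog (by simp [hne₀])).norm
  have clogD : ContinuousAt (fun w : ℂ => ‖Complex.log (D w / D w₀)‖) w₀ :=
    (cDratio.clog (by simp [hnd])).norm
  have e1 : ∀ᶠ p : ℂ × ℂ in 𝓝 (w₀, w₀), P.eval p.2 / P.eval p.1 ∈ Complex.slitPlane :=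
    cPratio.eventually_mem (Complex.isOpen_slitPlane.mem_nhds (by simp [hw₀]))
  have e2 : ∀ᶠ p : ℂ × ℂ in 𝓝 (w₀, w₀),
      (p.2 - ξ p.1) / (p.1 - ξ p.1) ∈ Complex.slitPlane :=
    cratio.eventually_mem (Complex.isOpen_slitPlane.mem_nhds (by simp [hne₀]))
  have e3 : ∀ᶠ p : ℂ × ℂ in 𝓝 (w₀, w₀), ‖H p - 2 * q‖ ≤ ε := by
    have := (cH.sub_const (2 * q)).norm
    exact this.eventually_le_const (by simpa [hH0] using hε)
  have e4 : ∀ᶠ p : ℂ × ℂ in 𝓝 (w₀, w₀),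
      ‖Complex.log ((p.2 - ξ p.1) / (p.1 - ξ p.1))‖ ≤ ε :=
    clog1.eventually_le_const (by simpa [hne₀] using hε)
  have e5 : ∀ᶠ w : ℂ in 𝓝 w₀, ‖Complex.log (D w / D w₀)‖ ≤ ε :=
    clogD.eventually_le_const (by simpa [hnd] using hε)
  obtain ⟨δ₁, hδ₁, hb₁⟩ := Metric.eventually_nhds_iff.1
    ((e1.and (e2.and (e3.and e4))).and (cP1.eventually_ne hw₀))
  obtain ⟨δ₂, hδ₂, hb₂⟩ := Metric.eventually_nhds_iff.1 ((e5.and (cD.eventually_ne hnd)).and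
    ((P.continuous.continuousAt.eventually_ne hw₀).and
      (P.derivative.continuous.continuousAt.eventually_ne hd₀)))
  refine ⟨min δ₁ δ₂, lt_min hδ₁ hδ₂, fun v hv w hw => ?_⟩
  have hB : ∀ x ∈ Metric.ball w₀ (min δ₁ δ₂), P.eval x / P.eval v ∈ Complex.slitPlane ∧
      (x - ξ v) / (v - ξ v) ∈ Complex.slitPlane ∧ ‖H (v, x) - 2 * q‖ ≤ ε ∧
      ‖Complex.log ((x - ξ v) / (v - ξ v))‖ ≤ ε := by
    intro x hx
    refine (hb₁ (y := (v, x)) ?_).1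
    rw [Prod.dist_eq]
    exact max_lt (lt_of_lt_of_le hv (min_le_left _ _)) (lt_of_lt_of_le hx (min_le_left _ _))
  have hB' : ∀ x ∈ Metric.ball w₀ (min δ₁ δ₂), (‖Complex.log (D x / D w₀)‖ ≤ ε ∧ D x ≠ 0) ∧
      P.eval x ≠ 0 ∧ P.derivative.eval x ≠ 0 :=
    fun x hx => hb₂ (lt_of_lt_of_le hx (min_le_right _ _))
  obtain ⟨⟨-, -⟩, hPv, hP'v⟩ := hB' v hv
  have hvξ : v - ξ v ≠ 0 := sub_saddleBase_ne_zero hα hPv hP'v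
  have hxξ : ∀ x ∈ Metric.ball w₀ (min δ₁ δ₂), x - ξ v ≠ 0 := by
    intro x hx h
    have := (hB x hx).2.1
    rw [h, zero_div] at this
    exact Complex.slitPlane_ne_zero this rfl
  refine ⟨(hB' w hw).2.1, (hB' w hw).2.2, sub_ne_zero.1 (hxξ w hw), (hB' w hw).1.2, ?_,
    (hB w hw).2.2.2, (hB' w hw).1.1⟩
  have hfirst : ∀ x ∈ Metric.ball w₀ (min δ₁ δ₂),
      ‖(P.derivative.eval x / P.eval x - α / (x - ξ v)) - 2 * q * (x - v)‖ ≤ ε * ‖x - v‖ := by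
    intro x hx
    have hder : ∀ y ∈ Metric.ball w₀ (min δ₁ δ₂), HasDerivWithinAt
        (fun y => (P.derivative.eval y / P.eval y - α / (y - ξ v)) - 2 * q * (y - v))
        (H (v, y) - 2 * q) (Metric.ball w₀ (min δ₁ δ₂)) y := by
      intro y hy
      have h1 := (P.derivative.hasDerivAt y).div (P.hasDerivAt y) (hB' y hy).2.1
      have h2 := (hasDerivAt_const y (α : ℂ)).div ((hasDerivAt_id y).sub_const (ξ v)) (hxξ y hy)
      have h3 := ((hasDerivAt_id y).sub_const v).const_mul (2 * q)
      refine (((h1.sub h2).sub h3).congr_deriv ?_).hasDerivWithinAt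
      simp only [hH, id]
      ring
    have := (convex_ball w₀ (min δ₁ δ₂)).norm_image_sub_le_of_norm_hasDerivWithin_le hder
      (fun y hy => (hB y hy).2.2.1) hv hx
    rw [eval_derivative_div_eq hα hPv hP'v, ← hξ] at this
    simpa using this
  have hsecond := ((convex_ball w₀ (min δ₁ δ₂)).inter
    (convex_closedBall v ‖w - v‖)).norm_image_sub_le_of_norm_hasDerivWithin_le
      (f := fun x => logBranch P α (ξ v) v x - q * (x - v) ^ 2)
      (f' := fun x => (P.derivative.eval x / P.eval x - α / (x - ξ v)) - 2 * q * (x - v))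
      (C := ε * ‖w - v‖) (x := v) (y := w)
      (fun x hx => by
        have h1 := hasDerivAt_logBranch (α := α) hPv (sub_ne_zero.1 hvξ) (hB x hx.1).1 (hB x hx.1).2.1
        have h2 := (((hasDerivAt_id x).sub_const v).pow 2).const_mul q
        refine ((h1.sub h2).congr_deriv ?_).hasDerivWithinAt
        simp only [id]
        push_cast
        ring)
      (fun x hx => (hfirst x hx.1).trans (by
        gcongr
        rw [← dist_eq_norm]; exact hx.2))
      ⟨hv, Metric.mem_closedBall_self (norm_nonneg _)⟩ ⟨hw, by
        rw [Metric.mem_closedBall, dist_eq_norm]⟩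
  rw [logBranch_self hPv (sub_ne_zero.1 hvξ)] at hsecond
  simp only [sub_self, ne_eq, OfNat.ofNat_ne_zero, not_false_eq_true, zero_pow, mul_zero,
    sub_zero] at hsecond
  refine hsecond.trans (le_of_eq ?_)
  ring

theorem norm_exp_mul_sub_le {y ε : ℝ} {u : ℂ} (hy : 0 ≤ y) (hε : ε = 1 / 200)
    (hu : ‖u‖ ≤ ε * (y + 3)) :
    ‖(Real.exp (-y) : ℂ) * Complex.exp u - Real.exp (-y)‖ ≤ 1 / 20 * Real.exp (-(y / 4)) := by
  have h1 : ‖Complex.exp u - 1‖ ≤ ‖u‖ * Real.exp ‖u‖ := by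
    simpa using Complex.norm_exp_sub_sum_le_norm_mul_exp u 1
  rw [show (Real.exp (-y) : ℂ) * Complex.exp u - Real.exp (-y) =
    (Real.exp (-y) : ℂ) * (Complex.exp u - 1) by ring, norm_mul, Complex.norm_real,
    Real.norm_of_nonneg (Real.exp_pos _).le]
  have h2 : Real.exp ‖u‖ ≤ Real.exp (y / 4) * 2 := by
    have h3 : Real.exp ‖u‖ ≤ Real.exp (y / 4) * Real.exp (3 * ε) := by
      rw [← Real.exp_add, Real.exp_le_exp]; rw [hε] at hu ⊢; linarith
    refine h3.trans ?_
    gcongr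
    have h4 : Real.exp (3 * ε) ≤ Real.exp (1 / 2) := by
      rw [Real.exp_le_exp, hε]; norm_num
    have h5 : Real.exp (1 / 2) ^ 2 ≤ 2 ^ 2 := by
      rw [← Real.exp_nat_mul]
      norm_num
      linarith [Real.exp_one_lt_d9]
    exact h4.trans (le_of_sq_le_sq h5 (by norm_num))
  have h6 : ‖u‖ ≤ ε * (3 * Real.exp (y / 2)) := by
    refine hu.trans ?_
    have := Real.add_one_le_exp (y / 2)
    rw [hε]; linarith
  calc Real.exp (-y) * ‖Complex.exp u - 1‖
      ≤ Real.exp (-y) * ((ε * (3 * Real.exp (y / 2))) * (Real.exp (y / 4) * 2)) := by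
        gcongr
        refine h1.trans ?_
        gcongr
    _ = 6 * ε * (Real.exp (-y) * Real.exp (y / 2) * Real.exp (y / 4)) := by ring
    _ = 6 * ε * Real.exp (-(y / 4)) := by
        rw [← Real.exp_add, ← Real.exp_add]; congr 2; ring
    _ ≤ _ := by
        gcongr
        rw [hε]; norm_num

/-- The kernel that relates the `z`-derivative of `headRatio` at the bases of `v` for the points
`w` and `v`. -/
noncomputable def saddleKernel (P : ℂ[X]) (α : ℝ) (w₀ : ℂ) (m n : ℕ) (v w : ℂ) : ℂ :=
  saddleBaseDeriv P α v / saddleBaseDeriv P α w₀ *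
    ((w - saddleBase P α v) / (v - saddleBase P α v)) ^ (m - 1) * (P.eval v / P.eval w) ^ n

/-- The kernel is exp(-n L) with L the logarithmic branch, up to the ratio of derivatives of ξ and a
power m - 1 - αn of (w - ξ)/(v - ξ). That exponent is at most 2 in modulus, so these corrections add
at most 3/200 to the exponent. -/
theorem norm_saddleKernel_sub_le {P : ℂ[X]} {α : ℝ} {w₀ v w : ℂ} {m n : ℕ} {x : ℝ} (hm : 0 < m)
    (hm1 : (m : ℝ) ≤ α * n) (hm2 : α * n < m + 1) (hPv : P.eval v ≠ 0) (hPw : P.eval w ≠ 0)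
    (hv : v ≠ saddleBase P α v) (hw : w ≠ saddleBase P α v)
    (hD₀ : saddleBaseDeriv P α w₀ ≠ 0) (hD : saddleBaseDeriv P α v ≠ 0)
    (hL : ‖logBranch P α (saddleBase P α v) v w - (x : ℂ) ^ 2‖ ≤ 1 / 200 * x ^ 2)
    (hr : ‖Complex.log ((w - saddleBase P α v) / (v - saddleBase P α v))‖ ≤ 1 / 200)
    (hDl : ‖Complex.log (saddleBaseDeriv P α v / saddleBaseDeriv P α w₀)‖ ≤ 1 / 200) :
    ‖saddleKernel P α w₀ m n v w - Real.exp (-(n : ℝ) * x ^ 2)‖ ≤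
      1 / 20 * Real.exp (-(n / 4 : ℝ) * x ^ 2) := by
  set ρ := (w - saddleBase P α v) / (v - saddleBase P α v) with hρ
  set D := saddleBaseDeriv P α v / saddleBaseDeriv P α w₀ with hDdef
  have hρ0 : ρ ≠ 0 := div_ne_zero (sub_ne_zero.2 hw) (sub_ne_zero.2 hv)
  have hD0 : D ≠ 0 := div_ne_zero hD hD₀
  set u : ℂ := -n * (logBranch P α (saddleBase P α v) v w - (x : ℂ) ^ 2) +
    ((m : ℂ) - 1 - α * n) * Complex.log ρ + Complex.log D with hu
  have h1 : saddleKernel P α w₀ m n v w = (Real.exp (-(n * x ^ 2)) : ℂ) * Complex.exp u := by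
    have e1 : ρ ^ (m - 1) = Complex.exp (((m : ℂ) - 1) * Complex.log ρ) := by
      have : ((m : ℂ) - 1) = ((m - 1 : ℕ) : ℂ) := by rw [Nat.cast_sub hm]; simp
      rw [this, Complex.exp_nat_mul, Complex.exp_log hρ0]
    have e2 : (P.eval v / P.eval w) ^ n =
        Complex.exp (-(n * Complex.log (P.eval w / P.eval v))) := by
      rw [Complex.exp_neg, Complex.exp_nat_mul, Complex.exp_log (div_ne_zero hPw hPv), ← inv_pow,
        inv_div]
    rw [saddleKernel, ← hρ, ← hDdef, e1, e2, ← Complex.exp_log hD0, ← Complex.exp_add,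
      ← Complex.exp_add, Complex.ofReal_exp, ← Complex.exp_add, hu, logBranch, ← hρ]
    congr 1
    push_cast
    ring
  have h2 : ‖u‖ ≤ 1 / 200 * (n * x ^ 2 + 3) := by
    have h3 : ‖(-n : ℂ) * (logBranch P α (saddleBase P α v) v w - (x : ℂ) ^ 2)‖ ≤
        n * (1 / 200 * x ^ 2) := by
      rw [norm_mul, norm_neg, Complex.norm_natCast]; gcongr
    have h4 : ‖((m : ℂ) - 1 - α * n) * Complex.log ρ‖ ≤ 2 * (1 / 200) := by
      rw [norm_mul]
      gcongr
      rw [show ((m : ℂ) - 1 - α * n) = ((m - 1 - α * n : ℝ) : ℂ) by push_cast; ring,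
        Complex.norm_real, Real.norm_eq_abs, abs_le]
      constructor <;> linarith
    have h5 := norm_add₃_le (a := (-n : ℂ) * (logBranch P α (saddleBase P α v) v w - (x : ℂ) ^ 2))
      (b := ((m : ℂ) - 1 - α * n) * Complex.log ρ) (c := Complex.log D)
    rw [hu]
    linarith
  have h6 := norm_exp_mul_sub_le (y := n * x ^ 2) (by positivity) rfl h2
  rw [← h1] at h6
  rw [show -(n : ℝ) * x ^ 2 = -(n * x ^ 2) by ring,
    show -(n / 4 : ℝ) * x ^ 2 = -(n * x ^ 2 / 4) by ring]
  exact h6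

/-! ### The jump across the saddle and the limit of the coefficient ratio -/

/-- The limit is known at the pair (v, w) = (w₀, w₀ - b) but needed near (w₀ + b, w₀). Sliding v and
w together keeps w = v - b in the superlevel set of ξ(v), so the local constancy of the head ratio
in both variables carries the limit along. -/
theorem exists_norm_headRatio_translate_sub_le {P : ℂ[X]} {α : ℝ} (hα : 0 < α)
    (hαd : α < (P.natDegree : ℝ)) {w₀ b : ℂ} {δ : ℝ} (hb : ‖b‖ < δ)
    (hd : ∀ v ∈ Metric.ball w₀ δ, P.derivative.eval v ≠ 0)
    (hpass : ∀ v ∈ Metric.ball w₀ δ, P.eval (saddleBase P α v) ≠ 0)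
    (hsup : ∀ v ∈ Metric.ball w₀ δ, v - b ∈ Metric.ball w₀ δ →
      v - b ∈ superlevel P α (saddleBase P α v) (passLevel P α (saddleBase P α v))) {c : ℂ}
    (hc : Tendsto (fun n : ℕ => headRatio P ⌊α * n⌋₊ n (saddleBase P α w₀) (w₀ - b)) atTop (𝓝 c)) :
    ∃ r > 0, ∃ ε : ℕ → ℝ, Tendsto ε atTop (𝓝 0) ∧ ∀ᶠ n : ℕ in atTop, ∀ w ∈ Metric.ball w₀ r,
      ‖headRatio P ⌊α * n⌋₊ n (saddleBase P α (w + b)) w - c‖ ≤ ε n := by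
  have hball : ∀ t ∈ Set.Icc (0 : ℝ) 1, w₀ + t * b ∈ Metric.ball w₀ δ ∧
      w₀ + t * b - b ∈ Metric.ball w₀ δ := by
    intro t ht
    constructor
    · rw [mem_ball_iff_norm, add_sub_cancel_left, norm_mul, Complex.norm_real,
        Real.norm_of_nonneg ht.1]
      nlinarith [norm_nonneg b, ht.2]
    · rw [mem_ball_iff_norm, show w₀ + t * b - b - w₀ = -((1 - t : ℝ) * b) by push_cast; ring,
        norm_neg, norm_mul, Complex.norm_real, Real.norm_of_nonneg (by linarith [ht.2])]
      nlinarith [norm_nonneg b, ht.1]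
  have hloc : ∀ t ∈ Set.Icc (0 : ℝ) 1, ∃ r > 0, ∃ ε : ℕ → ℝ, Tendsto ε atTop (𝓝 0) ∧
      ∀ᶠ n : ℕ in atTop, ∀ y ∈ Metric.ball (w₀ + t * b) r,
        ‖headRatio P ⌊α * n⌋₊ n (saddleBase P α y) (y - b) -
          headRatio P ⌊α * n⌋₊ n (saddleBase P α (w₀ + t * b)) (w₀ + t * b - b)‖ ≤ ε n := by
    intro t ht
    obtain ⟨h1, h2⟩ := hball t ht
    obtain ⟨r, hr, ε, hε, hev⟩ := exists_norm_headRatio_sub_le hα hαd (hpass _ h1) (hsup _ h1 h2)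
    have hcont := (hasDerivAt_saddleBase (α := α) (hd _ h1)).continuousAt
    obtain ⟨r', hr', hr''⟩ := Metric.continuousAt_iff.1 hcont r hr
    refine ⟨min r r', lt_min hr hr', ε, hε, ?_⟩
    filter_upwards [hev] with n hn y hy
    refine hn _ (hr'' (lt_of_lt_of_le hy (min_le_right _ _))) _ ?_
    rw [Metric.mem_ball, dist_sub_right]
    exact lt_of_lt_of_le hy (min_le_left _ _)
  have hchain : Tendsto (fun n : ℕ =>
      headRatio P ⌊α * n⌋₊ n (saddleBase P α (w₀ + (1 : ℝ) * b)) (w₀ + (1 : ℝ) * b - b) -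
      headRatio P ⌊α * n⌋₊ n (saddleBase P α (w₀ + (0 : ℝ) * b)) (w₀ + (0 : ℝ) * b - b)) atTop
      (𝓝 0) := by
    refine (isPreconnected_Icc (a := (0 : ℝ)) (b := 1)).induction₂ (fun s t => Tendsto (fun n : ℕ =>
      headRatio P ⌊α * n⌋₊ n (saddleBase P α (w₀ + t * b)) (w₀ + t * b - b) -
      headRatio P ⌊α * n⌋₊ n (saddleBase P α (w₀ + s * b)) (w₀ + s * b - b)) atTop (𝓝 0))
      (fun t ht => ?_) ?_ ?_ (Set.left_mem_Icc.2 zero_le_one) (Set.right_mem_Icc.2 zero_le_one)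
    · obtain ⟨r, hr, ε, hε, hev⟩ := hloc t ht
      have hcont : Continuous fun s : ℝ => w₀ + s * b := by fun_prop
      refine Filter.Eventually.filter_mono nhdsWithin_le_nhds ?_
      filter_upwards [hcont.continuousAt.eventually_mem (Metric.ball_mem_nhds _ hr)] with s hs
      refine squeeze_zero_norm' ?_ hε
      filter_upwards [hev] with n hn
      exact hn _ hs
    · intro a b c _ _ _ h1 h2
      simpa using h1.add h2
    · intro a b _ _ h
      simpa using h.neg
  simp only [Complex.ofReal_one, one_mul, Complex.ofReal_zero, zero_mul, add_zero,
    add_sub_cancel_right] at hchain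
  obtain ⟨r, hr, ε, hε, hev⟩ := hloc 1 (Set.right_mem_Icc.2 zero_le_one)
  simp only [Complex.ofReal_one, one_mul, add_sub_cancel_right] at hev
  have hlim := hchain.add hc
  simp only [sub_add_cancel, zero_add] at hlim
  refine ⟨r, hr, fun n => ε n + ‖headRatio P ⌊α * n⌋₊ n (saddleBase P α (w₀ + b)) w₀ - c‖, ?_, ?_⟩
  · have := (tendsto_sub_nhds_zero_iff.2 hlim).norm
    simpa using hε.add this
  · filter_upwards [hev] with n hn w hw
    have h1 := hn (w + b) (by rw [Metric.mem_ball, dist_add_right]; exact hw)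
    rw [add_sub_cancel_right] at h1
    calc _ ≤ _ := norm_sub_le_norm_sub_add_norm_sub _
          (headRatio P ⌊α * n⌋₊ n (saddleBase P α (w₀ + b)) w₀) _
      _ ≤ _ := by gcongr

/-- The normalised derivative coefficient at the base of `v`. -/
noncomputable def saddleCoeff (P : ℂ[X]) (α : ℝ) (m n : ℕ) (v : ℂ) : ℂ :=
  m * (taylor (saddleBase P α v) (P ^ n)).coeff m * (v - saddleBase P α v) ^ (m - 1) / P.eval v ^ n

theorem hasDerivAt_headRatio_saddleBase {P : ℂ[X]} {α : ℝ} {m n : ℕ} {w₀ v w : ℂ}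
    (hPv : P.eval v ≠ 0) (hd : P.derivative.eval v ≠ 0) (hv : v ≠ saddleBase P α v)
    (hD₀ : saddleBaseDeriv P α w₀ ≠ 0) :
    HasDerivAt (fun v => headRatio P m n (saddleBase P α v) w)
      (saddleBaseDeriv P α w₀ * (saddleCoeff P α m n v * saddleKernel P α w₀ m n v w)) v := by
  have h := (hasDerivAt_headRatio_left (P := P) m n (saddleBase P α v) w).comp v
    (hasDerivAt_saddleBase hd)
  refine h.congr_deriv ?_
  have hv' := sub_ne_zero.2 hv
  rw [saddleCoeff, saddleKernel, div_pow, div_pow]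
  field_simp

/-- Fundamental theorem of calculus along v = w + x e: the weighted integral of the unknown
coefficient is a difference of head ratios, whose limits are known. -/
theorem integral_saddleCoeff_mul_saddleKernel {P : ℂ[X]} {α : ℝ} {m n : ℕ} {w₀ w e : ℂ} {ρ : ℝ}
    (hρ : 0 ≤ ρ) (he : e ≠ 0) (hD₀ : saddleBaseDeriv P α w₀ ≠ 0)
    (hgood : ∀ x ∈ Set.Icc (-ρ) ρ, P.eval (w + x * e) ≠ 0 ∧ P.derivative.eval (w + x * e) ≠ 0 ∧
      w + x * e ≠ saddleBase P α (w + x * e))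
    (hint : ContinuousOn (fun x : ℝ => saddleCoeff P α m n (w + x * e) *
      saddleKernel P α w₀ m n (w + x * e) w) (Set.Icc (-ρ) ρ)) :
    ∫ x in (-ρ)..ρ, saddleCoeff P α m n (w + x * e) * saddleKernel P α w₀ m n (w + x * e) w =
      (headRatio P m n (saddleBase P α (w + ρ * e)) w -
        headRatio P m n (saddleBase P α (w + (-ρ : ℝ) * e)) w) / (e * saddleBaseDeriv P α w₀) := by
  have hIcc : Set.uIcc (-ρ) ρ = Set.Icc (-ρ) ρ := Set.uIcc_of_le (by linarith)
  rw [eq_div_iff (mul_ne_zero he hD₀), mul_comm, ← intervalIntegral.integral_const_mul]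
  refine intervalIntegral.integral_eq_sub_of_hasDerivAt
    (f := fun x : ℝ => headRatio P m n (saddleBase P α (w + x * e)) w) (fun x hx => ?_) ?_
  · rw [hIcc] at hx
    obtain ⟨h1, h2, h3⟩ := hgood x hx
    have := hasDerivAt_comp_line (hasDerivAt_headRatio_saddleBase (m := m) (n := n) (w := w)
      h1 h2 h3 hD₀)
    refine this.congr_deriv ?_
    ring
  · refine ContinuousOn.intervalIntegrable ?_
    rw [hIcc]
    exact continuousOn_const.mul hint

theorem differentiableAt_saddleCoeff {P : ℂ[X]} {α : ℝ} (m n : ℕ) {v : ℂ} (hPv : P.eval v ≠ 0)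
    (hd : P.derivative.eval v ≠ 0) : DifferentiableAt ℂ (saddleCoeff P α m n) v := by
  have h1 := (hasDerivAt_saddleBase (α := α) hd).differentiableAt
  have h2 : DifferentiableAt ℂ (fun v => (taylor (saddleBase P α v) (P ^ n)).coeff m) v :=
    (hasDerivAt_coeff_taylor (P ^ n) m (saddleBase P α v)).differentiableAt.comp v h1
  exact (((differentiableAt_const _).mul h2).mul ((differentiableAt_id.sub h1).pow (m - 1))).div
    (P.differentiable.differentiableAt.pow n) (pow_ne_zero _ hPv)

theorem logDeriv_saddleCoeff {P : ℂ[X]} {α : ℝ} {m n : ℕ} (hm : 0 < m) {v : ℂ}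
    (hPv : P.eval v ≠ 0) (hd : P.derivative.eval v ≠ 0) (hv : v ≠ saddleBase P α v)
    (hA : (taylor (saddleBase P α v) (P ^ n)).coeff m ≠ 0) :
    deriv (saddleCoeff P α m n) v / saddleCoeff P α m n v =
      (m + 1) * (taylor (saddleBase P α v) (P ^ n)).coeff (m + 1) /
        (taylor (saddleBase P α v) (P ^ n)).coeff m * saddleBaseDeriv P α v +
      ((m : ℂ) - 1) * (1 - saddleBaseDeriv P α v) / (v - saddleBase P α v) -
      n * (P.derivative.eval v / P.eval v) := by
  have h1 := hasDerivAt_saddleBase (α := α) hd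
  have h2 := (hasDerivAt_coeff_taylor (P ^ n) m (saddleBase P α v)).comp v h1
  have h3 : HasDerivAt (fun v => v - saddleBase P α v) (1 - saddleBaseDeriv P α v) v :=
    (hasDerivAt_id v).sub h1
  have hv' := sub_ne_zero.2 hv
  have hm0 : (m : ℂ) ≠ 0 := by exact_mod_cast hm.ne'
  have hpow := pow_ne_zero (m - 1) hv'
  have hcast : ((m - 1 : ℕ) : ℂ) = (m : ℂ) - 1 := by rw [Nat.cast_sub hm]; simp
  have dA : logDeriv (fun v => (taylor (saddleBase P α v) (P ^ n)).coeff m) v = _ :=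
    congrArg (· / (taylor (saddleBase P α v) (P ^ n)).coeff m) h2.deriv
  have db : logDeriv (fun v => v - saddleBase P α v) v = _ :=
    congrArg (· / (v - saddleBase P α v)) h3.deriv
  have dP : logDeriv (fun v => P.eval v) v = _ :=
    congrArg (· / P.eval v) (P.hasDerivAt v).deriv
  have h4 : logDeriv (fun v => m * (taylor (saddleBase P α v) (P ^ n)).coeff m *
      (v - saddleBase P α v) ^ (m - 1) / P.eval v ^ n) v = _ :=
    logDeriv_div v (mul_ne_zero (mul_ne_zero hm0 hA) hpow) (pow_ne_zero n hPv)
      ((h2.differentiableAt.const_mul (m : ℂ)).mul (h3.differentiableAt.pow _))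
      ((P.hasDerivAt v).differentiableAt.pow n)
  rw [logDeriv_mul (f := fun v => m * (taylor (saddleBase P α v) (P ^ n)).coeff m)
    (g := fun v => (v - saddleBase P α v) ^ (m - 1)) v (mul_ne_zero hm0 hA) hpow (h2.differentiableAt.const_mul (m : ℂ))
    (h3.differentiableAt.pow _), logDeriv_const_mul v _ hm0,
    logDeriv_fun_pow h3.differentiableAt, logDeriv_fun_pow (P.hasDerivAt v).differentiableAt,
    dA, db, dP, hcast] at h4
  refine Eq.trans h4 ?_
  ring

/-- Near w₀ the pass level of ξ(v) equals |P(v)|/|v - ξ(v)|^α, so the exponential factors cancel and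
a power of n remains. -/
theorem exists_norm_saddleCoeff_le {P : ℂ[X]} {α : ℝ} (hα : 0 < α)
    (hαd : α < (P.natDegree : ℝ)) {z₀ w₀ : ℂ} (hz₀ : P.eval z₀ ≠ 0) (hw₀ : P.eval w₀ ≠ 0)
    (hcrit : (criticalPoly P α z₀).eval w₀ = 0)
    (hpass : ∀ᶠ v in 𝓝 w₀,
      passLevel P α (saddleBase P α v) = ‖P.eval v‖ / ‖v - saddleBase P α v‖ ^ α) :
    ∃ C > 0, ∀ᶠ v in 𝓝 w₀, ∀ n : ℕ, 0 < n → 0 < ⌊α * n⌋₊ →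
      ‖saddleCoeff P α ⌊α * n⌋₊ n v‖ ≤ C * n ^ 3 := by
  have hd := derivative_ne_zero_of_critical hα hcrit hw₀
  have hbase := saddleBase_eq_of_critical hcrit hd
  obtain ⟨δ, hδ, C, hC, hA⟩ := exists_norm_coeff_taylor_le hα hαd hz₀ (D := 0) le_rfl
  have hcont : ContinuousAt (saddleBase P α) w₀ := (hasDerivAt_saddleBase hd).continuousAt
  have hne : w₀ - saddleBase P α w₀ ≠ 0 := sub_saddleBase_ne_zero hα hw₀ hd
  have hnorm : ContinuousAt (fun v => (1 + ‖v - saddleBase P α v‖⁻¹) ^ 2) w₀ :=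
    (continuousAt_const.add ((continuousAt_id.sub hcont).norm.inv₀ (norm_ne_zero_iff.2 hne))).pow 2
  set K := (1 + ‖w₀ - saddleBase P α w₀‖⁻¹) ^ 2 + 1 with hK
  refine ⟨α * C * K, by positivity, ?_⟩
  filter_upwards [hpass, hnorm.eventually_le_const (show _ < K by rw [hK]; exact lt_add_one _),
    hcont.eventually_mem (Metric.closedBall_mem_nhds _ hδ),
    P.continuous.continuousAt.eventually_ne hw₀,
    P.derivative.continuous.continuousAt.eventually_ne hd] with v h1 h2 h3 h4 h5 n hn hm
  have hn1 : (1 : ℝ) ≤ n := by exact_mod_cast hn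
  set m := ⌊α * n⌋₊ with hmdef
  have hm1 : (m : ℝ) ≤ α * n := Nat.floor_le (by positivity)
  have hm2 : α * n < m + 1 := Nat.lt_floor_add_one _
  set τ := ‖v - saddleBase P α v‖ with hτ
  have hτ0 : 0 < τ := norm_pos_iff.2 (sub_saddleBase_ne_zero hα h4 h5)
  have hτα : 0 < τ ^ α := Real.rpow_pos_of_pos hτ0 _
  have hPv : 0 < ‖P.eval v‖ := norm_pos_iff.2 h4
  rw [hbase] at h3
  have h6 := hA _ h3 n hn m (by linarith) hm1
  rw [h1] at h6
  have h7 := pow_floor_sub_one_le hα hτ0 hm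
  rw [saddleCoeff, norm_div, norm_mul, norm_mul, norm_pow, norm_pow, Complex.norm_natCast,
    div_le_iff₀ (by positivity)]
  calc m * ‖(taylor (saddleBase P α v) (P ^ n)).coeff m‖ * τ ^ (m - 1)
      ≤ (α * n) * (C * n ^ 2 * (‖P.eval v‖ / τ ^ α) ^ n) * (K * (τ ^ α) ^ n) := by
        gcongr
        exact h7.trans (by gcongr)
    _ = α * C * K * n ^ 3 * ‖P.eval v‖ ^ n := by
        rw [div_pow]; field_simp

theorem continuousAt_saddleKernel {P : ℂ[X]} {α : ℝ} {w₀ v w : ℂ} (m n : ℕ)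
    (hd : P.derivative.eval v ≠ 0) (hv : v ≠ saddleBase P α v) :
    ContinuousAt (fun v => saddleKernel P α w₀ m n v w) v := by
  have h1 : ContinuousAt (saddleBase P α) v := (hasDerivAt_saddleBase hd).continuousAt
  have h2 : ContinuousAt (saddleBaseDeriv P α) v := by
    unfold saddleBaseDeriv
    exact continuousAt_const.add (((continuous_const.mul P.continuous).mul
      P.derivative.derivative.continuous).continuousAt.div
        (P.derivative.continuous.pow 2).continuousAt (pow_ne_zero _ hd))
  unfold saddleKernel
  exact ((h2.div_const _).mul (((continuousAt_const.sub h1).div (continuousAt_id.sub h1)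
    (sub_ne_zero.2 hv)).pow _)).mul ((P.continuous.continuousAt.div_const _).pow n)

theorem tendsto_logBranch_div_sq {P : ℂ[X]} {α : ℝ} (hα : 0 < α) {w₀ : ℂ} (hw₀ : P.eval w₀ ≠ 0)
    (hd₀ : P.derivative.eval w₀ ≠ 0) (hnd : saddleBaseDeriv P α w₀ ≠ 0) :
    Tendsto (fun w => logBranch P α (saddleBase P α w₀) w₀ w / (w - w₀) ^ 2) (𝓝[≠] w₀)
      (𝓝 (P.derivative.eval w₀ ^ 2 * saddleBaseDeriv P α w₀ / (2 * α * P.eval w₀ ^ 2))) := by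
  rw [Metric.tendsto_nhdsWithin_nhds]
  intro ε hε
  obtain ⟨δ, hδ, h⟩ := exists_phase_estimate hα hw₀ hd₀ hnd (half_pos hε)
  refine ⟨δ, hδ, fun {w} hw hwδ => ?_⟩
  have hne : (w - w₀) ^ 2 ≠ 0 := pow_ne_zero _ (sub_ne_zero.2 hw)
  have h1 := (h w₀ (Metric.mem_ball_self hδ) w hwδ).2.2.2.2.1
  rw [dist_eq_norm]
  refine lt_of_le_of_lt ?_ (half_lt_self hε)
  rw [div_sub' hne, norm_div, div_le_iff₀ (norm_pos_iff.2 hne), norm_pow, mul_comm ((w - w₀) ^ 2)]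
  exact h1

/-- The saddle w₀ is the pass of z₀. Its two sides carry the limits 0 and 1 of the head ratio, which
supplies the nonzero constant for the bootstrap; the resulting G_n' = o(n G_n) is translated back to
Taylor coefficients. -/
theorem exists_tendsto_coeff_ratio {P : ℂ[X]} {α : ℝ} (hα : 0 < α)
    (hαd : α < (P.natDegree : ℝ)) {z₀ : ℂ} (hz₀ : P.eval z₀ ≠ 0)
    (hnd : ∀ w, (criticalPoly P α z₀).eval w = 0 → P.eval w ≠ 0 → saddleBaseDeriv P α w ≠ 0)
    (hdist : ∀ w w', (criticalPoly P α z₀).eval w = 0 → (criticalPoly P α z₀).eval w' = 0 →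
      P.eval w ≠ 0 → P.eval w' ≠ 0 →
      ‖P.eval w‖ / ‖w - z₀‖ ^ α = ‖P.eval w'‖ / ‖w' - z₀‖ ^ α → w = w') :
    ∃ w₀, P.eval w₀ ≠ 0 ∧ P.derivative.eval w₀ ≠ 0 ∧ saddleBase P α w₀ = z₀ ∧
      (∀ᶠ n : ℕ in atTop, (taylor z₀ (P ^ n)).coeff ⌊α * n⌋₊ ≠ 0) ∧
      Tendsto (fun n : ℕ => (⌊α * n⌋₊ + 1) * (taylor z₀ (P ^ n)).coeff (⌊α * n⌋₊ + 1) /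
        (n * (taylor z₀ (P ^ n)).coeff ⌊α * n⌋₊)) atTop
        (𝓝 (P.derivative.eval w₀ / P.eval w₀)) := by
  have hαc : (α : ℂ) ≠ 0 := by exact_mod_cast hα.ne'
  have hl := passLevel_pos hα hαd hz₀
  obtain ⟨w₀, hcl1, hcl2, hlev⟩ := exists_mem_closure_basin_inter hα hαd hz₀
  have hcrit := criticalPoly_eval_eq_zero_of_mem_closure hα hz₀ hl hcl1 hcl2 hlev
  obtain ⟨hwz, hw₀, hlw⟩ := ne_and_eval_ne_zero_of_eq_level hα hz₀ hl hlev
  have hd₀ := derivative_ne_zero_of_critical hα hcrit hw₀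
  have hbase := saddleBase_eq_of_critical hcrit hd₀
  have hD₀ := hnd w₀ hcrit hw₀
  have huniq : ∀ w, (criticalPoly P α z₀).eval w = 0 →
      ‖P.eval w‖ = passLevel P α z₀ * ‖w - z₀‖ ^ α → w = w₀ := by
    intro w hwc hwl
    obtain ⟨-, h2, h3⟩ := ne_and_eval_ne_zero_of_eq_level hα hz₀ hl hwl
    exact hdist w w₀ hwc hcrit h2 hw₀ (h3.symm.trans hlw)
  have hpass := eventually_passLevel_saddleBase hα hαd hz₀ hw₀ hcrit hD₀ huniq
  obtain ⟨C, hC, hcoeff⟩ := exists_norm_saddleCoeff_le hα hαd hz₀ hw₀ hcrit hpass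
  set q := P.derivative.eval w₀ ^ 2 * saddleBaseDeriv P α w₀ / (2 * α * P.eval w₀ ^ 2) with hq
  have hq0 : q ≠ 0 := div_ne_zero (mul_ne_zero (pow_ne_zero _ hd₀) hD₀)
    (mul_ne_zero (mul_ne_zero two_ne_zero hαc) (pow_ne_zero _ hw₀))
  -- The direction e satisfies q e^2 = 1, so that the phase along x e is x^2.
  obtain ⟨e, he⟩ := IsAlgClosed.exists_pow_nat_eq q⁻¹ two_pos
  have hqe : q * e ^ 2 = 1 := by rw [he, mul_inv_cancel₀ hq0]
  have he0 : e ≠ 0 := by rintro rfl; simp at hqe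
  -- The divisor 1 + |e|^2 makes both the tolerance and its product with |e|^2 at most 1/200.
  obtain ⟨δ₁, hδ₁, hphase⟩ := exists_phase_estimate hα hw₀ hd₀ hD₀
    (show (0 : ℝ) < 1 / 200 / (1 + ‖e‖ ^ 2) by positivity)
  have hcontξ : ContinuousAt (saddleBase P α) w₀ := (hasDerivAt_saddleBase hd₀).continuousAt
  have hPξ : ∀ᶠ v in 𝓝 w₀, P.eval (saddleBase P α v) ≠ 0 :=
    hcontξ.eventually (P.continuous.continuousAt.eventually_ne (by rw [hbase]; exact hz₀))
  obtain ⟨δ₂, hδ₂, hball₂⟩ := Metric.eventually_nhds_iff_ball.1 (hpass.and (hcoeff.and hPξ))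
  set δ := min δ₁ δ₂ with hδdef
  have hδ : 0 < δ := lt_min hδ₁ hδ₂
  have hε1 : (1 / 200 / (1 + ‖e‖ ^ 2) : ℝ) ≤ 1 / 200 :=
    div_le_self (by norm_num) (by have : 0 ≤ ‖e‖ ^ 2 := by positivity
                                  linarith)
  have hε2 : (1 / 200 / (1 + ‖e‖ ^ 2) : ℝ) * ‖e‖ ^ 2 ≤ 1 / 200 := by
    rw [div_mul_eq_mul_div, div_le_iff₀ (by positivity)]
    nlinarith [sq_nonneg ‖e‖]
  have hsub1 : Metric.ball w₀ δ ⊆ Metric.ball w₀ δ₁ := Metric.ball_subset_ball (min_le_left _ _)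
  have hsub2 : Metric.ball w₀ δ ⊆ Metric.ball w₀ δ₂ := Metric.ball_subset_ball (min_le_right _ _)
  have hself : w₀ ∈ Metric.ball w₀ δ₁ := Metric.mem_ball_self hδ₁
  have hgP : ∀ v ∈ Metric.ball w₀ δ, P.eval v ≠ 0 := fun v hv => (hphase w₀ hself v (hsub1 hv)).1
  have hgd : ∀ v ∈ Metric.ball w₀ δ, P.derivative.eval v ≠ 0 :=
    fun v hv => (hphase w₀ hself v (hsub1 hv)).2.1
  have hgξ : ∀ v ∈ Metric.ball w₀ δ, v ≠ saddleBase P α v :=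
    fun v hv => (hphase v (hsub1 hv) v (hsub1 hv)).2.2.1
  have hL : ∀ v ∈ Metric.ball w₀ δ, ∀ w ∈ Metric.ball w₀ δ, ∀ x : ℝ, w - v = x * e →
      ‖logBranch P α (saddleBase P α v) v w - (x : ℂ) ^ 2‖ ≤ 1 / 200 * x ^ 2 := by
    intro v hv w hw x hx
    have h1 := (hphase v (hsub1 hv) w (hsub1 hw)).2.2.2.2.1
    rw [← hq, hx, show q * ((x : ℂ) * e) ^ 2 = (x : ℂ) ^ 2 by linear_combination (x : ℂ) ^ 2 * hqe,
      norm_mul, Complex.norm_real, Real.norm_eq_abs, mul_pow, sq_abs] at h1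
    refine h1.trans ?_
    calc _ = (1 / 200 / (1 + ‖e‖ ^ 2) : ℝ) * ‖e‖ ^ 2 * x ^ 2 := by ring
      _ ≤ _ := by gcongr
  obtain ⟨s, hs, hsides⟩ := exists_saddle_sides hα hz₀ hl hcl1 hcl2 hlev (e := e) (κ := 1)
    (by rw [← hbase]; exact tendsto_logBranch_div_sq hα hw₀ hd₀ hD₀) one_pos
    (by rw [← hq, hqe, Complex.ofReal_one])
  have hsmall : ∀ᶠ t : ℝ in 𝓝[>] 0, t * ‖e‖ < δ / 2 := by
    have : Continuous fun t : ℝ => t * ‖e‖ := by fun_prop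
    exact ((this.tendsto 0).eventually_lt_const (by simpa using half_pos hδ)).filter_mono
      nhdsWithin_le_nhds
  obtain ⟨ρ, ⟨⟨hρ1, hρ2⟩, hρδ⟩, hρ⟩ := ((hsides.and hsmall).and self_mem_nhdsWithin).exists
  have hρ0 : 0 < ρ := hρ
  -- The real part of the phase is at least x^2 - x^2/200 > 0.
  have hsup : ∀ x : ℝ, x ≠ 0 → ∀ v ∈ Metric.ball w₀ δ, v - (x : ℂ) * e ∈ Metric.ball w₀ δ →
      v - (x : ℂ) * e ∈
        superlevel P α (saddleBase P α v) (passLevel P α (saddleBase P α v)) := by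
    intro x hx v hv hvb
    rw [(hball₂ v (hsub2 hv)).1, mem_superlevel_iff_logBranch (hgP v hv) (hgξ v hv) (hgP _ hvb)
      (hphase v (hsub1 hv) _ (hsub1 hvb)).2.2.1]
    have h1 := hL v hv _ hvb (-x) (by push_cast; ring)
    have h2 := (abs_le.1 ((Complex.abs_re_le_norm _).trans h1)).1
    rw [Complex.sub_re] at h2
    have h3 : (((-x : ℝ) : ℂ) ^ 2).re = x ^ 2 := by
      rw [← Complex.ofReal_pow, Complex.ofReal_re]; ring
    rw [h3] at h2
    have h4 : 0 < x ^ 2 := by positivity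
    nlinarith
  obtain ⟨cp, cm, hne, hcp, hcm⟩ : ∃ cp cm : ℂ, cp ≠ cm ∧
      Tendsto (fun n : ℕ => headRatio P ⌊α * n⌋₊ n (saddleBase P α w₀) (w₀ - (ρ : ℝ) * e)) atTop
        (𝓝 cp) ∧
      Tendsto (fun n : ℕ => headRatio P ⌊α * n⌋₊ n (saddleBase P α w₀) (w₀ - (-ρ : ℝ) * e)) atTop
        (𝓝 cm) := by
    rw [hbase]
    have h1 := tendsto_headRatio_of_mem_basin hα hαd hz₀ hρ1
    have h0 := tendsto_headRatio_of_notMem_basin hα hαd hz₀ hρ2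
    rcases hs with rfl | rfl
    · refine ⟨0, 1, zero_ne_one, ?_, ?_⟩
      · simpa using h0
      · simpa using h1
    · refine ⟨1, 0, one_ne_zero, ?_, ?_⟩
      · simpa [sub_eq_add_neg] using h1
      · simpa [sub_eq_add_neg] using h0
  have hnρ : ∀ x : ℝ, |x| ≤ ρ → ‖(x : ℂ) * e‖ < δ / 2 := by
    intro x hx
    rw [norm_mul, Complex.norm_real, Real.norm_eq_abs]
    exact lt_of_le_of_lt (by gcongr) hρδ
  obtain ⟨rp, hrp, εp, hεp, hevp⟩ := exists_norm_headRatio_translate_sub_le hα hαd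
    (b := (ρ : ℝ) * e) ((hnρ ρ (abs_of_pos hρ0).le).trans (half_lt_self hδ)) hgd
    (fun v hv => (hball₂ v (hsub2 hv)).2.2) (hsup ρ hρ0.ne') hcp
  obtain ⟨rm, hrm, εm, hεm, hevm⟩ := exists_norm_headRatio_translate_sub_le hα hαd
    (b := (-ρ : ℝ) * e) ((hnρ (-ρ) (by rw [abs_neg, abs_of_pos hρ0])).trans (half_lt_self hδ)) hgd
    (fun v hv => (hball₂ v (hsub2 hv)).2.2) (hsup (-ρ) (neg_ne_zero.2 hρ0.ne')) hcm
  set r₁ := min (δ / 2) (min rp rm) with hr₁def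
  have hr₁ : 0 < r₁ := lt_min (half_pos hδ) (lt_min hrp hrm)
  have hmaps : ∀ w ∈ Metric.ball w₀ r₁, ∀ x ∈ Set.Icc (-ρ) ρ,
      w + (x : ℂ) * e ∈ Metric.ball w₀ δ := by
    intro w hw x hx
    have h1 := hnρ x (abs_le.2 hx)
    have h2 : ‖w - w₀‖ < δ / 2 := by
      rw [← dist_eq_norm]; exact lt_of_lt_of_le hw (min_le_left _ _)
    rw [mem_ball_iff_norm, show w + (x : ℂ) * e - w₀ = (w - w₀) + x * e by ring]
    exact (norm_add_le _ _).trans_lt (by linarith)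
  have hwδ : ∀ w ∈ Metric.ball w₀ r₁, w ∈ Metric.ball w₀ δ := fun w hw =>
    Metric.ball_subset_ball ((min_le_left _ _).trans (half_le_self hδ.le)) hw
  have hkc : ∀ (m n : ℕ), ∀ w ∈ Metric.ball w₀ r₁,
      ContinuousOn (fun x : ℝ => saddleKernel P α w₀ m n (w + x * e) w) (Set.Icc (-ρ) ρ) := by
    intro m n w hw x hx
    have hv := hmaps w hw x hx
    exact (ContinuousAt.comp (g := fun v => saddleKernel P α w₀ m n v w)
      (f := fun x : ℝ => w + x * e) (continuousAt_saddleKernel m n (hgd _ hv) (hgξ _ hv))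
      (by fun_prop)).continuousWithinAt
  have hGdiff : ∀ m n : ℕ, DifferentiableOn ℂ (saddleCoeff P α m n) (Metric.ball w₀ δ) :=
    fun m n v hv =>
      (differentiableAt_saddleCoeff m n (hgP v hv) (hgd v hv)).differentiableWithinAt
  have key := tendsto_logDeriv_of_integral_tendsto
    (G := fun n v => saddleCoeff P α ⌊α * n⌋₊ n v)
    (E := fun n w x => saddleKernel P α w₀ ⌊α * n⌋₊ n (w + x * e) w)
    (a := (cp - cm) / (e * saddleBaseDeriv P α w₀))
    (ε := fun n => (εp n + εm n) / ‖e * saddleBaseDeriv P α w₀‖)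
    hρ0 hC hδ hr₁ hmaps (fun n => hGdiff _ n)
    (by
      filter_upwards [eventually_gt_atTop 0, eventually_floor_pos hα] with n hn hm v hv
      exact (hball₂ v (hsub2 hv)).2.1 n hn hm)
    (by
      filter_upwards [eventually_floor_pos hα] with n hm w hw
      refine ⟨hkc _ n w hw, fun x hx => ?_⟩
      have hv := hmaps w hw x hx
      have h1 := hphase _ (hsub1 hv) w (hsub1 (hwδ w hw))
      have h2 := hphase w₀ hself _ (hsub1 hv)
      refine norm_saddleKernel_sub_le hm (Nat.floor_le (by positivity)) (Nat.lt_floor_add_one _)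
        (hgP _ hv) h1.1 (hgξ _ hv) h1.2.2.1 hD₀ h2.2.2.2.1 ?_ (h1.2.2.2.2.2.1.trans hε1)
        (h2.2.2.2.2.2.2.trans hε1)
      have h3 := hL _ hv w (hwδ w hw) (-x) (by push_cast; ring)
      simpa using h3)
    (by
      filter_upwards [hevp, hevm] with n hp hm w hw
      have hwp : w ∈ Metric.ball w₀ rp :=
        Metric.ball_subset_ball ((min_le_right _ _).trans (min_le_left _ _)) hw
      have hwm : w ∈ Metric.ball w₀ rm :=
        Metric.ball_subset_ball ((min_le_right _ _).trans (min_le_right _ _)) hw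
      rw [integral_saddleCoeff_mul_saddleKernel hρ0.le he0 hD₀
        (fun x hx => ⟨hgP _ (hmaps w hw x hx), hgd _ (hmaps w hw x hx), hgξ _ (hmaps w hw x hx)⟩)
        (((hGdiff _ n).continuousOn.comp (by fun_prop) fun x hx => hmaps w hw x hx).mul
          (hkc _ n w hw)), ← sub_div, norm_div]
      gcongr
      refine le_trans (le_of_eq ?_) ((norm_sub_le _ _).trans (add_le_add (hp w hwp) (hm w hwm)))
      congr 1
      ring)
    (by simpa using (hεp.add hεm).div_const ‖e * saddleBaseDeriv P α w₀‖)
    (div_ne_zero (sub_ne_zero.2 hne) (mul_ne_zero he0 hD₀))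
  obtain ⟨hGne, hGlim⟩ := key
  have hAne : ∀ᶠ n : ℕ in atTop, (taylor z₀ (P ^ n)).coeff ⌊α * n⌋₊ ≠ 0 := by
    filter_upwards [hGne] with n hn h0
    apply hn
    simp only [saddleCoeff]
    rw [hbase, h0]
    simp
  refine ⟨w₀, hw₀, hd₀, hbase, hAne, ?_⟩
  have hfloor : Tendsto (fun n : ℕ => (((⌊α * n⌋₊ : ℝ) / n : ℝ) : ℂ)) atTop (𝓝 (α : ℂ)) :=
    (Complex.continuous_ofReal.tendsto α).comp
      ((tendsto_nat_floor_mul_div_atTop hα.le).comp tendsto_natCast_atTop_atTop)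
  have hinv : Tendsto (fun n : ℕ => ((n : ℂ))⁻¹) atTop (𝓝 0) :=
    tendsto_inv_atTop_nhds_zero_nat
  have hξ0 : w₀ - z₀ ≠ 0 := sub_ne_zero.2 hwz
  have hlim := ((hGlim.sub ((hfloor.sub hinv).mul_const
    ((1 - saddleBaseDeriv P α w₀) / (w₀ - z₀)))).add_const
      (P.derivative.eval w₀ / P.eval w₀)).div_const (saddleBaseDeriv P α w₀)
  -- With D the derivative of ξ at w₀, the limiting relation is D · (ratio) + α(1 - D)/(w₀ - z₀) =
  -- P'/P; as P'/P = α/(w₀ - z₀), the nonzero D cancels.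
  have hval : (0 - (α - 0) * ((1 - saddleBaseDeriv P α w₀) / (w₀ - z₀)) +
      P.derivative.eval w₀ / P.eval w₀) / saddleBaseDeriv P α w₀ =
      P.derivative.eval w₀ / P.eval w₀ := by
    rw [eval_derivative_div_eq hα hw₀ hd₀, hbase]
    field_simp
    ring
  rw [hval] at hlim
  refine hlim.congr' ?_
  filter_upwards [hAne, eventually_floor_pos hα, eventually_gt_atTop 0] with n hA hm hn
  have hn0 : (n : ℂ) ≠ 0 := by exact_mod_cast hn.ne'
  have h1 := logDeriv_saddleCoeff (α := α) (n := n) hm hw₀ hd₀ (by rw [hbase]; exact hwz)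
    (by rw [hbase]; exact hA)
  rw [hbase] at h1
  rw [mul_comm (n : ℂ) (saddleCoeff P α ⌊α * n⌋₊ n w₀), ← div_div, h1]
  push_cast
  field_simp
  ring

/-! ### Almost every base point is generic -/

theorem exists_analyticAt_inverse {f : ℂ → ℂ} {w : ℂ} (hf : AnalyticAt ℂ f w)
    (hf' : deriv f w ≠ 0) :
    ∃ g : ℂ → ℂ, AnalyticAt ℂ g (f w) ∧ ∀ᶠ x in 𝓝 w, g (f x) = x := by
  refine ⟨hf.hasStrictDerivAt.localInverse f _ w hf', hf.analyticAt_localInverse hf', ?_⟩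
  exact hf.hasStrictDerivAt.eventually_left_inverse hf'

theorem volume_re_eq_zero : volume {u : ℂ | u.re = 0} = 0 := by
  have h := Measure.addHaar_submodule (volume : Measure ℂ) (LinearMap.ker Complex.reLm) (by
    intro h
    have : (1 : ℂ) ∈ LinearMap.ker Complex.reLm := by rw [h]; trivial
    simp at this)
  exact h

/-- Locally the set is the image of part of a line under the differentiable local inverse, and such
maps preserve null sets. -/
theorem exists_nhds_volume_re_eq_zero {Ψ : ℂ → ℂ} {z₁ : ℂ} (hΨ : AnalyticAt ℂ Ψ z₁)
    (hd : deriv Ψ z₁ ≠ 0) : ∃ N ∈ 𝓝 z₁, volume (N ∩ {z | (Ψ z).re = 0}) = 0 := by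
  obtain ⟨g, hg, hinv⟩ := exists_analyticAt_inverse hΨ hd
  obtain ⟨ρ, hρ, hball⟩ := Metric.eventually_nhds_iff_ball.1
    (Complex.analyticAt_iff_eventually_differentiableAt.1 hg)
  refine ⟨{x | g (Ψ x) = x} ∩ Ψ ⁻¹' Metric.ball (Ψ z₁) ρ,
    inter_mem hinv (hΨ.continuousAt (Metric.ball_mem_nhds _ hρ)), ?_⟩
  have hsub : ({x | g (Ψ x) = x} ∩ Ψ ⁻¹' Metric.ball (Ψ z₁) ρ) ∩ {z | (Ψ z).re = 0} ⊆
      g '' (Metric.ball (Ψ z₁) ρ ∩ {u : ℂ | u.re = 0}) := by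
    rintro x ⟨⟨h1, h2⟩, h3⟩
    exact ⟨Ψ x, ⟨h2, h3⟩, h1⟩
  refine measure_mono_null hsub ?_
  refine addHaar_image_eq_zero_of_differentiableOn_of_addHaar_eq_zero volume
    (fun u hu => ?_) (measure_mono_null Set.inter_subset_right volume_re_eq_zero)
  exact ((hball u hu.1).restrictScalars ℝ).differentiableWithinAt

theorem analyticAt_saddleBase {P : ℂ[X]} {α : ℝ} {v : ℂ} (hv : P.derivative.eval v ≠ 0) :
    AnalyticAt ℂ (saddleBase P α) v := by
  rw [Complex.analyticAt_iff_eventually_differentiableAt]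
  filter_upwards [P.derivative.continuous.continuousAt.eventually_ne hv] with x hx
  exact (hasDerivAt_saddleBase hx).differentiableAt

/-- Λ is the logarithm of the critical value as a function of z. Since w is critical, the motion of
w does not contribute to the derivative, and only the explicit dependence of -α log(w - z) on z
remains. -/
theorem exists_critical_branch {P : ℂ[X]} {α : ℝ} (hα : 0 < α) {w : ℂ} (hw : P.eval w ≠ 0)
    (hd : P.derivative.eval w ≠ 0) (hD : saddleBaseDeriv P α w ≠ 0) :
    ∃ Λ : ℂ → ℂ, AnalyticAt ℂ Λ (saddleBase P α w) ∧
      HasDerivAt Λ (α / (w - saddleBase P α w)) (saddleBase P α w) ∧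
      ∀ᶠ v in 𝓝 w, (Λ (saddleBase P α v)).re =
        Real.log (‖P.eval v‖ / ‖v - saddleBase P α v‖ ^ α) -
          Real.log (‖P.eval w‖ / ‖w - saddleBase P α w‖ ^ α) := by
  set z₁ := saddleBase P α w with hz₁
  have hwz : w - z₁ ≠ 0 := sub_saddleBase_ne_zero hα hw hd
  obtain ⟨g, hg, hinv⟩ := exists_analyticAt_inverse (analyticAt_saddleBase (α := α) hd)
    (by rw [(hasDerivAt_saddleBase hd).deriv]; exact hD)
  rw [← hz₁] at hg
  have hg0 : g z₁ = w := hinv.self_of_nhds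
  have a1 : AnalyticAt ℂ (fun z => P.eval (g z) / P.eval w) z₁ := by
    have h1 : AnalyticAt ℂ (fun x => P.eval x) (g z₁) := P.differentiable.analyticAt _
    exact (h1.comp hg).div_const
  have a2 : AnalyticAt ℂ (fun z => (g z - z) / (w - z₁)) z₁ :=
    (hg.sub analyticAt_id).div_const
  have s1 : P.eval (g z₁) / P.eval w ∈ Complex.slitPlane := by
    rw [hg0, div_self hw]; exact Complex.one_mem_slitPlane
  have s2 : (g z₁ - z₁) / (w - z₁) ∈ Complex.slitPlane := by
    rw [hg0, div_self hwz]; exact Complex.one_mem_slitPlane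
  refine ⟨fun z => Complex.log (P.eval (g z) / P.eval w) - α * Complex.log ((g z - z) / (w - z₁)),
    (a1.clog s1).sub (analyticAt_const.mul (a2.clog s2)), ?_, ?_⟩
  · have hgd := hg.differentiableAt.hasDerivAt
    have d1 := (((P.hasDerivAt (g z₁)).comp z₁ hgd).div_const (P.eval w)).clog s1
    have d2 := (((hgd.sub (hasDerivAt_id z₁)).div_const (w - z₁)).clog s2).const_mul (α : ℂ)
    refine (d1.sub d2).congr_deriv ?_
    have h1 := eval_derivative_div_eq hα hw hd
    rw [← hz₁, div_eq_div_iff hw hwz] at h1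
    simp only [Function.comp_apply, Pi.sub_apply, id, hg0]
    field_simp
    linear_combination (deriv g z₁) * h1
  · filter_upwards [hinv, P.continuous.continuousAt.eventually_ne hw,
      P.derivative.continuous.continuousAt.eventually_ne hd] with v hv hPv hdv
    have hvz := sub_saddleBase_ne_zero hα hPv hdv
    have p1 : 0 < ‖v - saddleBase P α v‖ := norm_pos_iff.2 hvz
    have p2 : 0 < ‖w - z₁‖ := norm_pos_iff.2 hwz
    have p3 := norm_pos_iff.2 hPv
    have p4 := norm_pos_iff.2 hw
    simp only [hv, Complex.sub_re, Complex.log_re, Complex.re_ofReal_mul, norm_div]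
    rw [Real.log_div p3.ne' p4.ne', Real.log_div p1.ne' p2.ne',
      Real.log_div p3.ne' (Real.rpow_pos_of_pos p1 _).ne',
      Real.log_div p4.ne' (Real.rpow_pos_of_pos p2 _).ne', Real.log_rpow p1, Real.log_rpow p2]
    ring

/-- Two distinct critical points give branches Λ and Λ' with different derivatives α/(w - z) and
α/(w' - z), so equality of their moduli is locally a null condition on z. -/
theorem volume_equal_critical_values {P : ℂ[X]} {α : ℝ} (hα : 0 < α) :
    volume {z : ℂ | ∃ w w' : ℂ, w ≠ w' ∧ (saddleBase P α w = z ∧ saddleBase P α w' = z) ∧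
      (P.eval w ≠ 0 ∧ P.eval w' ≠ 0) ∧ (P.derivative.eval w ≠ 0 ∧ P.derivative.eval w' ≠ 0) ∧
      (saddleBaseDeriv P α w ≠ 0 ∧ saddleBaseDeriv P α w' ≠ 0) ∧
      ‖P.eval w‖ / ‖w - z‖ ^ α = ‖P.eval w'‖ / ‖w' - z‖ ^ α} = 0 := by
  set T : Set (ℂ × ℂ) := {p | p.1 ≠ p.2 ∧ saddleBase P α p.2 = saddleBase P α p.1 ∧
      (P.eval p.1 ≠ 0 ∧ P.eval p.2 ≠ 0) ∧
      (P.derivative.eval p.1 ≠ 0 ∧ P.derivative.eval p.2 ≠ 0) ∧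
      (saddleBaseDeriv P α p.1 ≠ 0 ∧ saddleBaseDeriv P α p.2 ≠ 0) ∧
      ‖P.eval p.1‖ / ‖p.1 - saddleBase P α p.1‖ ^ α =
        ‖P.eval p.2‖ / ‖p.2 - saddleBase P α p.2‖ ^ α} with hT
  -- Working on pairs of critical points, with Lebesgue measure pulled back along the base point,
  -- lets second countability reduce the claim to a local one.
  have hnull : (OuterMeasure.comap (fun p : ℂ × ℂ => saddleBase P α p.1)
      (volume : Measure ℂ).toOuterMeasure) T = 0 := by
    refine measure_null_of_locally_null T ?_
    rintro ⟨w, w'⟩ ⟨hne, hbase, ⟨hw, hw'⟩, ⟨hd, hd'⟩, ⟨hD, hD'⟩, hval⟩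
    simp only at hne hbase hw hw' hd hd' hD hD' hval
    obtain ⟨Λ, hΛ, hΛd, hΛre⟩ := exists_critical_branch hα hw hd hD
    obtain ⟨Λ', hΛ', hΛd', hΛre'⟩ := exists_critical_branch hα hw' hd' hD'
    have hwz : w - saddleBase P α w ≠ 0 := sub_saddleBase_ne_zero hα hw hd
    have hwz' : w' - saddleBase P α w' ≠ 0 := sub_saddleBase_ne_zero hα hw' hd'
    rw [hbase] at hΛ' hΛd' hwz'
    have hdΨ : deriv (fun z => Λ z - Λ' z) (saddleBase P α w) ≠ 0 := by
      rw [(hΛd.fun_sub hΛd').deriv, sub_ne_zero, Ne, div_eq_div_iff hwz hwz']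
      intro h
      have := mul_left_cancel₀ (show (α : ℂ) ≠ 0 by exact_mod_cast hα.ne') h
      exact hne (sub_left_inj.1 this).symm
    obtain ⟨N, hN, hN0⟩ := exists_nhds_volume_re_eq_zero (hΛ.fun_sub hΛ') hdΨ
    have hcont : ContinuousAt (saddleBase P α) w := (hasDerivAt_saddleBase hd).continuousAt
    have hN' : ∀ᶠ v in 𝓝 w, saddleBase P α v ∈ N := hcont hN
    have hfst : Tendsto (Prod.fst : ℂ × ℂ → ℂ) (𝓝 (w, w')) (𝓝 w) := continuousAt_fst
    have hsnd : Tendsto (Prod.snd : ℂ × ℂ → ℂ) (𝓝 (w, w')) (𝓝 w') := continuousAt_snd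
    have e1 : ∀ᶠ p : ℂ × ℂ in 𝓝 (w, w'), saddleBase P α p.1 ∈ N ∧
        (Λ (saddleBase P α p.1)).re =
        Real.log (‖P.eval p.1‖ / ‖p.1 - saddleBase P α p.1‖ ^ α) -
          Real.log (‖P.eval w‖ / ‖w - saddleBase P α w‖ ^ α) :=
      hfst.eventually (hN'.and hΛre)
    have e2 : ∀ᶠ p : ℂ × ℂ in 𝓝 (w, w'), (Λ' (saddleBase P α p.2)).re =
        Real.log (‖P.eval p.2‖ / ‖p.2 - saddleBase P α p.2‖ ^ α) -
          Real.log (‖P.eval w'‖ / ‖w' - saddleBase P α w'‖ ^ α) :=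
      hsnd.eventually hΛre'
    have hmem : {p : ℂ × ℂ | saddleBase P α p.1 ∈ N ∧
        (Λ (saddleBase P α p.1) - Λ' (saddleBase P α p.1)).re = 0} ∈ 𝓝[T] (w, w') := by
      filter_upwards [e1.filter_mono nhdsWithin_le_nhds, e2.filter_mono nhdsWithin_le_nhds,
        self_mem_nhdsWithin] with p h1 h2 h3
      refine ⟨h1.1, ?_⟩
      obtain ⟨-, hb, -, -, -, hv⟩ := h3
      rw [← hb] at hv h1 ⊢
      rw [Complex.sub_re, h2, h1.2, hval]
      rw [hv]
      ring
    refine ⟨_, hmem, ?_⟩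
    rw [OuterMeasure.comap_apply]
    refine measure_mono_null ?_ hN0
    rintro _ ⟨p, ⟨h1, h2⟩, rfl⟩
    exact ⟨h1, h2⟩
  rw [OuterMeasure.comap_apply] at hnull
  refine measure_mono_null ?_ hnull
  rintro z ⟨w, w', hne, ⟨rfl, hb⟩, hP, hd, hD, hv⟩
  refine ⟨(w, w'), ⟨hne, hb, hP, hd, hD, ?_⟩, rfl⟩
  simp only [hb]
  exact hv

/-- Degenerate saddles are roots of (1 - α) P'^2 + α P P''. For α ≠ 1 this is nonzero at any root of
P, which is simple; for α = 1 it is P P'', and d > 1. -/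
theorem finite_degenerate_saddle {P : ℂ[X]} {α : ℝ} (hα : 0 < α) (hαd : α < (P.natDegree : ℝ))
    (hP : P.roots.Nodup) :
    {w : ℂ | P.derivative.eval w ≠ 0 ∧ saddleBaseDeriv P α w = 0}.Finite := by
  have hdeg := natDegree_pos_of_lt hα hαd
  have hP0 : P ≠ 0 := by rintro rfl; simp at hdeg
  set R : ℂ[X] := C (1 - α : ℂ) * derivative P ^ 2 + C (α : ℂ) * (P * derivative (derivative P))
    with hR
  have hR0 : R ≠ 0 := by
    by_cases h1 : α = 1
    · have hd2 : derivative (derivative P) ≠ 0 := by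
        intro h
        have h3 : (derivative P).natDegree = 0 := Polynomial.derivative_eq_zero.1 h
        have h4 : P.natDegree ≤ 1 := by
          have := natDegree_derivative P
          omega
        have : (P.natDegree : ℝ) ≤ 1 := by exact_mod_cast h4
        linarith
      rw [hR, h1]
      simp only [Complex.ofReal_one, sub_self, map_zero, zero_mul, zero_add, map_one, one_mul]
      exact mul_ne_zero hP0 hd2
    · obtain ⟨w, hw⟩ := Complex.exists_root (f := P) (natDegree_pos_iff_degree_pos.1 hdeg)
      have hw' := eval_derivative_ne_zero_of_nodup_roots hP0 hP hw
      intro h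
      have h2 := congrArg (eval w) h
      rw [IsRoot.def] at hw
      simp only [hR, eval_add, eval_mul, eval_C, eval_pow, hw, zero_mul, mul_zero, add_zero,
        eval_zero, mul_eq_zero] at h2
      rcases h2 with h2 | h2
      · exact h1 (by exact_mod_cast (sub_eq_zero.1 h2).symm)
      · exact hw' (pow_eq_zero_iff two_ne_zero |>.1 h2)
  refine (R.rootSet_finite ℂ).subset ?_
  rintro w ⟨hd, hD⟩
  rw [mem_rootSet]
  refine ⟨hR0, ?_⟩
  rw [saddleBaseDeriv] at hD
  simp only [hR, coe_aeval_eq_eval, eval_add, eval_mul, eval_C, eval_pow]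
  field_simp at hD
  linear_combination hD

theorem ae_generic {P : ℂ[X]} {α : ℝ} (hα : 0 < α) (hαd : α < (P.natDegree : ℝ))
    (hP : P.roots.Nodup) :
    ∀ᵐ z : ℂ, P.eval z ≠ 0 ∧
      (∀ w, (criticalPoly P α z).eval w = 0 → P.eval w ≠ 0 → saddleBaseDeriv P α w ≠ 0) ∧
      ∀ w w', (criticalPoly P α z).eval w = 0 → (criticalPoly P α z).eval w' = 0 →
        P.eval w ≠ 0 → P.eval w' ≠ 0 →
        ‖P.eval w‖ / ‖w - z‖ ^ α = ‖P.eval w'‖ / ‖w' - z‖ ^ α → w = w' := by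
  have hdeg := natDegree_pos_of_lt hα hαd
  have hP0 : P ≠ 0 := by rintro rfl; simp at hdeg
  have h1 : ∀ᵐ z : ℂ, z ∉ P.rootSet ℂ :=
    measure_eq_zero_iff_ae_notMem.1 ((P.rootSet_finite ℂ).measure_zero volume)
  have h2 : ∀ᵐ z : ℂ, z ∉ saddleBase P α ''
      {w : ℂ | P.derivative.eval w ≠ 0 ∧ saddleBaseDeriv P α w = 0} :=
    measure_eq_zero_iff_ae_notMem.1
      (((finite_degenerate_saddle hα hαd hP).image _).measure_zero volume)
  filter_upwards [h1, h2, measure_eq_zero_iff_ae_notMem.1 (volume_equal_critical_values hα (P := P))]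
    with z hz1 hz2 hz3
  have hnd : ∀ w, (criticalPoly P α z).eval w = 0 → P.eval w ≠ 0 → saddleBaseDeriv P α w ≠ 0 := by
    intro w hwc hw hD
    have hd := derivative_ne_zero_of_critical hα hwc hw
    exact hz2 ⟨w, ⟨hd, hD⟩, saddleBase_eq_of_critical hwc hd⟩
  refine ⟨fun h => hz1 (by rw [mem_rootSet]; exact ⟨hP0, by simpa using h⟩), hnd, ?_⟩
  intro w w' hwc hwc' hw hw' hv
  by_contra hne
  have hd := derivative_ne_zero_of_critical hα hwc hw
  have hd' := derivative_ne_zero_of_critical hα hwc' hw'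
  exact hz3 ⟨w, w', hne, ⟨saddleBase_eq_of_critical hwc hd, saddleBase_eq_of_critical hwc' hd'⟩,
    ⟨hw, hw'⟩, ⟨hd, hd'⟩, ⟨hnd w hwc hw, hnd w' hwc' hw'⟩, hv⟩

/-! ### Conclusion for the Rodrigues descendants -/

theorem eval_rodrigues (m n : ℕ) (P : ℂ[X]) (z : ℂ) :
    (rodrigues m n P).eval z = m.factorial * (taylor z (P ^ n)).coeff m := by
  rw [rodrigues, ← factorial_smul_hasseDeriv, LinearMap.smul_apply, taylor_coeff]
  simp

theorem eval_derivative_rodrigues (m n : ℕ) (P : ℂ[X]) (z : ℂ) :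
    (rodrigues m n P).derivative.eval z =
      m.factorial * ((m + 1) * (taylor z (P ^ n)).coeff (m + 1)) := by
  have h : (rodrigues m n P).derivative = rodrigues (m + 1) n P := by
    rw [rodrigues, rodrigues, Function.iterate_succ_apply']
  rw [h, eval_rodrigues, Nat.factorial_succ]
  push_cast
  ring

theorem rodriguesCauchy_eq_coeff_ratio {n : ℕ} (hn : n ≠ 0) (m : ℕ) (P : ℂ[X]) (z : ℂ) :
    rodriguesCauchy m n P z =
      (m + 1) * (taylor z (P ^ n)).coeff (m + 1) / (n * (taylor z (P ^ n)).coeff m) /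
        ((P.natDegree : ℂ) - m / n) := by
  have hn' : (n : ℂ) ≠ 0 := by exact_mod_cast hn
  have hm : (m.factorial : ℂ) ≠ 0 := by exact_mod_cast m.factorial_ne_zero
  have h : (P.natDegree : ℂ) * n - m = n * ((P.natDegree : ℂ) - m / n) := by
    field_simp
  rw [rodriguesCauchy, eval_rodrigues, eval_derivative_rodrigues, h,
    show (n : ℂ) * ((P.natDegree : ℂ) - m / n) * (m.factorial * (taylor z (P ^ n)).coeff m) =
      m.factorial * (n * (taylor z (P ^ n)).coeff m * ((P.natDegree : ℂ) - m / n)) by ring,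
    mul_div_mul_left _ _ hm, div_div]

theorem tendsto_floor_mul_div {α : ℝ} (hα : 0 < α) :
    Tendsto (fun n : ℕ => (⌊α * n⌋₊ : ℂ) / n) atTop (𝓝 (α : ℂ)) := by
  have h : Tendsto (fun n : ℕ => (⌊α * (n : ℝ)⌋₊ : ℝ) / (n : ℝ)) atTop (𝓝 α) :=
    (tendsto_nat_floor_mul_div_atTop hα.le).comp tendsto_natCast_atTop_atTop
  simpa [Function.comp_def] using (Complex.continuous_ofReal.tendsto α).comp h

/-- For (d - α) c = P'(w)/P(w), the critical equation says that z + α/((d - α) c) is w again. -/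
theorem logDerivEquation_of_saddle {P : ℂ[X]} {α : ℝ} (hα : 0 < α)
    (hαd : α < (P.natDegree : ℝ)) {w : ℂ} (hw : P.eval w ≠ 0) (hw' : P.derivative.eval w ≠ 0) :
    LogDerivEquation P α (saddleBase P α w)
      (P.derivative.eval w / P.eval w / ((P.natDegree : ℂ) - α)) := by
  have hα0 : (α : ℂ) ≠ 0 := by exact_mod_cast hα.ne'
  have hdα : (P.natDegree : ℂ) - α ≠ 0 := by
    rw [sub_ne_zero]; exact_mod_cast hαd.ne'
  have hc : ((P.natDegree : ℂ) - α) * (P.derivative.eval w / P.eval w / ((P.natDegree : ℂ) - α)) =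
      P.derivative.eval w / P.eval w := mul_div_cancel₀ _ hdα
  have harg : saddleBase P α w + α / (P.derivative.eval w / P.eval w) = w := by
    rw [eval_derivative_div_eq hα hw hw', div_div_cancel₀ hα0]
    ring
  refine ⟨div_ne_zero (div_ne_zero hw' hw) hdα, ?_, ?_⟩
  · rwa [hc, harg]
  · rw [hc, harg, logDeriv_apply, Polynomial.deriv]

theorem ae_exists_tendsto_rodriguesCauchy {P : ℂ[X]} {α : ℝ} (hα : 0 < α)
    (hαd : α < (P.natDegree : ℝ)) (hP : P.roots.Nodup) :
    ∀ᵐ z : ℂ, ∃ c : ℂ, (∀ᶠ n : ℕ in atTop, (rodrigues ⌊α * n⌋₊ n P).eval z ≠ 0) ∧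
      Tendsto (fun n : ℕ => rodriguesCauchy ⌊α * n⌋₊ n P z) atTop (𝓝 c) ∧
      LogDerivEquation P α z c := by
  filter_upwards [ae_generic hα hαd hP] with z ⟨hz, hnd, hdist⟩
  obtain ⟨w, hw, hw', rfl, hne, hlim⟩ := exists_tendsto_coeff_ratio hα hαd hz hnd hdist
  have hdα : (P.natDegree : ℂ) - α ≠ 0 := by
    rw [sub_ne_zero]; exact_mod_cast hαd.ne'
  refine ⟨_, ?_, ?_, logDerivEquation_of_saddle hα hαd hw hw'⟩
  · filter_upwards [hne] with n hn
    rw [eval_rodrigues]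
    exact mul_ne_zero (by exact_mod_cast Nat.factorial_ne_zero _) hn
  · refine (hlim.div ((tendsto_floor_mul_div hα).const_sub _) hdα).congr' ?_
    filter_upwards [eventually_ne_atTop 0] with n hn
    exact (rodriguesCauchy_eq_coeff_ratio hn _ P _).symm

theorem theorem1 (P : ℂ[X]) (hP : StronglyGeneric P) (α : ℝ) (hα : 0 < α)
    (hαd : α < (P.natDegree : ℝ)) :
    (∃ μ : ProbabilityMeasure ℂ,
      Tendsto (fun n : ℕ => rootCountingMeasure (rodrigues ⌊α * n⌋₊ n P)) atTop
        (𝓝 μ.toFiniteMeasure) ∧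
      ∀ᵐ z : ℂ,
        Integrable (fun ξ : ℂ => (z - ξ)⁻¹) (μ : Measure ℂ) ∧
        Tendsto (fun n : ℕ => rodriguesCauchy ⌊α * n⌋₊ n P z) atTop
          (𝓝 (cauchyTransform (μ : Measure ℂ) z)) ∧
        SymbolEquation P α z (cauchyTransform (μ : Measure ℂ) z) ∧
        LogDerivEquation P α z (cauchyTransform (μ : Measure ℂ) z)) ∧
    ∀ z c : ℂ, SymbolEquation P α z c ↔ LogDerivEquation P α z c := by
  have hiff := symbolEquation_iff_logDerivEquation hP.1 hα hαd
  refine ⟨?_, hiff⟩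
  -- The pointwise limits are chosen without regard to measurability, which follows later from
  -- almost everywhere convergence.
  obtain ⟨c, hc⟩ := (ae_exists_tendsto_rodriguesCauchy hα hαd hP.1).choice
  obtain ⟨μ, hμ, hμc⟩ := exists_tendsto_rootCountingMeasure hα hαd
    (hc.mono fun z hz => ⟨hz.1, hz.2.1⟩)
  refine ⟨μ, hμ, ?_⟩
  filter_upwards [ae_integrable_cauchyKernel (μ : Measure ℂ), hμc, hc] with z h1 h2 h3
  rw [h2]
  exact ⟨h1, h3.2.1, (hiff z (c z)).2 h3.2.2, h3.2.2⟩
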